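/- **Conventions.** Manifolds are smooth, finite dimensional, Hausdorff and second countable, without boundary. For a Lie groupoid $X_1\rightrightarrows X_0$ (source and target $s,t$, composition $m$), $X_2=\{(p,q)\in X_1\times X_1: s(p)=t(q)\}$ is the manifold of composable pairs, with $m:X_2\to X_1$ and the two projections $\mathrm{pr}_1,\mathrm{pr}_2:X_2\to X_1$. The symmetric group $S_3$ acts on $X_2$ by permuting the vertices of the commutative triangles $(p,q,m(p,q))$. A Riemannian metric on the total space of a surjective submersion $f$ is *transverse* to $f$ if, for any two points of one fibre of $f$, the identification (via $df$) of the orthogonal complements of $\ker df$ at these points is isometric; $f$ is a *Riemannian submersion* if $df$ is isometric on $(\ker df)^\perp$. A *Riemannian groupoid* $(X_1\rightrightarrows X_0,\eta)$ is a Lie groupoid with a Riemannian metric $\eta$ on $X_2$ that is $S_3$-invariant and transverse to $m$. It induces unique metrics $\eta^{(1)}$ on $X_1$ and $\eta^{(0)}$ on $X_0$ for which $m,\mathrm{pr}_1,\mathrm{pr}_2:X_2\to X_1$ and $s,t:X_1\to X_0$ are Riemannian submersions. A *Lie 2-group* is a Lie groupoid $G_1\rightrightarrows G_0$ such that $G_1,G_0$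 are Lie groups and all structural maps are homomorphisms of Lie groups. A (left) *2-action* of it on $X_1\rightrightarrows X_0$ is a pair of smooth left actions of $G_1$ on $X_1$ and of $G_0$ on $X_0$ which is a morphism of Lie groupoids $(G_1\times X_1\rightrightarrows G_0\times X_0)\to (X_1\rightrightarrows X_0)$. It is *free* (*proper*) if both actions are free (proper), and *isometric* for $\eta$ if the induced action $(g,h)\cdot(p,q)=(gp,hq)$ of $G_2$ on $X_2$ is by isometries of $\eta$. **Proposition.** Let a Lie 2-group $G_1\rightrightarrows G_0$ act freely, properly and isometrically on a Riemannian groupoid $(X_1\rightrightarrows X_0,\eta)$. Then the quotient spaces $X_1/G_1$ and $X_0/G_0$, with the quotient topologies, carry smooth structures and a structure of Riemannian groupoid $(X_1/G_1\rightrightarrows X_0/G_0,\overline\eta)$ such that the canonical projection $\pi=(\pi_1,\pi_0):(X_1\rightrightarrows X_0)\to(X_1/G_1\rightrightarrows X_0/G_0)$ is a Riemannian groupoid submersion. That is, $\pi$ is a morphism of Lie groupoids; it is a fibration (both $\pi_0$ and the map $X_1\to (X_1/G_1)\times_{X_0/G_0}X_0$, $p\mapsto(\pi_1(p),s(p))$,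 are surjective submersions); and the maps $\pi_2:X_2\to (X_1/G_1)_2$ induced by $\pi$, $\pi_1:X_1\to X_1/G_1$ and $\pi_0:X_0\to X_0/G_0$ are surjective Riemannian submersions for $\eta,\eta^{(1)},\eta^{(0)}$ and $\overline\eta,\overline\eta^{(1)},\overline\eta^{(0)}$ respectively. -/

import Mathlib

open scoped Manifold ContDiff

noncomputable section

/-! ### Riemannian metrics and Riemannian submersions

All manifolds are finite dimensional, without boundary, modelled on `EuclideanSpace ℝ (Fin d)`. -/

/-- A smooth Riemannian metric on a smooth manifold `M` of dimension `d`. -/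
abbrev RiemMetric (d : ℕ) (M : Type*) [TopologicalSpace M]
    [ChartedSpace (EuclideanSpace ℝ (Fin d)) M] [IsManifold (𝓡 d) ∞ M] :=
  Bundle.ContMDiffRiemannianMetric (𝓡 d) ∞ (EuclideanSpace ℝ (Fin d))
    (fun x : M => TangentSpace (𝓡 d) x)

section Submersions

variable {a b : ℕ} {M N : Type*}
  [TopologicalSpace M] [ChartedSpace (EuclideanSpace ℝ (Fin a)) M]
  [TopologicalSpace N] [ChartedSpace (EuclideanSpace ℝ (Fin b)) N]

/-- A surjective submersion: a smooth surjective map with everywhere surjective differential. -/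
structure IsSurjSubmersion (a b : ℕ) {M N : Type*}
    [TopologicalSpace M] [ChartedSpace (EuclideanSpace ℝ (Fin a)) M]
    [TopologicalSpace N] [ChartedSpace (EuclideanSpace ℝ (Fin b)) N] (f : M → N) : Prop where
  contMDiff : ContMDiff (𝓡 a) (𝓡 b) ∞ f
  surjective : Function.Surjective f
  mfderiv_surjective : ∀ x, Function.Surjective (mfderiv (𝓡 a) (𝓡 b) f x)

variable [IsManifold (𝓡 a) ∞ M] [IsManifold (𝓡 b) ∞ N]

/-- `v` is orthogonal to the kernel of the differential of `f` at `x`. -/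
def IsHorizontal (b : ℕ) {N : Type*} [TopologicalSpace N]
    [ChartedSpace (EuclideanSpace ℝ (Fin b)) N]
    (η : RiemMetric a M) (f : M → N) (x : M) (v : TangentSpace (𝓡 a) x) : Prop :=
  ∀ w : TangentSpace (𝓡 a) x, mfderiv (𝓡 a) (𝓡 b) f x w = 0 → η.inner x v w = 0

/-- `f : (M, η) → (N, η')` is a (surjective) Riemannian submersion: the differential of `f` is
isometric on the orthogonal complement of its kernel.  In other words `η'` is the push-forward
metric `f_* η`. -/
structure IsRiemSubmersion (η : RiemMetric a M) (η' : RiemMetric b N) (f : M → N) : Prop where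
  submersion : IsSurjSubmersion a b f
  isometric : ∀ (x : M) (v w : TangentSpace (𝓡 a) x),
    IsHorizontal b η f x v → IsHorizontal b η f x w →
      η'.inner (f x) (mfderiv (𝓡 a) (𝓡 b) f x v) (mfderiv (𝓡 a) (𝓡 b) f x w) = η.inner x v w

/-- `η` is transverse to `f`: for points `x`, `y` of one fibre, the identification of the horizontal
spaces at `x` and at `y` through the tangent space of the base is isometric.  The equations between
values of `tangentMap` say that the base points have the same image and that the tangent vectors
have the same image. -/
def IsTransverse (b : ℕ) {N : Type*} [TopologicalSpace N]
    [ChartedSpace (EuclideanSpace ℝ (Fin b)) N] (η : RiemMetric a M) (f : M → N) : Prop :=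
  ∀ (x y : M) (v₁ v₂ : TangentSpace (𝓡 a) x) (w₁ w₂ : TangentSpace (𝓡 a) y),
    IsHorizontal b η f x v₁ → IsHorizontal b η f x v₂ →
    IsHorizontal b η f y w₁ → IsHorizontal b η f y w₂ →
    tangentMap (𝓡 a) (𝓡 b) f ⟨x, v₁⟩ = tangentMap (𝓡 a) (𝓡 b) f ⟨y, w₁⟩ →
    tangentMap (𝓡 a) (𝓡 b) f ⟨x, v₂⟩ = tangentMap (𝓡 a) (𝓡 b) f ⟨y, w₂⟩ →
    η.inner x v₁ v₂ = η.inner y w₁ w₂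

/-- The self-map `f` of `M` preserves the metric `η`, that is, `f^* η = η`. -/
def PreservesMetric (η : RiemMetric a M) (f : M → M) : Prop :=
  ∀ (x : M) (v w : TangentSpace (𝓡 a) x),
    η.inner (f x) (mfderiv (𝓡 a) (𝓡 a) f x v) (mfderiv (𝓡 a) (𝓡 a) f x w) = η.inner x v w

end Submersions

/-! ### Groupoids -/

/-- A groupoid with arrows `X₁` and objects `X₀`.  The composite `comp p q` is defined when the
source of `p` is the target of `q`. -/
structure GroupoidStr (X₁ X₀ : Type*) where
  src : X₁ → X₀
  tgt : X₁ → X₀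
  unit : X₀ → X₁
  inv : X₁ → X₁
  comp : ∀ p q : X₁, src p = tgt q → X₁
  src_unit : ∀ x, src (unit x) = x
  tgt_unit : ∀ x, tgt (unit x) = x
  src_inv : ∀ p, src (inv p) = tgt p
  tgt_inv : ∀ p, tgt (inv p) = src p
  src_comp : ∀ p q h, src (comp p q h) = src q
  tgt_comp : ∀ p q h, tgt (comp p q h) = tgt p
  comp_assoc : ∀ p q r (h : src p = tgt q) (k : src q = tgt r),
    comp (comp p q h) r ((src_comp p q h).trans k) =
      comp p (comp q r k) (h.trans (tgt_comp q r k).symm)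
  comp_unit : ∀ p, comp p (unit (src p)) (tgt_unit _).symm = p
  unit_comp : ∀ p, comp (unit (tgt p)) p (src_unit _) = p
  comp_inv : ∀ p, comp p (inv p) (tgt_inv p).symm = unit (tgt p)
  inv_comp : ∀ p, comp (inv p) p (src_inv p) = unit (src p)

namespace GroupoidStr

variable {X₁ X₀ Y₁ Y₀ : Type*}

/-- The set `X₂` of pairs of composable arrows. -/
def Comp (𝒳 : GroupoidStr X₁ X₀) : Type _ := {pq : X₁ × X₁ // 𝒳.src pq.1 = 𝒳.tgt pq.2}

instance (𝒳 : GroupoidStr X₁ X₀) [TopologicalSpace X₁] : TopologicalSpace 𝒳.Comp :=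
  inferInstanceAs (TopologicalSpace {pq : X₁ × X₁ // 𝒳.src pq.1 = 𝒳.tgt pq.2})

/-- The composition `X₂ → X₁`. -/
def compMap (𝒳 : GroupoidStr X₁ X₀) (x : 𝒳.Comp) : X₁ := 𝒳.comp x.1.1 x.1.2 x.2

/-- The first projection `X₂ → X₁`. -/
def fstMap (𝒳 : GroupoidStr X₁ X₀) (x : 𝒳.Comp) : X₁ := x.1.1

/-- The second projection `X₂ → X₁`. -/
def sndMap (𝒳 : GroupoidStr X₁ X₀) (x : 𝒳.Comp) : X₁ := x.1.2

/-- The pair `(p, q)` is a commutative triangle with vertices `t(p)`, `s(p) = t(q)`, `s(q)`, numbered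
`0`, `1`, `2`.  This is the side from vertex `2` to vertex `i`. -/
def toVertex (𝒳 : GroupoidStr X₁ X₀) (x : 𝒳.Comp) : Fin 3 → X₁ :=
  ![𝒳.compMap x, x.1.2, 𝒳.unit (𝒳.src x.1.2)]

theorem src_toVertex (𝒳 : GroupoidStr X₁ X₀) (x : 𝒳.Comp) (i : Fin 3) :
    𝒳.src (𝒳.toVertex x i) = 𝒳.src x.1.2 := by
  fin_cases i
  · exact 𝒳.src_comp _ _ _
  · rfl
  · exact 𝒳.src_unit _

/-- The side of the triangle `x` from vertex `j` to vertex `i`. -/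
def edge (𝒳 : GroupoidStr X₁ X₀) (x : 𝒳.Comp) (i j : Fin 3) : X₁ :=
  𝒳.comp (𝒳.toVertex x i) (𝒳.inv (𝒳.toVertex x j))
    (by rw [𝒳.tgt_inv, src_toVertex, src_toVertex])

/-- The action of the symmetric group `S₃` on `X₂` by permuting the vertices of triangles. -/
def permute (𝒳 : GroupoidStr X₁ X₀) (σ : Equiv.Perm (Fin 3)) (x : 𝒳.Comp) : 𝒳.Comp :=
  ⟨(𝒳.edge x (σ 0) (σ 1), 𝒳.edge x (σ 1) (σ 2)), by
    simp only [edge, 𝒳.src_comp, 𝒳.tgt_comp, 𝒳.src_inv]⟩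

/-- The product of two groupoids. -/
def prod (𝒳 : GroupoidStr X₁ X₀) (𝒴 : GroupoidStr Y₁ Y₀) :
    GroupoidStr (X₁ × Y₁) (X₀ × Y₀) where
  src p := (𝒳.src p.1, 𝒴.src p.2)
  tgt p := (𝒳.tgt p.1, 𝒴.tgt p.2)
  unit x := (𝒳.unit x.1, 𝒴.unit x.2)
  inv p := (𝒳.inv p.1, 𝒴.inv p.2)
  comp p q h := (𝒳.comp p.1 q.1 (congrArg Prod.fst h), 𝒴.comp p.2 q.2 (congrArg Prod.snd h))
  src_unit x := Prod.ext (𝒳.src_unit _) (𝒴.src_unit _)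
  tgt_unit x := Prod.ext (𝒳.tgt_unit _) (𝒴.tgt_unit _)
  src_inv p := Prod.ext (𝒳.src_inv _) (𝒴.src_inv _)
  tgt_inv p := Prod.ext (𝒳.tgt_inv _) (𝒴.tgt_inv _)
  src_comp p q h := Prod.ext (𝒳.src_comp _ _ _) (𝒴.src_comp _ _ _)
  tgt_comp p q h := Prod.ext (𝒳.tgt_comp _ _ _) (𝒴.tgt_comp _ _ _)
  comp_assoc p q r h k := Prod.ext
    (𝒳.comp_assoc _ _ _ (congrArg Prod.fst h) (congrArg Prod.fst k))
    (𝒴.comp_assoc _ _ _ (congrArg Prod.snd h) (congrArg Prod.snd k))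
  comp_unit p := Prod.ext (𝒳.comp_unit _) (𝒴.comp_unit _)
  unit_comp p := Prod.ext (𝒳.unit_comp _) (𝒴.unit_comp _)
  comp_inv p := Prod.ext (𝒳.comp_inv _) (𝒴.comp_inv _)
  inv_comp p := Prod.ext (𝒳.inv_comp _) (𝒴.inv_comp _)

/-- `(φ₁, φ₀)` is a morphism of groupoids: it commutes with sources and targets and preserves
composition (hence also units and inverses). -/
structure IsHom (𝒳 : GroupoidStr X₁ X₀) (𝒴 : GroupoidStr Y₁ Y₀)
    (φ₁ : X₁ → Y₁) (φ₀ : X₀ → Y₀) : Prop where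
  src : ∀ p, 𝒴.src (φ₁ p) = φ₀ (𝒳.src p)
  tgt : ∀ p, 𝒴.tgt (φ₁ p) = φ₀ (𝒳.tgt p)
  comp : ∀ p q (h : 𝒳.src p = 𝒳.tgt q),
    φ₁ (𝒳.comp p q h) =
      𝒴.comp (φ₁ p) (φ₁ q) ((src p).trans ((congrArg φ₀ h).trans (tgt q).symm))

/-- The map `X₂ → Y₂` induced by a morphism. -/
def IsHom.map₂ {𝒳 : GroupoidStr X₁ X₀} {𝒴 : GroupoidStr Y₁ Y₀} {φ₁ : X₁ → Y₁} {φ₀ : X₀ → Y₀}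
    (h : IsHom 𝒳 𝒴 φ₁ φ₀) (x : 𝒳.Comp) : 𝒴.Comp :=
  ⟨(φ₁ x.1.1, φ₁ x.1.2), (h.src _).trans ((congrArg φ₀ x.2).trans (h.tgt _).symm)⟩

end GroupoidStr

/-! ### Lie groupoids -/

/-- A Lie groupoid `X₁ ⇉ X₀` (Hausdorff and second countable, `d₁ = dim X₁`, `d₀ = dim X₀`).
The set `X₂` of composable pairs carries its (unique) structure of embedded submanifold of
`X₁ × X₁`, recorded by `charts₂` (with `d₂ = dim X₂`): the inclusion is a smooth
immersion, and it is a topological embedding because `X₂` has the subspace topology. -/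
structure LieGroupoid (d₁ d₀ d₂ : ℕ) (X₁ X₀ : Type*)
    [TopologicalSpace X₁] [ChartedSpace (EuclideanSpace ℝ (Fin d₁)) X₁] [IsManifold (𝓡 d₁) ∞ X₁]
    [TopologicalSpace X₀] [ChartedSpace (EuclideanSpace ℝ (Fin d₀)) X₀] [IsManifold (𝓡 d₀) ∞ X₀]
    extends GroupoidStr X₁ X₀ where
  t2_arrows : T2Space X₁
  t2_objects : T2Space X₀
  secondCountable_arrows : SecondCountableTopology X₁
  secondCountable_objects : SecondCountableTopology X₀
  src_submersion : IsSurjSubmersion d₁ d₀ src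
  tgt_submersion : IsSurjSubmersion d₁ d₀ tgt
  contMDiff_unit : ContMDiff (𝓡 d₀) (𝓡 d₁) ∞ unit
  contMDiff_inv : ContMDiff (𝓡 d₁) (𝓡 d₁) ∞ inv
  charts₂ : ChartedSpace (EuclideanSpace ℝ (Fin d₂)) toGroupoidStr.Comp
  isManifold₂ : IsManifold (𝓡 d₂) ∞ toGroupoidStr.Comp
  contMDiff_incl₂ : ContMDiff (𝓡 d₂) ((𝓡 d₁).prod (𝓡 d₁)) ∞
    (fun x : toGroupoidStr.Comp => (x.1 : X₁ × X₁))
  immersion_incl₂ : ∀ x, Function.Injective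
    (mfderiv (𝓡 d₂) ((𝓡 d₁).prod (𝓡 d₁)) (fun x : toGroupoidStr.Comp => (x.1 : X₁ × X₁)) x)
  contMDiff_comp : ContMDiff (𝓡 d₂) (𝓡 d₁) ∞ toGroupoidStr.compMap

namespace LieGroupoid

variable {d₁ d₀ d₂ : ℕ} {X₁ X₀ : Type*}
  [TopologicalSpace X₁] [ChartedSpace (EuclideanSpace ℝ (Fin d₁)) X₁] [IsManifold (𝓡 d₁) ∞ X₁]
  [TopologicalSpace X₀] [ChartedSpace (EuclideanSpace ℝ (Fin d₀)) X₀] [IsManifold (𝓡 d₀) ∞ X₀]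

instance (𝒳 : LieGroupoid d₁ d₀ d₂ X₁ X₀) :
    ChartedSpace (EuclideanSpace ℝ (Fin d₂)) 𝒳.toGroupoidStr.Comp := 𝒳.charts₂

instance (𝒳 : LieGroupoid d₁ d₀ d₂ X₁ X₀) : IsManifold (𝓡 d₂) ∞ 𝒳.toGroupoidStr.Comp :=
  𝒳.isManifold₂

/-- `η` is a `2`-metric on `X₁ ⇉ X₀`: a Riemannian metric on `X₂` invariant under the action of `S₃`
and transverse to the composition.  A Riemannian groupoid is a Lie groupoid with a `2`-metric. -/
structure IsTwoMetric (𝒳 : LieGroupoid d₁ d₀ d₂ X₁ X₀)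
    (η : RiemMetric d₂ 𝒳.toGroupoidStr.Comp) : Prop where
  invariant : ∀ σ : Equiv.Perm (Fin 3), PreservesMetric η (𝒳.permute σ)
  transverse : IsTransverse d₁ η 𝒳.compMap

/-- `η₁` and `η₀` are the metrics on `X₁` and `X₀` induced by the metric `η` on `X₂`, by push-forward
along each of the face maps. -/
structure AreInducedMetrics (𝒳 : LieGroupoid d₁ d₀ d₂ X₁ X₀)
    (η : RiemMetric d₂ 𝒳.toGroupoidStr.Comp) (η₁ : RiemMetric d₁ X₁) (η₀ : RiemMetric d₀ X₀) :
    Prop where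
  comp : IsRiemSubmersion η η₁ 𝒳.compMap
  fst : IsRiemSubmersion η η₁ 𝒳.fstMap
  snd : IsRiemSubmersion η η₁ 𝒳.sndMap
  src : IsRiemSubmersion η₁ η₀ 𝒳.src
  tgt : IsRiemSubmersion η₁ η₀ 𝒳.tgt

variable {e₁ e₀ e₂ : ℕ} {Y₁ Y₀ : Type*}
  [TopologicalSpace Y₁] [ChartedSpace (EuclideanSpace ℝ (Fin e₁)) Y₁] [IsManifold (𝓡 e₁) ∞ Y₁]
  [TopologicalSpace Y₀] [ChartedSpace (EuclideanSpace ℝ (Fin e₀)) Y₀] [IsManifold (𝓡 e₀) ∞ Y₀]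

/-- A morphism of Lie groupoids. -/
structure IsLieHom (𝒳 : LieGroupoid d₁ d₀ d₂ X₁ X₀) (𝒴 : LieGroupoid e₁ e₀ e₂ Y₁ Y₀)
    (φ₁ : X₁ → Y₁) (φ₀ : X₀ → Y₀) : Prop
    extends GroupoidStr.IsHom 𝒳.toGroupoidStr 𝒴.toGroupoidStr φ₁ φ₀ where
  contMDiff_arrows : ContMDiff (𝓡 d₁) (𝓡 e₁) ∞ φ₁
  contMDiff_objects : ContMDiff (𝓡 d₀) (𝓡 e₀) ∞ φ₀

/-- A fibration of Lie groupoids: a morphism such that `φ₀` is a surjective submersion and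
`X₁ → Y₁ ×_{Y₀} X₀`, `p ↦ (φ₁ p, s(p))`, is a surjective submersion.  The tangent space of the fibre
product is the fibre product of the tangent spaces, which gives the last field. -/
structure IsFibration (𝒳 : LieGroupoid d₁ d₀ d₂ X₁ X₀) (𝒴 : LieGroupoid e₁ e₀ e₂ Y₁ Y₀)
    (φ₁ : X₁ → Y₁) (φ₀ : X₀ → Y₀) : Prop extends IsLieHom 𝒳 𝒴 φ₁ φ₀ where
  submersion_objects : IsSurjSubmersion d₀ e₀ φ₀
  lift : ∀ (r : Y₁) (x : X₀), 𝒴.src r = φ₀ x → ∃ p, φ₁ p = r ∧ 𝒳.src p = x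
  mfderiv_lift : ∀ (p : X₁) (v : TangentSpace (𝓡 e₁) (φ₁ p)) (w : TangentSpace (𝓡 d₀) (𝒳.src p)),
    (mfderiv (𝓡 e₁) (𝓡 e₀) 𝒴.src (φ₁ p) v : EuclideanSpace ℝ (Fin e₀)) =
        mfderiv (𝓡 d₀) (𝓡 e₀) φ₀ (𝒳.src p) w →
      ∃ u : TangentSpace (𝓡 d₁) p,
        mfderiv (𝓡 d₁) (𝓡 e₁) φ₁ p u = v ∧ mfderiv (𝓡 d₁) (𝓡 d₀) 𝒳.src p u = w

/-- `(φ₁, φ₀) : (X₁ ⇉ X₀, η) → (Y₁ ⇉ Y₀, ε)` is a Riemannian submersion of Riemannian groupoids: a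
fibration of Lie groupoids such that `X₂ → Y₂`, `X₁ → Y₁` and `X₀ → Y₀` are Riemannian
submersions for the metrics `η`, `ε` and the metrics that they induce. -/
structure IsRiemGroupoidSubmersion (𝒳 : LieGroupoid d₁ d₀ d₂ X₁ X₀)
    (𝒴 : LieGroupoid e₁ e₀ e₂ Y₁ Y₀) (η : RiemMetric d₂ 𝒳.toGroupoidStr.Comp)
    (ε : RiemMetric e₂ 𝒴.toGroupoidStr.Comp) (φ₁ : X₁ → Y₁) (φ₀ : X₀ → Y₀) : Prop
    extends IsFibration 𝒳 𝒴 φ₁ φ₀ where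
  riemSubmersion₂ : IsRiemSubmersion η ε toIsHom.map₂
  riemSubmersion_induced : ∃ (η₁ : RiemMetric d₁ X₁) (η₀ : RiemMetric d₀ X₀)
    (ε₁ : RiemMetric e₁ Y₁) (ε₀ : RiemMetric e₀ Y₀),
    𝒳.AreInducedMetrics η η₁ η₀ ∧ 𝒴.AreInducedMetrics ε ε₁ ε₀ ∧
      IsRiemSubmersion η₁ ε₁ φ₁ ∧ IsRiemSubmersion η₀ ε₀ φ₀

end LieGroupoid

/-! ### Lie 2-groups and their actions -/

section Actions

variable {k₁ k₀ k₂ d₁ d₀ d₂ : ℕ} {G₁ G₀ X₁ X₀ : Type*}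
  [Group G₁] [TopologicalSpace G₁] [ChartedSpace (EuclideanSpace ℝ (Fin k₁)) G₁]
  [LieGroup (𝓡 k₁) ∞ G₁]
  [Group G₀] [TopologicalSpace G₀] [ChartedSpace (EuclideanSpace ℝ (Fin k₀)) G₀]
  [LieGroup (𝓡 k₀) ∞ G₀]
  [TopologicalSpace X₁] [ChartedSpace (EuclideanSpace ℝ (Fin d₁)) X₁] [IsManifold (𝓡 d₁) ∞ X₁]
  [TopologicalSpace X₀] [ChartedSpace (EuclideanSpace ℝ (Fin d₀)) X₀] [IsManifold (𝓡 d₀) ∞ X₀]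

/-- A Lie groupoid `G₁ ⇉ G₀` between Lie groups is a Lie 2-group if its structural maps are group
homomorphisms.  For the composition this is the interchange law
`(g * h) · (g' * h') = (g · g') * (h · h')`: the pair of multiplications of `G₁` and `G₀` is a
morphism of groupoids. -/
structure IsLieTwoGroup (𝒢 : LieGroupoid k₁ k₀ k₂ G₁ G₀) : Prop where
  src_mul : ∀ g h, 𝒢.src (g * h) = 𝒢.src g * 𝒢.src h
  tgt_mul : ∀ g h, 𝒢.tgt (g * h) = 𝒢.tgt g * 𝒢.tgt h
  unit_mul : ∀ g h, 𝒢.unit (g * h) = 𝒢.unit g * 𝒢.unit h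
  inv_mul : ∀ g h, 𝒢.inv (g * h) = 𝒢.inv g * 𝒢.inv h
  comp_mul : (𝒢.toGroupoidStr.prod 𝒢.toGroupoidStr).IsHom 𝒢.toGroupoidStr
    (fun g => g.1 * g.2) (fun g => g.1 * g.2)

variable [MulAction G₁ X₁] [MulAction G₀ X₀]

/-- The actions of `G₁` on `X₁` and of `G₀` on `X₀` form a (left) 2-action of `G₁ ⇉ G₀` on
`X₁ ⇉ X₀`: they are smooth and define a morphism of groupoids
`(G₁ × X₁ ⇉ G₀ × X₀) → (X₁ ⇉ X₀)`. -/
structure IsTwoAction (𝒢 : LieGroupoid k₁ k₀ k₂ G₁ G₀) (𝒳 : LieGroupoid d₁ d₀ d₂ X₁ X₀) :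
    Prop where
  smooth_arrows : ContMDiffSMul (𝓡 k₁) (𝓡 d₁) ∞ G₁ X₁
  smooth_objects : ContMDiffSMul (𝓡 k₀) (𝓡 d₀) ∞ G₀ X₀
  isHom : (𝒢.toGroupoidStr.prod 𝒳.toGroupoidStr).IsHom 𝒳.toGroupoidStr
    (fun gp => gp.1 • gp.2) (fun gx => gx.1 • gx.2)

/-- The action of `G₂` on `X₂`, `(g, h) · (p, q) = (g · p, h · q)`. -/
def IsTwoAction.act₂ {𝒢 : LieGroupoid k₁ k₀ k₂ G₁ G₀} {𝒳 : LieGroupoid d₁ d₀ d₂ X₁ X₀}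
    (θ : IsTwoAction 𝒢 𝒳) (g : 𝒢.toGroupoidStr.Comp) (x : 𝒳.toGroupoidStr.Comp) :
    𝒳.toGroupoidStr.Comp :=
  θ.isHom.map₂ ⟨((g.1.1, x.1.1), (g.1.2, x.1.2)), Prod.ext g.2 x.2⟩

/-- The 2-action is isometric for the metric `η` on `X₂`: `G₂` acts on `X₂` by isometries. -/
def IsTwoAction.IsIsometric {𝒢 : LieGroupoid k₁ k₀ k₂ G₁ G₀} {𝒳 : LieGroupoid d₁ d₀ d₂ X₁ X₀}
    (θ : IsTwoAction 𝒢 𝒳) (η : RiemMetric d₂ 𝒳.toGroupoidStr.Comp) : Prop :=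
  ∀ g : 𝒢.toGroupoidStr.Comp, PreservesMetric η (θ.act₂ g)

end Actions

/-- An action is free if only the neutral element has fixed points. -/
def IsFreeAction (G X : Type*) [Group G] [MulAction G X] : Prop :=
  ∀ (g : G) (x : X), g • x = x → g = 1

end

/-!
The quotient of a Riemannian groupoid `X₁ ⇉ X₀` by a free, proper and isometric 2-action of a Lie
2-group `G₁ ⇉ G₀`.

*Smooth structures.* A space that is locally a smooth retract of a manifold, with retractions of
constant rank, is a manifold (`exists_isManifold_of_local_retracts`).  A free and proper action
has slices (`exists_slice`), which give local sections of the projection to the orbits; so `X₁/G₁`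
and `X₀/G₀` are manifolds, the projections `π₁`, `π₀` are submersions, and their vertical vectors
are tangent to orbits (`exists_isManifold_orbit_quotient`).  In the same way the composable pairs
of a groupoid whose source and target are submersions form a manifold (`exists_isManifold_comp`).

*The quotient groupoid.* Units of `G₁` move an arrow of `X₁` so that its source or target becomes
any prescribed point of its orbit; so every composable pair of orbits has a composable pair of
representatives.  As `G₀` acts freely on `X₀`, any two such pairs differ by an element of `G₂`, so
that orbits can be composed (`quotComp_orbitProj`), and the fibres of `π₂ : X₂ → (X₁/G₁)₂` are
the orbits of `G₂` (`exists_act₂_eq`).  The projection is a fibration: a lift along `π₁` of a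
tangent vector gets the prescribed source after adding a vector tangent to a `G₁`-orbit, since
`G₁ → G₀` is a submersion (`exists_differential_lift`).  Hence also `π₂` is a submersion
(`isSurjSubmersion_map₂`), and smoothness of the structure maps descends along the projections
(`exists_quotient_lieGroupoid`).

*Metrics.* A metric can be pushed forward along a surjective submersion if it is transverse to it
(`exists_isRiemSubmersion_of_isTransverse`); the result is smooth because the push-forward is
dual to the restriction of the dual metric along the transpose of the differential
(`pushforwardForm`).  A 2-metric `η` induces metrics on arrows and objects: it is transverse to
the composition, hence by symmetry to the projections, and the metric on the arrows is transverse
to the source because two arrows with one source are sides of a triangle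
(`IsTwoMetric.exists_areInducedMetrics`).  The group `G₂` acts by isometries of `η`, transitively
on the fibres of `π₂`, so `η` is transverse to `π₂` (`isTransverse_of_isometries`) and pushes
forward to a metric `ε`; likewise `η₁` is pushed forward along `π₁`.

*Conclusion.* If `f` and `g ∘ f` are Riemannian submersions, so is `g`
(`IsRiemSubmersion.of_comp`).  Applied to the commutative squares formed by the projections and
the symmetries, the compositions or the source maps, this shows that `ε` is symmetric and
transverse to the composition, and that `π₁` and `π₀` are Riemannian submersions for the metrics
induced by `η` and `ε` (`IsFibration.isRiemGroupoidSubmersion`).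
-/


/-! ### Consequences of the inverse function theorem -/

section InverseFunction

variable {E F : Type*} [NormedAddCommGroup E] [NormedSpace ℝ E] [FiniteDimensional ℝ E]
  [NormedAddCommGroup F] [NormedSpace ℝ F] [FiniteDimensional ℝ F]
  {H K : Type*} [TopologicalSpace H] [TopologicalSpace K]
  {I : ModelWithCorners ℝ E H} {J : ModelWithCorners ℝ F K} [I.Boundaryless] [J.Boundaryless]
  {M N : Type*} [TopologicalSpace M] [ChartedSpace H M] [IsManifold I ∞ M]
  [TopologicalSpace N] [ChartedSpace K N] [IsManifold J ∞ N]

open Filter Topology Set Function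

/-- The inverse function theorem on manifolds without boundary. -/
theorem exists_local_inverse_of_mfderiv_bijective {f : M → N} {x : M}
    (hf : ∀ᶠ x' in 𝓝 x, ContMDiffAt I J ∞ f x') (hb : Bijective (mfderiv I J f x)) :
    ∃ h : N → M, h (f x) = x ∧ (∀ᶠ y in 𝓝 (f x), ContMDiffAt J I ∞ h y) ∧
      (∀ᶠ x' in 𝓝 x, h (f x') = x') ∧ ∀ᶠ y in 𝓝 (f x), f (h y) = y := by
  have : CompleteSpace E := FiniteDimensional.complete ℝ E
  have hfx : ContMDiffAt I J ∞ f x := hf.self_of_nhds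
  have hφx : (extChartAt I x).symm (extChartAt I x x) = x := extChartAt_to_inv x
  have hφ : ∀ᶠ u in 𝓝 (extChartAt I x x),
      ContMDiffAt 𝓘(ℝ, E) I ∞ (extChartAt I x).symm u := by
    filter_upwards [(isOpen_extChartAt_target (I := I) x).mem_nhds (mem_extChartAt_target x)]
      with u hu
    exact (contMDiffOn_extChartAt_symm x).contMDiffAt
      ((isOpen_extChartAt_target (I := I) x).mem_nhds hu)
  have hφc : ContinuousAt (extChartAt I x).symm (extChartAt I x x) :=
    hφ.self_of_nhds.continuousAt
  have hψ : ∀ᶠ y in 𝓝 (f x), ContMDiffAt J 𝓘(ℝ, F) ∞ (extChartAt J (f x)) y := by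
    filter_upwards [(chartAt K (f x)).open_source.mem_nhds (mem_chart_source K (f x))] with y hy
    exact contMDiffAt_extChartAt' hy
  have hψc : ContinuousAt (extChartAt J (f x)) (f x) := hψ.self_of_nhds.continuousAt
  set A : E → F := writtenInExtChartAt I J x f with hA
  have hAx : A (extChartAt I x x) = extChartAt J (f x) (f x) := by
    simp [hA, writtenInExtChartAt]
  have hAev : ∀ᶠ u in 𝓝 (extChartAt I x x), ContDiffAt ℝ ∞ A u := by
    have h1 : ∀ᶠ u in 𝓝 (extChartAt I x x), ContMDiffAt I J ∞ f ((extChartAt I x).symm u) :=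
      hφc.eventually (by rwa [hφx])
    have h2 : ∀ᶠ u in 𝓝 (extChartAt I x x),
        ContMDiffAt J 𝓘(ℝ, F) ∞ (extChartAt J (f x)) (f ((extChartAt I x).symm u)) := by
      have h3 : ContinuousAt (fun u => f ((extChartAt I x).symm u)) (extChartAt I x x) := by
        refine ContinuousAt.comp (g := f) ?_ hφc
        rw [hφx]
        exact hfx.continuousAt
      exact h3.eventually (by simp only [hφx]; exact hψ)
    filter_upwards [hφ, h1, h2] with u h3 h4 h5
    exact contMDiffAt_iff_contDiffAt.1 ((h5.comp _ h4).comp u h3)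
  have hAsm : ContDiffAt ℝ ∞ A (extChartAt I x x) := hAev.self_of_nhds
  have hd : fderiv ℝ A (extChartAt I x x) = mfderiv I J f x := by
    have h1 : HasFDerivWithinAt A (show E →L[ℝ] F from mfderiv I J f x) (range I)
      (extChartAt I x x) := (hfx.mdifferentiableAt (by simp)).hasMFDerivAt.2
    rw [I.range_eq_univ, hasFDerivWithinAt_univ] at h1
    exact h1.fderiv
  let L : E ≃L[ℝ] F := (LinearEquiv.ofBijective (fderiv ℝ A (extChartAt I x x)).toLinearMap
    (by rw [hd]; exact hb)).toContinuousLinearEquiv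
  have hLA : (L : E →L[ℝ] F) = fderiv ℝ A (extChartAt I x x) := by ext v; rfl
  have hL : HasFDerivAt A (L : E →L[ℝ] F) (extChartAt I x x) := by
    rw [hLA]
    exact (hAsm.differentiableAt (by simp)).hasFDerivAt
  have hs : HasStrictFDerivAt A (L : E →L[ℝ] F) (extChartAt I x x) :=
    hAsm.hasStrictFDerivAt' hL (by simp)
  let e := hs.toOpenPartialHomeomorph A
  have hB1 : ∀ᶠ u in 𝓝 (extChartAt I x x), e.symm (A u) = u := hs.eventually_left_inverse
  have hB2 : ∀ᶠ u in 𝓝 (A (extChartAt I x x)), A (e.symm u) = u := hs.eventually_right_inverse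
  have hBx : e.symm (A (extChartAt I x x)) = extChartAt I x x := hB1.self_of_nhds
  have hBc : ContinuousAt e.symm (A (extChartAt I x x)) := hs.localInverse_continuousAt
  have hinv : ∀ᶠ u in 𝓝 (extChartAt I x x), ∃ L' : E ≃L[ℝ] F, L' = fderiv ℝ A u := by
    have h1 : ContinuousAt (fderiv ℝ A) (extChartAt I x x) :=
      (hAsm.fderiv_right (m := 0) (by simp)).continuousAt
    refine h1.eventually_mem (s := range ((↑) : (E ≃L[ℝ] F) → E →L[ℝ] F)) ?_
    rw [← hLA]
    exact ContinuousLinearEquiv.nhds L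
  have hBs : ∀ᶠ u in 𝓝 (A (extChartAt I x x)), ContDiffAt ℝ ∞ e.symm u := by
    have h1 : e.target ∈ 𝓝 (A (extChartAt I x x)) :=
      e.open_target.mem_nhds hs.image_mem_toOpenPartialHomeomorph_target
    have h2 := hBc.eventually (p := fun u => ContDiffAt ℝ ∞ A u ∧
      ∃ L' : E ≃L[ℝ] F, L' = fderiv ℝ A u) (by rw [hBx]; exact hAev.and hinv)
    filter_upwards [h1, h2] with u hu h3
    obtain ⟨h3, L', h4⟩ := h3
    refine e.contDiffAt_symm hu (f₀' := L') ?_ h3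
    rw [h4]
    exact (h3.differentiableAt (by simp)).hasFDerivAt
  rw [hAx] at hBs hB2 hBx hBc
  have hh : ∀ᶠ y in 𝓝 (f x),
      ContMDiffAt J I ∞ (fun y => (extChartAt I x).symm (e.symm (extChartAt J (f x) y))) y := by
    have h1 := hψc.eventually hBs
    have h2 : ∀ᶠ y in 𝓝 (f x), ContMDiffAt 𝓘(ℝ, E) I ∞ (extChartAt I x).symm
        (e.symm (extChartAt J (f x) y)) :=
      (ContinuousAt.comp (f := extChartAt J (f x)) hBc hψc).eventually
        (by simp only [comp_apply, hBx]; exact hφ)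
    filter_upwards [hψ, h1, h2] with y h3 h4 h5
    exact ContMDiffAt.comp y (g := (extChartAt I x).symm) h5
      (ContMDiffAt.comp y (g := e.symm) h4.contMDiffAt h3)
  have hhx : (extChartAt I x).symm (e.symm (extChartAt J (f x) (f x))) = x := by rw [hBx, hφx]
  refine ⟨fun y => (extChartAt I x).symm (e.symm (extChartAt J (f x) y)), hhx, hh, ?_, ?_⟩
  · have h1 := (continuousAt_extChartAt (I := I) x).eventually hB1
    filter_upwards [h1, extChartAt_source_mem_nhds (I := I) x] with x' h2 h3
    have h4 : (extChartAt I x).symm (extChartAt I x x') = x' := (extChartAt I x).left_inv h3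
    simp only [hA, writtenInExtChartAt, comp_apply, h4] at h2
    rw [h2, h4]
  · have h1 := hψc.eventually hB2
    have h2 := hh.self_of_nhds.continuousAt
    have h3 : ContinuousAt
        (fun y => f ((extChartAt I x).symm (e.symm (extChartAt J (f x) y)))) (f x) := by
      refine ContinuousAt.comp (g := f) ?_ h2
      simp only [hhx]
      exact hfx.continuousAt
    have h4 : ∀ᶠ y in 𝓝 (f x), f ((extChartAt I x).symm (e.symm (extChartAt J (f x) y))) ∈
        (extChartAt J (f x)).source := by
      apply h3.eventually_mem
      simp only [hhx]
      exact extChartAt_source_mem_nhds (f x)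
    filter_upwards [h1, h4, extChartAt_source_mem_nhds (I := J) (f x)] with y h5 h6 h7
    exact (extChartAt J (f x)).injOn h6 h7 h5

/-- A smooth map with injective differential at `x` has a smooth left inverse near `x`. -/
theorem ContMDiff.exists_local_left_inverse {f : M → N} {x : M} (hf : ContMDiff I J ∞ f)
    (hi : Injective (mfderiv I J f x)) :
    ∃ ρ : N → M, ContMDiffAt J I ∞ ρ (f x) ∧ ∀ᶠ x' in 𝓝 x, ρ (f x') = x' := by
  obtain ⟨L, hL⟩ := (mfderiv I J f x).toLinearMap.exists_leftInverse_of_injective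
    (LinearMap.ker_eq_bot.2 hi)
  let L' : F →L[ℝ] E := LinearMap.toContinuousLinearMap (E := F) (F' := E) L
  have hg : ∀ᶠ y in 𝓝 (f x), ContMDiffAt J 𝓘(ℝ, E) ∞ (fun y => L' (extChartAt J (f x) y)) y := by
    filter_upwards [(chartAt K (f x)).open_source.mem_nhds (mem_chart_source K (f x))] with y hy
    exact L'.contDiff.contMDiff.contMDiffAt.comp y (contMDiffAt_extChartAt' hy)
  have hc : ∀ᶠ x' in 𝓝 x, ContMDiffAt I 𝓘(ℝ, E) ∞ ((fun y => L' (extChartAt J (f x) y)) ∘ f) x' :=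
    (hf.continuous.continuousAt.eventually hg).mono fun x' h => h.comp x' hf.contMDiffAt
  have hgd : HasMFDerivAt J 𝓘(ℝ, E) (fun y => L' (extChartAt J (f x) y)) (f x) L' := by
    have h1 := L'.hasMFDerivAt (x := extChartAt J (f x) (f x))
    have h2 := (mdifferentiableAt_extChartAt (I := J) (mem_chart_source K (f x))).hasMFDerivAt
    rw [mfderiv_extChartAt_self] at h2
    exact h1.comp (f x) h2
  have hcd : mfderiv I 𝓘(ℝ, E) ((fun y => L' (extChartAt J (f x) y)) ∘ f) x =
      ContinuousLinearMap.id ℝ E := by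
    rw [(hgd.comp x (hf.contMDiffAt.mdifferentiableAt (by simp)).hasMFDerivAt).mfderiv]
    ext v
    exact LinearMap.congr_fun hL v
  obtain ⟨h, -, h2, h3, -⟩ := exists_local_inverse_of_mfderiv_bijective hc
    (by rw [hcd]; exact bijective_id)
  exact ⟨fun y => h (L' (extChartAt J (f x) y)),
    ContMDiffAt.comp (f x) (g := h) h2.self_of_nhds hg.self_of_nhds, h3⟩

/-- Let `f` have surjective differential at `x`.  Points `x'` near `x` can be moved smoothly to
prescribed nearby fibres of `f`, in such a way that a point which lies in the prescribed
fibre is not moved.  With `x'` fixed this is a local section of `f`. -/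
theorem ContMDiff.exists_fibre_transport {f : M → N} {x : M} (hf : ContMDiff I J ∞ f)
    (hs : Surjective (mfderiv I J f x)) :
    ∃ S : N × M → M, (∀ᶠ p in 𝓝 (f x, x), ContMDiffAt (J.prod I) I ∞ S p) ∧
      (∀ᶠ p in 𝓝 (f x, x), f (S p) = p.1) ∧ ∀ᶠ x' in 𝓝 x, S (f x', x') = x' := by
  obtain ⟨R, hR⟩ := (mfderiv I J f x).toLinearMap.exists_rightInverse_of_surjective
    (LinearMap.range_eq_top.2 hs)
  let R' : F →L[ℝ] E := LinearMap.toContinuousLinearMap (E := F) (F' := E) R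
  -- `T (x', u)` is `x'` translated by `R u` in the chart at `x`.
  let T : M × F → M := fun p => (extChartAt I x).symm (extChartAt I x p.1 + R' p.2)
  have hT0 : ∀ᶠ x' in 𝓝 x, T (x', 0) = x' := by
    filter_upwards [extChartAt_source_mem_nhds (I := I) x] with x' h
    simp only [T, map_zero, add_zero]
    exact (extChartAt I x).left_inv h
  have hTx : T (x, 0) = x := hT0.self_of_nhds
  have hφ : ∀ᶠ u in 𝓝 (extChartAt I x x),
      ContMDiffAt 𝓘(ℝ, E) I ∞ (extChartAt I x).symm u := by
    filter_upwards [(isOpen_extChartAt_target (I := I) x).mem_nhds (mem_extChartAt_target x)]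
      with u hu
    exact (contMDiffOn_extChartAt_symm x).contMDiffAt
      ((isOpen_extChartAt_target (I := I) x).mem_nhds hu)
  have hφd : HasMFDerivAt 𝓘(ℝ, E) I (extChartAt I x).symm (extChartAt I x x)
      (ContinuousLinearMap.id ℝ E) := by
    have := mfderivWithin_range_extChartAt_symm (I := I) (x := x)
    rw [I.range_eq_univ, mfderivWithin_univ] at this
    exact (hφ.self_of_nhds.mdifferentiableAt (by simp)).hasMFDerivAt.congr_mfderiv this
  have hT : ∀ᶠ p in 𝓝 (x, (0 : F)), ContMDiffAt (I.prod 𝓘(ℝ, F)) I ∞ T p := by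
    have h1 : ∀ᶠ p in 𝓝 (x, (0 : F)), ContMDiffAt (I.prod 𝓘(ℝ, F)) 𝓘(ℝ, E) ∞
        (fun p : M × F => extChartAt I x p.1 + R' p.2) p := by
      filter_upwards [continuousAt_fst.eventually
        ((chartAt H x).open_source.mem_nhds (mem_chart_source H x))] with p hp
      refine ContMDiffAt.add ?_ ?_
      · exact ContMDiffAt.comp p (g := extChartAt I x) (contMDiffAt_extChartAt' hp)
          contMDiffAt_fst
      · exact R'.contDiff.contMDiff.contMDiffAt.comp p contMDiffAt_snd
    have h2 := h1.self_of_nhds.continuousAt.eventually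
      (p := fun u => ContMDiffAt 𝓘(ℝ, E) I ∞ (extChartAt I x).symm u) (by simpa using hφ)
    filter_upwards [h1, h2] with p h3 h4
    exact ContMDiffAt.comp p (g := (extChartAt I x).symm) h4 h3
  let G : M × F → M × N := fun p => (p.1, f (T p))
  have hG : ∀ᶠ p in 𝓝 (x, (0 : F)), ContMDiffAt (I.prod 𝓘(ℝ, F)) (I.prod J) ∞ G p :=
    hT.mono fun p hp => contMDiffAt_fst.prodMk (ContMDiffAt.comp p hf.contMDiffAt hp)
  have hG0 : G (x, 0) = (x, f x) := by simp only [G, hTx]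
  have hGd := (hG.self_of_nhds.mdifferentiableAt (by simp)).hasMFDerivAt
  have hinj : Injective (mfderiv (I.prod 𝓘(ℝ, F)) (I.prod J) G (x, 0)) := by
    have hTR : HasMFDerivAt 𝓘(ℝ, F) I (fun u => T (x, u)) 0 R' := by
      have h1 : HasMFDerivAt 𝓘(ℝ, F) 𝓘(ℝ, E) (fun u => extChartAt I x x + R' u) 0 R' :=
        (R'.hasFDerivAt.const_add _).hasMFDerivAt
      have h2 : HasMFDerivAt 𝓘(ℝ, E) I (extChartAt I x).symm (extChartAt I x x + R' 0)
          (ContinuousLinearMap.id ℝ E) := by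
        have h3 : R' 0 = 0 := map_zero R'
        rw [h3, add_zero]
        exact hφd
      exact h2.comp (0 : F) h1
    have hfR : HasMFDerivAt 𝓘(ℝ, F) J (fun u => f (T (x, u))) 0
        ((mfderiv I J f x).comp R' : F →L[ℝ] F) := by
      refine HasMFDerivAt.comp (f := fun u => T (x, u)) (g := f) (0 : F) ?_ hTR
      rw [hTx]
      exact (hf.contMDiffAt.mdifferentiableAt (by simp)).hasMFDerivAt
    have h1 : HasMFDerivAt 𝓘(ℝ, F) (I.prod 𝓘(ℝ, F)) (fun u : F => (x, u)) 0
        ((0 : F →L[ℝ] E).prod (ContinuousLinearMap.id ℝ F)) :=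
      (hasMFDerivAt_const x (0 : F)).prodMk (hasMFDerivAt_id (0 : F))
    have h2 : HasMFDerivAt 𝓘(ℝ, F) (I.prod J) (fun u : F => (x, f (T (x, u)))) 0
        ((0 : F →L[ℝ] E).prod ((mfderiv I J f x).comp R' : F →L[ℝ] F)) :=
      (hasMFDerivAt_const x (0 : F)).prodMk hfR
    have h3 := hasMFDerivAt_unique (HasMFDerivAt.comp (f := fun u : F => (x, u)) (0 : F) hGd h1) h2
    have h4 : (ContinuousLinearMap.fst ℝ E F).comp
        (show E × F →L[ℝ] E × F from mfderiv (I.prod 𝓘(ℝ, F)) (I.prod J) G (x, 0)) =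
        ContinuousLinearMap.fst ℝ E F :=
      hasMFDerivAt_unique (HasMFDerivAt.comp (f := G) (g := Prod.fst) (x, (0 : F))
        (hasMFDerivAt_fst (I := I) (I' := J) _) hGd) (hasMFDerivAt_fst (I := I) (I' := 𝓘(ℝ, F)) _)
    rw [injective_iff_map_eq_zero]
    rintro ⟨a, b⟩ hab
    have ha : a = 0 := by
      have := DFunLike.congr_fun h4 (a, b)
      rw [ContinuousLinearMap.comp_apply] at this
      exact this.symm.trans (congrArg Prod.fst hab)
    subst ha
    have hb : b = (0 : F) := by
      have h5 := congrArg Prod.snd (DFunLike.congr_fun h3 b)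
      have h6 : (mfderiv I J f x) (R b) = b := LinearMap.congr_fun hR b
      exact h6.symm.trans (h5.symm.trans (congrArg Prod.snd hab))
    subst hb
    rfl
  have hbij : Bijective (mfderiv (I.prod 𝓘(ℝ, F)) (I.prod J) G (x, 0)) := by
    refine ⟨hinj, ?_⟩
    let A : E × F →ₗ[ℝ] E × F :=
      (mfderiv (I.prod 𝓘(ℝ, F)) (I.prod J) G (x, 0)).toLinearMap
    exact (LinearMap.injective_iff_surjective (f := A)).1 hinj
  obtain ⟨h, h1, h2, h3, h4⟩ := exists_local_inverse_of_mfderiv_bijective hG hbij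
  rw [hG0] at h1 h2 h4
  refine ⟨fun p => T (h p.swap), ?_, ?_, ?_⟩
  · have h5 : ∀ᶠ p : N × M in 𝓝 (f x, x), ContMDiffAt (I.prod J) (I.prod 𝓘(ℝ, F)) ∞ h p.swap :=
      continuous_swap.continuousAt.eventually h2
    have h6 : ContinuousAt (fun p : N × M => h p.swap) (f x, x) :=
      ContinuousAt.comp (g := h) h2.self_of_nhds.continuousAt continuous_swap.continuousAt
    have h7 := h6.eventually (p := fun p => ContMDiffAt (I.prod 𝓘(ℝ, F)) I ∞ T p)
      (by simp only [Prod.swap_prod_mk, h1]; exact hT)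
    filter_upwards [h5, h7] with p h8 h9
    exact ContMDiffAt.comp p (g := T) h9 (ContMDiffAt.comp p (g := h) h8
      (contMDiffAt_snd.prodMk contMDiffAt_fst))
  · have h5 : ∀ᶠ p : N × M in 𝓝 (f x, x), G (h p.swap) = p.swap :=
      continuous_swap.continuousAt.eventually (p := fun y => G (h y) = y) h4
    exact h5.mono fun p hp => congrArg Prod.snd hp
  · have hc : ContinuousAt (fun x' : M => (x', (0 : F))) x := by fun_prop
    filter_upwards [hT0, hc.eventually h3] with x' h5 h6
    simp only [G, h5] at h6
    simp only [Prod.swap, h6, h5]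

/-- The differential of a retraction: `S (f x', x') = x'` for `x'` near `x`. -/
theorem mfderiv_fibre_transport {f : M → N} {x : M} (hf : MDifferentiableAt I J f x)
    {S : N × M → M} (hS : MDifferentiableAt (J.prod I) I S (f x, x))
    (h : ∀ᶠ x' in 𝓝 x, S (f x', x') = x') (v : TangentSpace I x) :
    mfderiv (J.prod I) I S (f x, x) (mfderiv I J f x v, v) = v := by
  have h1 : HasMFDerivAt I (J.prod I) (fun x' => (f x', x')) x
      ((mfderiv I J f x).prod (ContinuousLinearMap.id ℝ (TangentSpace I x))) :=
    hf.hasMFDerivAt.prodMk (hasMFDerivAt_id x)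
  have h2 := (HasMFDerivAt.comp (f := fun x' => (f x', x')) (g := S) x
    hS.hasMFDerivAt h1).congr_of_eventuallyEq (f₁ := id) (h.mono fun y hy => hy.symm)
  have h3 := hasMFDerivAt_unique h2 (hasMFDerivAt_id x)
  exact congrArg (fun A => A v) h3

/-- A submersion has a smooth local section through each point of its source. -/
theorem ContMDiff.exists_local_section {f : M → N} {x : M} (hf : ContMDiff I J ∞ f)
    (hs : Surjective (mfderiv I J f x)) :
    ∃ σ : N → M, σ (f x) = x ∧ ContMDiffAt J I ∞ σ (f x) ∧ ∀ᶠ y in 𝓝 (f x), f (σ y) = y := by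
  obtain ⟨S, h1, h2, h3⟩ := hf.exists_fibre_transport hs
  refine ⟨fun y => S (y, x), h3.self_of_nhds, ?_, ?_⟩
  · exact ContMDiffAt.comp (f x) (g := S) h1.self_of_nhds (contMDiffAt_id.prodMk contMDiffAt_const)
  · have hc : ContinuousAt (fun y : N => (y, x)) (f x) := by fun_prop
    exact hc.eventually h2

variable {E' : Type*} [NormedAddCommGroup E'] [NormedSpace ℝ E'] {H' : Type*} [TopologicalSpace H']
  {I' : ModelWithCorners ℝ E' H'} {Z : Type*} [TopologicalSpace Z] [ChartedSpace H' Z]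

/-- A map out of the target of a submersion `f` is smooth when its composite with `f` is. -/
theorem ContMDiffAt.of_comp_submersion {f : M → N} {x : M} {g : N → Z}
    (hg : ContMDiffAt I I' ∞ (g ∘ f) x) (hf : ContMDiff I J ∞ f)
    (hs : Surjective (mfderiv I J f x)) : ContMDiffAt J I' ∞ g (f x) := by
  obtain ⟨σ, h1, h2, h3⟩ := hf.exists_local_section hs
  have h4 : ContMDiffAt J I' ∞ ((g ∘ f) ∘ σ) (f x) := by
    refine ContMDiffAt.comp (f x) ?_ h2
    rwa [h1]
  exact h4.congr_of_eventuallyEq (h3.mono fun y hy => by simp [hy])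

/-- A continuous map into the source of an immersion `f` is smooth when its composite with `f`
is. -/
theorem ContMDiffAt.of_immersion_comp {f : M → N} {z : Z} {g : Z → M}
    (hg : ContMDiffAt I' J ∞ (f ∘ g) z) (hc : ContinuousAt g z) (hf : ContMDiff I J ∞ f)
    (hi : Injective (mfderiv I J f (g z))) : ContMDiffAt I' I ∞ g z := by
  obtain ⟨ρ, h1, h2⟩ := hf.exists_local_left_inverse hi
  have h3 : ContMDiffAt I' I ∞ (ρ ∘ (f ∘ g)) z := ContMDiffAt.comp z h1 hg
  exact h3.congr_of_eventuallyEq ((hc.eventually h2).mono fun y hy => by simp [hy])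

end InverseFunction

/-! ### Manifolds from local smooth retracts -/

section Retraction

open Filter Topology Set Function

variable {E : Type*} [NormedAddCommGroup E] [NormedSpace ℝ E] [FiniteDimensional ℝ E]
  {H : Type*} [TopologicalSpace H] {I : ModelWithCorners ℝ E H} [I.Boundaryless]
  {M : Type*} [TopologicalSpace M] [ChartedSpace H M] [IsManifold I ∞ M]

/-- The image of a smooth retraction `Ω` of rank `e` is near a fixed point `x` parametrized by
`ℝ^e`: the parametrization is `β`, and `α` is a smooth extension of its inverse. -/
theorem exists_parametrization_of_retraction {Ω : M → M} {x : M} {e : ℕ} (hx : Ω x = x)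
    (hΩ : ∀ᶠ y in 𝓝 x, ContMDiffAt I I ∞ Ω y) (hi : ∀ᶠ y in 𝓝 x, Ω (Ω y) = Ω y)
    (hr : Module.finrank ℝ (mfderiv I I Ω x).toLinearMap.range = e) :
    ∃ (α : M → EuclideanSpace ℝ (Fin e)) (β : EuclideanSpace ℝ (Fin e) → M),
      (∀ᶠ y in 𝓝 x, ContMDiffAt I (𝓡 e) ∞ α y) ∧
      (∀ᶠ u in 𝓝 (α x), ContMDiffAt (𝓡 e) I ∞ β u) ∧
      (∀ᶠ u in 𝓝 (α x), α (β u) = u) ∧ (∀ᶠ u in 𝓝 (α x), Ω (β u) = β u) ∧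
      (∀ᶠ y in 𝓝 x, β (α (Ω y)) = Ω y) ∧ β (α x) = x := by
  let P : E →L[ℝ] E := mfderiv I I Ω x
  have hΩx : ContMDiffAt I I ∞ Ω x := hΩ.self_of_nhds
  have hP : HasMFDerivAt I I Ω x P := (hΩx.mdifferentiableAt (by simp)).hasMFDerivAt
  have hPP : P.comp P = P := by
    have h1 : HasMFDerivAt I I Ω (Ω x) P := by rw [hx]; exact hP
    have h2 := (h1.comp x hP).congr_of_eventuallyEq (f₁ := Ω) (hi.mono fun y hy => hy.symm)
    exact hasMFDerivAt_unique h2 hP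
  have hPPa : ∀ v, P (P v) = P v := fun v => DFunLike.congr_fun hPP v
  -- an identification of the range of `P` with `ℝ^e`
  obtain ⟨j, k, hjk, hkj⟩ : ∃ (j : E →L[ℝ] EuclideanSpace ℝ (Fin e))
      (k : EuclideanSpace ℝ (Fin e) →L[ℝ] E), (∀ u, j (k u) = u) ∧ ∀ v, k (j v) = P v := by
    have hr' : Module.finrank ℝ P.toLinearMap.range =
        Module.finrank ℝ (EuclideanSpace ℝ (Fin e)) := by
      rw [finrank_euclideanSpace_fin]; exact hr
    let c : P.toLinearMap.range ≃ₗ[ℝ] EuclideanSpace ℝ (Fin e) := LinearEquiv.ofFinrankEq _ _ hr'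
    refine ⟨LinearMap.toContinuousLinearMap (c.toLinearMap ∘ₗ P.toLinearMap.rangeRestrict),
      LinearMap.toContinuousLinearMap (P.toLinearMap.range.subtype ∘ₗ c.symm.toLinearMap),
      fun u => ?_, fun v => ?_⟩
    · have h1 : P.toLinearMap.rangeRestrict (c.symm u : E) = c.symm u := by
        obtain ⟨v, hv⟩ := (c.symm u).2
        apply Subtype.ext
        change P (c.symm u : E) = _
        rw [← hv]
        exact hPPa v
      change c (P.toLinearMap.rangeRestrict (c.symm u : E)) = u
      rw [h1, LinearEquiv.apply_symm_apply]
    · change ((c.symm (c (P.toLinearMap.rangeRestrict v)) : P.toLinearMap.range) : E) = P v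
      rw [LinearEquiv.symm_apply_apply]
      rfl
  have hPk : ∀ u, P (k u) = k u := fun u => by rw [← hkj, hjk]
  set φ := extChartAt I x with hφ
  have hφs : ∀ᶠ y in 𝓝 x, ContMDiffAt I 𝓘(ℝ, E) ∞ φ y := by
    filter_upwards [(chartAt H x).open_source.mem_nhds (mem_chart_source H x)] with y hy
    exact contMDiffAt_extChartAt' hy
  have hΩc : Tendsto Ω (𝓝 x) (𝓝 x) := by
    have := hΩx.continuousAt.tendsto
    rwa [hx] at this
  -- `Ψ` is the sum of `P ∘ φ ∘ Ω` and `(1 - P) ∘ (φ - φ ∘ Ω)`; its differential at `x` is the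
  -- identity, and it maps the image of `Ω` to the range of `P`
  let ℓ : E × E →L[ℝ] E := ContinuousLinearMap.fst ℝ E E - ContinuousLinearMap.snd ℝ E E -
    P.comp (ContinuousLinearMap.fst ℝ E E) + (2 : ℝ) • P.comp (ContinuousLinearMap.snd ℝ E E)
  have hℓ : ∀ a b, ℓ (a, b) = a - b - P a + (2 : ℝ) • P b := fun a b => rfl
  let Ψ : M → E := fun y => ℓ (φ y, φ (Ω y))
  have hΨs : ∀ᶠ y in 𝓝 x, ContMDiffAt I 𝓘(ℝ, E) ∞ Ψ y := by
    filter_upwards [hφs, hΩ, hΩc.eventually hφs] with y h1 h2 h3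
    exact ℓ.contDiff.contMDiff.contMDiffAt.comp y (h1.prodMk_space (h3.comp y h2))
  have hΨd : HasMFDerivAt I 𝓘(ℝ, E) Ψ x (ContinuousLinearMap.id ℝ E) := by
    have h1 : HasMFDerivAt I 𝓘(ℝ, E) φ x (ContinuousLinearMap.id ℝ E) := by
      have h2 := (mdifferentiableAt_extChartAt (I := I) (mem_chart_source H x)).hasMFDerivAt
      rwa [mfderiv_extChartAt_self] at h2
    have h2 : HasMFDerivAt I 𝓘(ℝ, E) (fun y => φ (Ω y)) x P := by
      have h3 : HasMFDerivAt I 𝓘(ℝ, E) φ (Ω x) (ContinuousLinearMap.id ℝ E) := by rwa [hx]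
      exact h3.comp x hP
    have h3 : HasMFDerivAt I 𝓘(ℝ, E × E) (fun y => (φ y, φ (Ω y))) x
        ((ContinuousLinearMap.id ℝ E).prod P) :=
      ⟨h1.1.prodMk h2.1, h1.2.prodMk h2.2⟩
    have h4 := (ℓ.hasMFDerivAt (x := (φ x, φ (Ω x)))).comp x h3
    refine h4.congr_mfderiv ?_
    refine ContinuousLinearMap.ext fun (v : E) => ?_
    change ℓ (v, P v) = v
    rw [hℓ, hPPa, two_smul]
    abel
  obtain ⟨h, hhx, hhs, hl, hrt⟩ := exists_local_inverse_of_mfderiv_bijective hΨs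
    (by rw [hΨd.mfderiv]; exact bijective_id)
  have hΨΩ : ∀ y, Ω (Ω y) = Ω y → Ψ (Ω y) = P (φ (Ω y)) := fun y hy => by
    change ℓ (φ (Ω y), φ (Ω (Ω y))) = _
    rw [hy, hℓ, two_smul]
    abel
  have hΨx : Ψ x = k (j (φ x)) := by
    have := hΨΩ x (by rw [hx, hx])
    rwa [hx, ← hkj] at this
  have hkc : Tendsto k (𝓝 (j (φ x))) (𝓝 (Ψ x)) := by
    rw [hΨx]; exact k.continuous.continuousAt
  have hhk : Tendsto (fun u => h (k u)) (𝓝 (j (φ x))) (𝓝 x) := by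
    have := hhs.self_of_nhds.continuousAt.tendsto.comp hkc
    rwa [hhx] at this
  -- the key point: `h (k u)` is fixed by `Ω`, as `Ψ` takes the same value there and at its image
  have hfix : ∀ᶠ u in 𝓝 (j (φ x)), Ω (h (k u)) = h (k u) ∧ P (φ (h (k u))) = k u := by
    filter_upwards [hkc.eventually hrt, hhk.eventually hi, (hΩc.comp hhk).eventually hl,
      hhk.eventually hl] with u h1 h2 h3 h4
    have h5 : P (φ (Ω (h (k u)))) = k u := by
      have h6 : P (Ψ (h (k u))) = P (k u) := by rw [h1]
      change P (ℓ (φ (h (k u)), φ (Ω (h (k u))))) = P (k u) at h6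
      rw [hℓ, hPk, map_add, map_sub, map_sub, map_smul, hPPa, hPPa, two_smul] at h6
      refine Eq.trans ?_ h6
      abel
    have h6 : Ω (h (k u)) = h (k u) := by
      have h7 : Ψ (Ω (h (k u))) = Ψ (h (k u)) := by rw [hΨΩ _ h2, h5, h1]
      rw [comp_apply, h7, h4] at h3
      exact h3.symm
    exact ⟨h6, by rwa [h6] at h5⟩
  refine ⟨fun y => j (φ y), fun u => h (k u), ?_, ?_, ?_, ?_, ?_, ?_⟩
  · exact hφs.mono fun y hy => j.contDiff.contMDiff.contMDiffAt.comp y hy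
  · exact (hkc.eventually hhs).mono fun u hu =>
      ContMDiffAt.comp u (g := h) hu k.contDiff.contMDiff.contMDiffAt
  · filter_upwards [hfix] with u hu
    rw [← hjk u, ← hu.2, ← hkj, hjk, hkj, hu.2]
  · exact hfix.mono fun u hu => hu.1
  · filter_upwards [hΩc.eventually hl, hi] with y h1 h2
    rw [hkj, ← hΨΩ y h2, h1]
  · change h (k (j (φ x))) = x
    rw [← hΨx, hhx]

/-- A local homeomorphism from a pair of functions that are inverse to each other where both
make sense. -/
theorem exists_openPartialHomeomorph_of_inverse {X Y : Type*} [TopologicalSpace X]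
    [TopologicalSpace Y] {a : X → Y} {b : Y → X} {A : Set X} {B : Set Y} (hA : IsOpen A)
    (hB : IsOpen B) (ha : ContinuousOn a A) (hb : ContinuousOn b B) (hba : ∀ x ∈ A, b (a x) = x)
    (hab : ∀ y ∈ B, a (b y) = y) :
    ∃ e : OpenPartialHomeomorph X Y, (∀ x, e x = a x) ∧ (∀ y, e.symm y = b y) ∧
      e.source = A ∩ a ⁻¹' B ∧ e.target = B ∩ b ⁻¹' A := by
  refine ⟨⟨⟨⟨a, b, A ∩ a ⁻¹' B, B ∩ b ⁻¹' A, ?_, ?_, ?_, ?_⟩, ha.mono inter_subset_left,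
    hb.mono inter_subset_left⟩, ha.isOpen_inter_preimage hA hB, hb.isOpen_inter_preimage hB hA⟩,
    fun _ => rfl, fun _ => rfl, rfl, rfl⟩
  · intro x hx
    exact ⟨hx.2, by rw [mem_preimage, hba x hx.1]; exact hx.1⟩
  · intro y hy
    exact ⟨hy.2, by rw [mem_preimage, hab y hy.1]; exact hy.1⟩
  · exact fun x hx => hba x hx.1
  · exact fun y hy => hab y hy.1

/-- Let `ι` and `ρ` exhibit a neighbourhood of `q` in `Q` as a retract of an open set of a
manifold, with smooth retraction `ι ∘ ρ` of rank `e`.  Then `Q` is near `q` homeomorphic to an open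
set of `ℝ^e`, through the composite of `ι` with a smooth map `α`; the inverse is the
composite of a smooth map `β` with `ρ`. -/
theorem exists_chart_of_retract {Q : Type*} [TopologicalSpace Q] {e : ℕ} {ι : Q → M} {ρ : M → Q}
    {U : Set Q} {V : Set M} {q : Q} (hU : IsOpen U) (hqU : q ∈ U) (hV : IsOpen V)
    (hqV : ι q ∈ V) (hι : ContinuousOn ι U) (hρ : ContinuousOn ρ V)
    (hρι : ∀ y ∈ U, ρ (ι y) = y) (hs : ContMDiffOn I I ∞ (ι ∘ ρ) (V ∩ ρ ⁻¹' U))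
    (hr : Module.finrank ℝ (mfderiv I I (ι ∘ ρ) (ι q)).toLinearMap.range = e) :
    ∃ (c : OpenPartialHomeomorph Q (EuclideanSpace ℝ (Fin e))) (α : M → EuclideanSpace ℝ (Fin e))
      (β : EuclideanSpace ℝ (Fin e) → M), q ∈ c.source ∧ c.source ⊆ U ∧
      (∀ y, c y = α (ι y)) ∧ (∀ u, c.symm u = ρ (β u)) ∧
      (∀ y ∈ c.source, ContMDiffAt I (𝓡 e) ∞ α (ι y)) ∧
      (∀ u ∈ c.target, ContMDiffAt (𝓡 e) I ∞ β u) ∧ ∀ u ∈ c.target, β u ∈ V := by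
  have hW : IsOpen (V ∩ ρ ⁻¹' U) := hρ.isOpen_inter_preimage hV hU
  have hqW : ι q ∈ V ∩ ρ ⁻¹' U := ⟨hqV, by rw [mem_preimage, hρι q hqU]; exact hqU⟩
  obtain ⟨α, β, h1, h2, h3, h4, h5, h6⟩ := exists_parametrization_of_retraction (I := I)
    (Ω := ι ∘ ρ) (x := ι q) (e := e) (by simp [hρι q hqU])
    (by filter_upwards [hW.mem_nhds hqW] with y hy; exact hs.contMDiffAt (hW.mem_nhds hy))
    (by filter_upwards [hW.mem_nhds hqW] with y hy; simp [hρι _ hy.2]) hr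
  obtain ⟨A, hA, hAo, hqA⟩ := eventually_nhds_iff.1 (h1.and h5)
  obtain ⟨B, hB, hBo, hqB⟩ := eventually_nhds_iff.1
    ((h2.and (h3.and h4)).and (h2.self_of_nhds.continuousAt.eventually_mem
      (by rw [h6]; exact hW.mem_nhds hqW)))
  have hfix : ∀ y ∈ U, β (α (ι y)) = ι y ∨ ι y ∉ A := by
    intro y hy
    by_cases hyA : ι y ∈ A
    · left
      have := (hA _ hyA).2
      simpa [hρι y hy] using this
    · exact Or.inr hyA
  obtain ⟨c, hc1, hc2, hc3, hc4⟩ := exists_openPartialHomeomorph_of_inverse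
    (a := fun y => α (ι y)) (b := fun u => ρ (β u)) (A := U ∩ ι ⁻¹' A) (B := B)
    (hι.isOpen_inter_preimage hU hAo) hBo
    (fun y hy => ((hA _ hy.2).1.continuousAt.comp_continuousWithinAt
      ((hι y hy.1).mono inter_subset_left)))
    (fun u hu => ((hρ.continuousAt (hV.mem_nhds (hB u hu).2.1)).comp_continuousWithinAt
      (hB u hu).1.1.continuousAt.continuousWithinAt))
    (fun y hy => by
      rcases hfix y hy.1 with h | h
      · simp only [h, hρι y hy.1]
      · exact absurd hy.2 h)
    (fun u hu => by
      have := (hB u hu).1.2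
      simp only [comp_apply] at this
      rw [this.2, this.1])
  refine ⟨c, α, β, ?_, ?_, hc1, hc2, ?_, ?_, ?_⟩
  · rw [hc3]
    exact ⟨⟨hqU, hqA⟩, hqB⟩
  · rw [hc3]
    exact fun y hy => hy.1.1
  · rw [hc3]
    exact fun y hy => (hA _ hy.1.2).1
  · rw [hc4]
    exact fun u hu => (hB u hu.1).1.1
  · rw [hc4]
    exact fun u hu => (hB u hu.1).2.1

/-- A space which is locally a smooth retract of a manifold, with smooth transitions `ι q' ∘ ρ q`
and retractions of constant rank `e`, is a manifold of dimension `e`, in such a way that the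
inclusions `ι q` and the retractions `ρ q` are smooth.  Both submanifolds
(`ι` is the inclusion) and quotients (`ρ` is the projection) arise in this way. -/
theorem exists_isManifold_of_local_retracts {Q : Type*} [TopologicalSpace Q] {e : ℕ}
    {ι : Q → Q → M} {ρ : Q → M → Q} {U : Q → Set Q} {V : Q → Set M}
    (hU : ∀ q, IsOpen (U q)) (hqU : ∀ q, q ∈ U q) (hV : ∀ q, IsOpen (V q))
    (hqV : ∀ q, ι q q ∈ V q) (hι : ∀ q, ContinuousOn (ι q) (U q))
    (hρ : ∀ q, ContinuousOn (ρ q) (V q)) (hρι : ∀ q, ∀ y ∈ U q, ρ q (ι q y) = y)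
    (hs : ∀ q q', ContMDiffOn I I ∞ (ι q' ∘ ρ q) (V q ∩ ρ q ⁻¹' U q'))
    (hr : ∀ q, Module.finrank ℝ (mfderiv I I (ι q ∘ ρ q) (ι q q)).toLinearMap.range = e) :
    ∃ (_ : ChartedSpace (EuclideanSpace ℝ (Fin e)) Q) (_ : IsManifold (𝓡 e) ∞ Q),
      (∀ q, ContMDiffOn (𝓡 e) I ∞ (ι q) (U q)) ∧ ∀ q, ContMDiffOn I (𝓡 e) ∞ (ρ q) (V q) := by
  choose c α β hc1 hc2 hc3 hc4 hc5 hc6 hc7 using fun q =>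
    exists_chart_of_retract (hU q) (hqU q) (hV q) (hqV q) (hι q) (hρ q) (hρι q) (hs q q) (hr q)
  -- the transition `ι q' ∘ ρ q`, precomposed with the parametrization at `q`
  have htr : ∀ q q' u, u ∈ (c q).target → (c q).symm u ∈ U q' →
      ContMDiffAt (𝓡 e) I ∞ (fun u => ι q' ((c q).symm u)) u := by
    intro q q' u hu hu'
    have h1 : ContMDiffAt I I ∞ (ι q' ∘ ρ q) (β q u) :=
      (hs q q').contMDiffAt (((hρ q).isOpen_inter_preimage (hV q) (hU q')).mem_nhds
        ⟨hc7 q u hu, by rw [mem_preimage, ← hc4]; exact hu'⟩)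
    have h2 := ContMDiffAt.comp u h1 (hc6 q u hu)
    refine h2.congr_of_eventuallyEq (Eventually.of_forall fun u' => ?_)
    simp [hc4]
  let cs : ChartedSpace (EuclideanSpace ℝ (Fin e)) Q :=
    { atlas := range c
      chartAt := c
      mem_chart_source := hc1
      chart_mem_atlas := mem_range_self }
  have hm : IsManifold (𝓡 e) ∞ Q := by
    refine isManifold_of_contDiffOn (𝓡 e) ∞ Q ?_
    rintro _ _ ⟨q, rfl⟩ ⟨q', rfl⟩
    intro u hu
    have hu1 : u ∈ (c q).target ∧ (c q).symm u ∈ (c q').source := by simpa using hu.1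
    have h1 := htr q q' u hu1.1 (hc2 q' hu1.2)
    have h2 : ContMDiffAt (𝓡 e) (𝓡 e) ∞ (fun u => α q' (ι q' ((c q).symm u))) u :=
      ContMDiffAt.comp u (g := α q') (hc5 q' _ hu1.2) h1
    refine (contMDiffAt_iff_contDiffAt.1 h2).contDiffWithinAt.congr (fun y hy => ?_) ?_ <;>
    · simp [hc3]
  refine ⟨cs, hm, fun q y hy => ?_, fun q v hv => ?_⟩
  · refine ContMDiffAt.contMDiffWithinAt ?_
    have h1 : ContMDiffAt (𝓡 e) (𝓡 e) ∞ (c y) y := contMDiffAt_of_mem_maximalAtlas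
      (IsManifold.chart_mem_maximalAtlas (I := 𝓡 e) y) (hc1 y)
    have h2 := htr y q (c y y) ((c y).map_source (hc1 y)) (by rwa [(c y).left_inv (hc1 y)])
    refine (ContMDiffAt.comp y h2 h1).congr_of_eventuallyEq ?_
    filter_upwards [(c y).open_source.mem_nhds (hc1 y)] with y' hy'
    simp [(c y).left_inv hy']
  · refine ContMDiffAt.contMDiffWithinAt ?_
    have h1 : ContMDiffAt I I ∞ (ι (ρ q v) ∘ ρ q) v :=
      (hs q (ρ q v)).contMDiffAt (((hρ q).isOpen_inter_preimage (hV q) (hU _)).mem_nhds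
        ⟨hv, hqU _⟩)
    have h2 : ContMDiffAt I (𝓡 e) ∞ (fun x => c (ρ q v) (ρ q x)) v := by
      have := ContMDiffAt.comp v (g := α (ρ q v)) (hc5 (ρ q v) (ρ q v) (hc1 _)) h1
      refine this.congr_of_eventuallyEq (Eventually.of_forall fun x => ?_)
      simp [hc3]
    have h3 : ContMDiffAt (𝓡 e) (𝓡 e) ∞ (c (ρ q v)).symm (c (ρ q v) (ρ q v)) :=
      contMDiffAt_symm_of_mem_maximalAtlas (IsManifold.chart_mem_maximalAtlas (I := 𝓡 e) (ρ q v))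
        ((c (ρ q v)).map_source (hc1 _))
    refine (ContMDiffAt.comp v h3 h2).congr_of_eventuallyEq ?_
    have h4 := ((hρ q).continuousAt ((hV q).mem_nhds hv)).eventually_mem
      ((c (ρ q v)).open_source.mem_nhds (hc1 (ρ q v)))
    filter_upwards [h4] with x hx
    simp [(c (ρ q v)).left_inv hx]

end Retraction

/-! ### Orbit spaces of free and proper actions -/

section Orbits

open Filter Topology Set Function

/-- A curve in a manifold with vanishing derivative is locally constant. -/
theorem eventually_eq_of_hasMFDerivAt_zero {d : ℕ} {X : Type*} [TopologicalSpace X]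
    [ChartedSpace (EuclideanSpace ℝ (Fin d)) X] [IsManifold (𝓡 d) ∞ X] {c : ℝ → X} {t₀ : ℝ}
    (hc : ∀ᶠ t in 𝓝 t₀, HasMFDerivAt 𝓘(ℝ, ℝ) (𝓡 d) c t (0 : ℝ →L[ℝ] EuclideanSpace ℝ (Fin d))) :
    ∀ᶠ t in 𝓝 t₀, c t = c t₀ := by
  have hs : ∀ᶠ t in 𝓝 t₀, c t ∈ (chartAt (EuclideanSpace ℝ (Fin d)) (c t₀)).source :=
    hc.self_of_nhds.continuousAt.eventually_mem
      ((chartAt _ (c t₀)).open_source.mem_nhds (mem_chart_source _ _))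
  obtain ⟨r, hr, hB⟩ := Metric.eventually_nhds_iff_ball.1 (hc.and hs)
  set φ := extChartAt (𝓡 d) (c t₀) with hφ
  have hd : ∀ t ∈ Metric.ball t₀ r,
      HasFDerivAt (fun t => φ (c t)) (0 : ℝ →L[ℝ] EuclideanSpace ℝ (Fin d)) t := by
    intro t ht
    have h1 := (mdifferentiableAt_extChartAt (I := 𝓡 d) (hB t ht).2).hasMFDerivAt.comp t
      (hB t ht).1
    have h2 := h1.hasFDerivAt
    refine h2.congr_fderiv (ContinuousLinearMap.ext fun v => ?_)
    exact map_zero (mfderiv (𝓡 d) 𝓘(ℝ, EuclideanSpace ℝ (Fin d)) φ (c t))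
  have hconst : ∀ t ∈ Metric.ball t₀ r, φ (c t) = φ (c t₀) := fun t ht =>
    Metric.isOpen_ball.is_const_of_fderiv_eq_zero (𝕜 := ℝ) (f := fun t => φ (c t))
      (convex_ball t₀ r).isPreconnected
      (fun t ht => (hd t ht).differentiableAt.differentiableWithinAt)
      (fun t ht => (hd t ht).fderiv) ht (Metric.mem_ball_self hr)
  filter_upwards [Metric.ball_mem_nhds t₀ hr] with t ht
  refine φ.injOn ?_ ?_ (hconst t ht)
  · rw [hφ, extChartAt_source]; exact (hB t ht).2
  · rw [hφ, extChartAt_source]; exact mem_chart_source _ _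

variable {k d : ℕ} {G X : Type*} [Group G] [TopologicalSpace G]
  [ChartedSpace (EuclideanSpace ℝ (Fin k)) G] [LieGroup (𝓡 k) ∞ G]
  [TopologicalSpace X] [ChartedSpace (EuclideanSpace ℝ (Fin d)) X] [IsManifold (𝓡 d) ∞ X]
  [MulAction G X] [ContMDiffSMul (𝓡 k) (𝓡 d) ∞ G X]

/-- The orbit map of a free action is an immersion at the neutral element: if its differential
kills a vector `v`, it contracts the one-parameter subgroup generated by `v` to a point. -/
theorem injective_mfderiv_orbitMap (free : IsFreeAction G X) (x : X) :
    Injective (mfderiv (𝓡 k) (𝓡 d) (fun g : G => g • x) 1) := by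
  have hG : LieGroup (𝓡 k) (minSmoothness ℝ 3) G :=
    LieGroup.of_le (n := ∞) (by
      simp only [minSmoothness_of_isRCLikeNormedField]
      exact ENat.LEInfty.out)
  have hM : IsManifold (𝓡 k) ∞ G := inferInstance
  have hμ : ContMDiff (𝓡 k) (𝓡 d) ∞ (fun g : G => g • x) :=
    (contMDiff_smul (I := 𝓡 k) (I' := 𝓡 d) (n := ∞) (G := G) (M := X)).comp
      (contMDiff_id.prodMk contMDiff_const)
  have hact : ∀ g : G, ContMDiff (𝓡 d) (𝓡 d) ∞ (fun y : X => g • y) :=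
    fun g => ContMDiffSMul.contMDiff_const_smul (I := 𝓡 k) g
  have hmul : ∀ g : G, ContMDiff (𝓡 k) (𝓡 k) ∞ (fun h : G => g * h) :=
    fun g => contMDiff_mul_left
  rw [injective_iff_map_eq_zero]
  intro v hv
  have hV : ContMDiffAt (𝓡 k) (𝓡 k).tangent 1
      (fun g : G => (mulInvariantVectorField v g : TangentBundle (𝓡 k) G)) 1 :=
    (contMDiffAt_mulInvariantVectorField v).of_le
      (by simp only [minSmoothness_of_isRCLikeNormedField]; exact one_le_two)
  obtain ⟨γ, hγ0, hγ⟩ := exists_isMIntegralCurveAt_of_contMDiffAt_boundaryless (t₀ := 0) hV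
  -- the field generated by `v` is killed by the differential of the orbit map everywhere
  have hkill : ∀ g : G, mfderiv (𝓡 k) (𝓡 d) (fun g : G => g • x) g
      (mulInvariantVectorField v g) = (0 : EuclideanSpace ℝ (Fin d)) := by
    intro g
    have h1 : HasMFDerivAt (𝓡 k) (𝓡 k) (fun h : G => g * h) 1
      (mfderiv (𝓡 k) (𝓡 k) (fun h : G => g * h) 1) :=
        ((hmul g).mdifferentiable (by simp) 1).hasMFDerivAt
    have h2 : HasMFDerivAt (𝓡 k) (𝓡 d) (fun g : G => g • x) (g * 1)
        (mfderiv (𝓡 k) (𝓡 d) (fun g : G => g • x) g) := by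
      rw [mul_one]
      exact (hμ.mdifferentiable (by simp) g).hasMFDerivAt
    have h3 := HasMFDerivAt.comp (g := fun g : G => g • x) (f := fun h : G => g * h) 1 h2 h1
    have h4 : HasMFDerivAt (𝓡 d) (𝓡 d) (fun y : X => g • y) ((1 : G) • x)
      (mfderiv (𝓡 d) (𝓡 d) (fun y : X => g • y) ((1 : G) • x)) :=
        ((hact g).mdifferentiable (by simp) _).hasMFDerivAt
    have h5 := HasMFDerivAt.comp (g := fun y : X => g • y) (f := fun h : G => h • x) 1 h4
      (hμ.mdifferentiable (by simp) 1).hasMFDerivAt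
    have h6 : ((fun g : G => g • x) ∘ fun h : G => g * h) =
        ((fun y : X => g • y) ∘ fun h : G => h • x) := by
      ext h; simp [mul_smul]
    rw [h6] at h3
    have h7 := DFunLike.congr_fun (hasMFDerivAt_unique h3 h5) v
    refine h7.trans ?_
    change mfderiv (𝓡 d) (𝓡 d) (fun y : X => g • y) ((1 : G) • x)
      (mfderiv (𝓡 k) (𝓡 d) (fun g : G => g • x) 1 v) = _
    rw [hv]
    exact map_zero _
  have hconst : ∀ᶠ t in 𝓝 (0 : ℝ), γ t • x = γ 0 • x := by
    refine eventually_eq_of_hasMFDerivAt_zero (d := d) (c := fun t => γ t • x) ?_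
    filter_upwards [hγ] with t ht
    have h1 := HasMFDerivAt.comp (g := fun g : G => g • x) t
      (hμ.mdifferentiable (by simp) (γ t)).hasMFDerivAt ht
    refine h1.congr_mfderiv ?_
    refine ContinuousLinearMap.ext fun (s : ℝ) => ?_
    change mfderiv (𝓡 k) (𝓡 d) (fun g : G => g • x) (γ t)
      (s • mulInvariantVectorField v (γ t)) = (0 : EuclideanSpace ℝ (Fin d))
    rw [map_smul, hkill]
    exact smul_zero (A := EuclideanSpace ℝ (Fin d)) s
  have h1 : γ =ᶠ[𝓝 0] fun _ => (1 : G) := by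
    filter_upwards [hconst] with t ht
    rw [hγ0, one_smul] at ht
    exact free _ _ ht
  have h2 := hasMFDerivAt_unique hγ.hasMFDerivAt
    ((hasMFDerivAt_const (I := 𝓘(ℝ, ℝ)) (I' := 𝓡 k) (1 : G) (0 : ℝ)).congr_of_eventuallyEq h1)
  have h3 : (1 : ℝ) • mulInvariantVectorField v (γ 0) = (0 : EuclideanSpace ℝ (Fin k)) :=
    DFunLike.congr_fun h2 (1 : ℝ)
  rw [one_smul, hγ0] at h3
  have h4 : (fun h : G => (1 : G) * h) = id := by ext; simp
  rwa [mulInvariantVectorField, h4, mfderiv_id] at h3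

/-- For a free and proper action, a group element that moves a point near `x` to a point near `x`
is near the neutral element. -/
theorem exists_nhds_forall_smul_mem_imp {G X : Type*} [Group G] [TopologicalSpace G]
    [TopologicalSpace X] [MulAction G X] [ProperSMul G X] (free : IsFreeAction G X) (x : X)
    {W : Set G} (hW : W ∈ 𝓝 (1 : G)) :
    ∃ V ∈ 𝓝 x, ∀ y ∈ V, ∀ g : G, g • y ∈ V → g ∈ W := by
  obtain ⟨W', hW', hWo, h1⟩ := mem_nhds_iff.1 hW
  have hcl := ((ProperSMul.isProperMap_smul_pair (G := G) (X := X)).isClosedMap _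
    ((hWo.preimage continuous_fst).isClosed_compl)).isOpen_compl
  have hx : (x, x) ∈ ((fun gx : G × X => (gx.1 • gx.2, gx.2)) '' (Prod.fst ⁻¹' W')ᶜ)ᶜ := by
    rintro ⟨⟨g, y⟩, hg, h⟩
    obtain ⟨h2, rfl⟩ := Prod.mk.inj h
    exact hg (by rw [mem_preimage, free g y h2]; exact h1)
  obtain ⟨V₁, hV₁, V₂, hV₂, hV⟩ := mem_nhds_prod_iff.1 (hcl.mem_nhds hx)
  refine ⟨V₁ ∩ V₂, inter_mem hV₁ hV₂, fun y hy g hg => hW' ?_⟩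
  by_contra hgW
  exact hV (mk_mem_prod hg.1 hy.2) ⟨(g, y), hgW, rfl⟩

/-- A slice for a free and proper action: near `x` every point `y` can be moved by a group element
`Γ y` that depends smoothly on it, in such a way that the points of one orbit are moved to one
point.  The element `Γ y` is determined by the condition that a linear projection of `Γ y • y`,
in a chart, to the tangent space of the orbit is constant. -/
theorem exists_slice [ProperSMul G X] (free : IsFreeAction G X) (x : X) :
    ∃ (Γ : X → G) (V : Set X), IsOpen V ∧ x ∈ V ∧ Γ x = 1 ∧
      (∀ y ∈ V, ContMDiffAt (𝓡 d) (𝓡 k) ∞ Γ y) ∧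
      ∀ y ∈ V, ∀ g : G, g • y ∈ V → Γ (g • y) • g • y = Γ y • y := by
  have hsm : ContMDiff ((𝓡 k).prod (𝓡 d)) (𝓡 d) ∞ (fun p : G × X => p.1 • p.2) :=
    contMDiff_smul (I := 𝓡 k) (I' := 𝓡 d) (n := ∞) (G := G) (M := X)
  have hM : IsManifold (𝓡 k) ∞ G := inferInstance
  have hμ : ContMDiff (𝓡 k) (𝓡 d) ∞ (fun g : G => g • x) :=
    hsm.comp (contMDiff_id.prodMk contMDiff_const)
  let A : EuclideanSpace ℝ (Fin k) →L[ℝ] EuclideanSpace ℝ (Fin d) :=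
    mfderiv (𝓡 k) (𝓡 d) (fun g : G => g • x) 1
  have hA : HasMFDerivAt (𝓡 k) (𝓡 d) (fun g : G => g • x) 1 A :=
    (hμ.mdifferentiable (by simp) 1).hasMFDerivAt
  obtain ⟨T₀, hT₀⟩ := A.toLinearMap.exists_leftInverse_of_injective
    (LinearMap.ker_eq_bot.2 (injective_mfderiv_orbitMap free x))
  let T : EuclideanSpace ℝ (Fin d) →L[ℝ] EuclideanSpace ℝ (Fin k) :=
    LinearMap.toContinuousLinearMap T₀
  have hTA : ∀ u, T (A u) = u := fun u => LinearMap.congr_fun hT₀ u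
  let φ := extChartAt (𝓡 d) x
  let Ψ : G × X → EuclideanSpace ℝ (Fin k) × X := fun p => (T (φ (p.1 • p.2)), p.2)
  have hφs : ∀ᶠ y in 𝓝 x, ContMDiffAt (𝓡 d) 𝓘(ℝ, EuclideanSpace ℝ (Fin d)) ∞ φ y := by
    filter_upwards [(chartAt (EuclideanSpace ℝ (Fin d)) x).open_source.mem_nhds
      (mem_chart_source _ x)] with y hy
    exact contMDiffAt_extChartAt' hy
  have hsmt : Tendsto (fun p : G × X => p.1 • p.2) (𝓝 (1, x)) (𝓝 x) := by
    have := hsm.continuous.tendsto ((1 : G), x)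
    rwa [one_smul] at this
  have hΨs : ∀ᶠ p in 𝓝 ((1 : G), x), ContMDiffAt ((𝓡 k).prod (𝓡 d)) ((𝓡 k).prod (𝓡 d)) ∞ Ψ p := by
    filter_upwards [hsmt.eventually hφs] with p hp
    exact ContMDiffAt.prodMk (T.contDiff.contMDiff.contMDiffAt.comp p
      (ContMDiffAt.comp p (g := φ) hp hsm.contMDiffAt)) contMDiffAt_snd
  have hΨ1 : Ψ (1, x) = (T (φ x), x) := by simp only [Ψ, one_smul]
  have hΨd := (hΨs.self_of_nhds.mdifferentiableAt (by simp)).hasMFDerivAt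
  have hinj : Injective (mfderiv ((𝓡 k).prod (𝓡 d)) ((𝓡 k).prod (𝓡 d)) Ψ (1, x)) := by
    have h1 : HasMFDerivAt (𝓡 k) ((𝓡 k).prod (𝓡 d)) (fun g : G => (g, x)) 1
        ((ContinuousLinearMap.id ℝ (EuclideanSpace ℝ (Fin k))).prod
          (0 : EuclideanSpace ℝ (Fin k) →L[ℝ] EuclideanSpace ℝ (Fin d))) :=
      (hasMFDerivAt_id (1 : G)).prodMk (hasMFDerivAt_const x (1 : G))
    have h2 : HasMFDerivAt (𝓡 k) (𝓡 k) (fun g : G => T (φ (g • x))) 1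
        (ContinuousLinearMap.id ℝ (EuclideanSpace ℝ (Fin k))) := by
      have h3 := (mdifferentiableAt_extChartAt (I := 𝓡 d)
        (mem_chart_source (EuclideanSpace ℝ (Fin d)) x)).hasMFDerivAt
      rw [mfderiv_extChartAt_self] at h3
      have h4 := (T.hasMFDerivAt (x := φ x)).comp x h3
      have h5 : HasMFDerivAt (𝓡 d) (𝓡 k) (fun y => T (φ y)) ((1 : G) • x) T := by
        rw [one_smul]; exact h4
      refine (HasMFDerivAt.comp (g := fun y => T (φ y)) 1 h5 hA).congr_mfderiv ?_
      exact ContinuousLinearMap.ext hTA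
    have h3 := h2.prodMk (hasMFDerivAt_const x (1 : G) (I' := 𝓡 d))
    have h4 := hasMFDerivAt_unique (HasMFDerivAt.comp (f := fun g : G => (g, x)) 1 hΨd h1) h3
    have h5 := hasMFDerivAt_unique (HasMFDerivAt.comp (f := Ψ) (g := Prod.snd) ((1 : G), x)
        (hasMFDerivAt_snd (I := 𝓡 k) (I' := 𝓡 d) _) hΨd)
        (hasMFDerivAt_snd (I := 𝓡 k) (I' := 𝓡 d) _)
    rw [injective_iff_map_eq_zero]
    rintro ⟨u, c⟩ huc
    have hc : c = (0 : EuclideanSpace ℝ (Fin d)) :=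
      (DFunLike.congr_fun h5 (u, c)).symm.trans (congrArg Prod.snd huc)
    subst hc
    have hu : u = (0 : EuclideanSpace ℝ (Fin k)) :=
      (congrArg Prod.fst (DFunLike.congr_fun h4 u)).symm.trans (congrArg Prod.fst huc)
    subst hu
    rfl
  have hbij : Bijective (mfderiv ((𝓡 k).prod (𝓡 d)) ((𝓡 k).prod (𝓡 d)) Ψ (1, x)) := by
    refine ⟨hinj, ?_⟩
    let D : EuclideanSpace ℝ (Fin k) × EuclideanSpace ℝ (Fin d) →ₗ[ℝ]
        EuclideanSpace ℝ (Fin k) × EuclideanSpace ℝ (Fin d) :=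
      (mfderiv ((𝓡 k).prod (𝓡 d)) ((𝓡 k).prod (𝓡 d)) Ψ (1, x)).toLinearMap
    exact (LinearMap.injective_iff_surjective (f := D)).1 hinj
  obtain ⟨h, h1, h2, h3, h4⟩ := exists_local_inverse_of_mfderiv_bijective hΨs hbij
  rw [hΨ1] at h1 h2 h4
  have hin : Tendsto (fun y : X => (T (φ x), y)) (𝓝 x) (𝓝 (T (φ x), x)) :=
    (Continuous.prodMk_right (T (φ x))).tendsto x
  have hΓs : ∀ᶠ y in 𝓝 x, ContMDiffAt (𝓡 d) (𝓡 k) ∞ (fun y => (h (T (φ x), y)).1) y := by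
    filter_upwards [hin.eventually h2] with y hy
    exact ContMDiffAt.comp y (contMDiffAt_fst (I := 𝓡 k) (J := 𝓡 d)) (ContMDiffAt.comp y
      (I' := (𝓡 k).prod (𝓡 d)) (f := fun y : X => (T (φ x), y)) hy
      (contMDiffAt_const.prodMk contMDiffAt_id))
  have hΓ1 : (h (T (φ x), x)).1 = 1 := by rw [h1]
  have hΓc : Tendsto (fun y => (h (T (φ x), y)).1) (𝓝 x) (𝓝 1) := by
    have := hΓs.self_of_nhds.continuousAt.tendsto
    rwa [hΓ1] at this
  -- `Γ y` is the only solution near the neutral element, in a neighbourhood `N₁ × V₁`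
  obtain ⟨N₁, hN₁, V₁, hV₁, hu⟩ := mem_nhds_prod_iff.1 h3
  have hcG : ContinuousMul G := continuousMul_of_contMDiffMul (𝓡 k) ∞
  obtain ⟨N₂, hN₂o, h1N₂, hN₂⟩ := exists_open_nhds_one_mul_subset hN₁
  obtain ⟨V₂, hV₂, hV₂'⟩ := exists_nhds_forall_smul_mem_imp free x (hN₂o.mem_nhds h1N₂)
  have hev : ∀ᶠ y in 𝓝 x, ContMDiffAt (𝓡 d) (𝓡 k) ∞ (fun y => (h (T (φ x), y)).1) y ∧
      Ψ (h (T (φ x), y)) = (T (φ x), y) ∧ (h (T (φ x), y)).1 ∈ N₂ ∧ y ∈ V₁ ∧ y ∈ V₂ := by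
    filter_upwards [hΓs, hin.eventually h4, hΓc.eventually_mem (hN₂o.mem_nhds h1N₂), hV₁, hV₂]
      with y h5 h6 h7 h8 h9
    exact ⟨h5, h6, h7, h8, h9⟩
  obtain ⟨V, hV, hVo, hxV⟩ := eventually_nhds_iff.1 hev
  refine ⟨fun y => (h (T (φ x), y)).1, V, hVo, hxV, hΓ1, fun y hy => (hV y hy).1, ?_⟩
  intro y hy g hgy
  obtain ⟨-, -, -, hy1, hy2⟩ := hV y hy
  obtain ⟨-, h6, h7, -, hgy2⟩ := hV (g • y) hgy
  have h8 : (h (T (φ x), g • y)).1 * g ∈ N₁ :=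
    hN₂ (mul_mem_mul h7 (hV₂' y hy2 g hgy2))
  have h9 : h (Ψ ((h (T (φ x), g • y)).1 * g, y)) = ((h (T (φ x), g • y)).1 * g, y) :=
    hu (mk_mem_prod h8 hy1)
  have h10 : (h (T (φ x), g • y)).2 = g • y := congrArg Prod.snd h6
  have h11 : T (φ ((h (T (φ x), g • y)).1 • g • y)) = T (φ x) := by
    have := congrArg Prod.fst h6
    simp only [Ψ, h10] at this
    exact this
  have h12 : Ψ ((h (T (φ x), g • y)).1 * g, y) = (T (φ x), y) := by
    simp only [Ψ, mul_smul, h11]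
  rw [h12] at h9
  simp only [h9, mul_smul]

/-- The differential at `x` of the retraction `y ↦ Γ y • y` onto a slice through `x` is the
identity modulo the tangent space of the orbit. -/
theorem hasMFDerivAt_slice {Γ : X → G} {x : X} (hΓ1 : Γ x = 1)
    {A : EuclideanSpace ℝ (Fin k) →L[ℝ] EuclideanSpace ℝ (Fin d)}
    {B : EuclideanSpace ℝ (Fin d) →L[ℝ] EuclideanSpace ℝ (Fin k)}
    (hA : HasMFDerivAt (𝓡 k) (𝓡 d) (fun g : G => g • x) 1 A)
    (hB : HasMFDerivAt (𝓡 d) (𝓡 k) Γ x B) :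
    HasMFDerivAt (𝓡 d) (𝓡 d) (fun y => Γ y • y) x
      (A.comp B + ContinuousLinearMap.id ℝ (EuclideanSpace ℝ (Fin d))) := by
  have hsm : ContMDiff ((𝓡 k).prod (𝓡 d)) (𝓡 d) ∞ (fun p : G × X => p.1 • p.2) :=
    contMDiff_smul (I := 𝓡 k) (I' := 𝓡 d) (n := ∞) (G := G) (M := X)
  have h2 := HasMFDerivAt.comp (f := fun y => (Γ y, id y)) (g := fun p : G × X => p.1 • p.2) x
    (hsm.mdifferentiable (by simp) (Γ x, x)).hasMFDerivAt (hB.prodMk (hasMFDerivAt_id x))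
  refine h2.congr_mfderiv (ContinuousLinearMap.ext fun (c : EuclideanSpace ℝ (Fin d)) => ?_)
  have h4 := mfderiv_prod_eq_add_apply (I := 𝓡 k) (I' := 𝓡 d) (v := (B c, c))
    (hsm.mdifferentiable (by simp) (Γ x, x))
  refine h4.trans ?_
  have hA' : HasMFDerivAt (𝓡 k) (𝓡 d) (fun g : G => g • x) (Γ x) A := by
    rw [hΓ1]; exact hA
  have hI : HasMFDerivAt (𝓡 d) (𝓡 d) (fun z : X => Γ x • z) x
      (ContinuousLinearMap.id ℝ (EuclideanSpace ℝ (Fin d))) :=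
    (hasMFDerivAt_id x).congr_of_eventuallyEq
      (Eventually.of_forall fun z => by simp only [hΓ1, one_smul, id])
  exact congrArg₂ (fun a b : EuclideanSpace ℝ (Fin d) => a + b)
    (DFunLike.congr_fun hA'.mfderiv (B c)) (DFunLike.congr_fun hI.mfderiv c)

/-- **Quotients by free and proper actions.** The orbit space of a free and proper smooth action
is a manifold, the projection is a submersion, and the kernel of its differential consists of
tangent vectors of orbits. -/
theorem exists_isManifold_orbit_quotient [ProperSMul G X] (free : IsFreeAction G X) :
    ∃ (_ : ChartedSpace (EuclideanSpace ℝ (Fin (d - k))) (MulAction.orbitRel.Quotient G X))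
      (_ : IsManifold (𝓡 (d - k)) ∞ (MulAction.orbitRel.Quotient G X)),
      IsSurjSubmersion d (d - k)
        (fun x => (Quotient.mk _ x : MulAction.orbitRel.Quotient G X)) ∧
      ∀ (x : X) (c : TangentSpace (𝓡 d) x),
        mfderiv (𝓡 d) (𝓡 (d - k))
          (fun x => (Quotient.mk _ x : MulAction.orbitRel.Quotient G X)) x c = 0 →
        ∃ u : TangentSpace (𝓡 k) (1 : G),
          (mfderiv (𝓡 k) (𝓡 d) (fun g : G => g • x) 1 u : EuclideanSpace ℝ (Fin d)) = c := by
  set π : X → MulAction.orbitRel.Quotient G X := fun x => Quotient.mk _ x with hπ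
  have hact : ∀ g : G, ContMDiff (𝓡 d) (𝓡 d) ∞ (fun y : X => g • y) :=
    fun g => ContMDiffSMul.contMDiff_const_smul (I := 𝓡 k) g
  have hμ : ∀ x : X, ContMDiff (𝓡 k) (𝓡 d) ∞ (fun g : G => g • x) := fun x =>
    (contMDiff_smul (I := 𝓡 k) (I' := 𝓡 d) (n := ∞) (G := G) (M := X)).comp
      (contMDiff_id.prodMk contMDiff_const)
  have hquot : IsOpenQuotientMap π := MulAction.isOpenQuotientMap_quotientMk
  have hπg : ∀ (g : G) (x : X), π (g • x) = π x := fun g x =>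
    Quotient.sound (MulAction.orbitRel_apply.2 (MulAction.mem_orbit x g))
  have hπe : ∀ {x y : X}, π x = π y → ∃ g : G, g • y = x := fun h =>
    MulAction.orbitRel_apply.1 (Quotient.exact h)
  choose Γ V hVo hxV hΓ1 hΓs hΓ using fun x : X => exists_slice (k := k) (d := d) free x
  -- the local section of `π` through `x` determined by the slice
  have hσ : ∀ x : X, ∃ σ : MulAction.orbitRel.Quotient G X → X,
      ∀ y ∈ V x, σ (π y) = Γ x y • y := by
    intro x
    classical
    refine ⟨fun q => if h : ∃ y ∈ V x, π y = q then Γ x h.choose • h.choose else x, ?_⟩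
    intro y hy
    have h : ∃ y' ∈ V x, π y' = π y := ⟨y, hy, rfl⟩
    change (if h : ∃ y' ∈ V x, π y' = π y then Γ x h.choose • h.choose else x) = _
    rw [dif_pos h]
    obtain ⟨g, hg⟩ := hπe h.choose_spec.2
    have h1 := hΓ x y hy g (by rw [hg]; exact h.choose_spec.1)
    rwa [hg] at h1
  choose σ hσ using hσ
  have hσx : ∀ x, σ x (π x) = x := fun x => by rw [hσ x x (hxV x), hΓ1, one_smul]
  have hUo : ∀ x, IsOpen (π '' V x) := fun x => hquot.isOpenMap _ (hVo x)
  have hπσ : ∀ x, ∀ q ∈ π '' V x, π (σ x q) = q := by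
    rintro x _ ⟨y, hy, rfl⟩
    rw [hσ x y hy, hπg]
  have hΩs : ∀ x, ∀ y ∈ V x, ContMDiffAt (𝓡 d) (𝓡 d) ∞ (fun y => Γ x y • y) y := fun x y hy =>
    ContMDiffAt.smul (I := 𝓡 k) (hΓs x y hy) contMDiffAt_id
  have hσπ : ∀ x, ∀ z, π z ∈ π '' V x → ContMDiffAt (𝓡 d) (𝓡 d) ∞ (σ x ∘ π) z := by
    rintro x z ⟨y, hy, hyz⟩
    obtain ⟨g, rfl⟩ := hπe hyz
    have h1 : ContMDiffAt (𝓡 d) (𝓡 d) ∞ ((fun y => Γ x y • y) ∘ fun z => g • z) z :=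
      ContMDiffAt.comp z (hΩs x _ hy) (hact g).contMDiffAt
    refine h1.congr_of_eventuallyEq ?_
    filter_upwards [(hact g).continuous.continuousAt.eventually_mem ((hVo x).mem_nhds hy)]
      with z' hz'
    simp only [comp_apply]
    rw [← hσ x _ hz', hπg]
  have hσc : ∀ x, ContinuousOn (σ x) (π '' V x) := by
    intro x q hq
    obtain ⟨z, rfl⟩ := hquot.surjective q
    refine ContinuousAt.continuousWithinAt ?_
    have h1 := (hσπ x z hq).continuousAt
    rw [ContinuousAt, ← hquot.map_nhds_eq z]
    exact h1
  have hdΩ : ∀ x, mfderiv (𝓡 d) (𝓡 d) (σ x ∘ π) x =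
      mfderiv (𝓡 d) (𝓡 d) (fun y => Γ x y • y) x := fun x =>
    Filter.EventuallyEq.mfderiv_eq (by
      filter_upwards [(hVo x).mem_nhds (hxV x)] with y hy using hσ x y hy)
  have hker : ∀ (x : X) (c : EuclideanSpace ℝ (Fin d)),
      (mfderiv (𝓡 d) (𝓡 d) (σ x ∘ π) x c : EuclideanSpace ℝ (Fin d)) = 0 ↔
      ∃ u : EuclideanSpace ℝ (Fin k),
        (mfderiv (𝓡 k) (𝓡 d) (fun g : G => g • x) 1 u : EuclideanSpace ℝ (Fin d)) = c := by
    intro x c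
    constructor
    · intro h
      let A : EuclideanSpace ℝ (Fin k) →L[ℝ] EuclideanSpace ℝ (Fin d) :=
        mfderiv (𝓡 k) (𝓡 d) (fun g : G => g • x) 1
      let B : EuclideanSpace ℝ (Fin d) →L[ℝ] EuclideanSpace ℝ (Fin k) :=
        mfderiv (𝓡 d) (𝓡 k) (Γ x) x
      have h1 := hasMFDerivAt_slice (A := A) (B := B) (hΓ1 x)
        ((hμ x).mdifferentiable (by simp) 1).hasMFDerivAt
        ((hΓs x x (hxV x)).mdifferentiableAt (by simp)).hasMFDerivAt
      rw [hdΩ, h1.mfderiv] at h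
      have h2 : A (B c) + c = 0 := h
      exact ⟨-B c, (map_neg A _).trans (neg_eq_of_add_eq_zero_right h2)⟩
    · rintro ⟨u, rfl⟩
      have h1 : HasMFDerivAt (𝓡 d) (𝓡 d) (σ x ∘ π) ((1 : G) • x)
          (mfderiv (𝓡 d) (𝓡 d) (σ x ∘ π) x) := by
        rw [one_smul]
        exact ((hσπ x x (mem_image_of_mem _ (hxV x))).mdifferentiableAt (by simp)).hasMFDerivAt
      have h2 := HasMFDerivAt.comp (g := σ x ∘ π) (f := fun g : G => g • x) 1 h1
        ((hμ x).mdifferentiable (by simp) 1).hasMFDerivAt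
      have h3 : ((σ x ∘ π) ∘ fun g : G => g • x) = fun _ : G => x := by
        ext g; simp only [comp_apply, hπg, hσx]
      rw [h3] at h2
      exact DFunLike.congr_fun (hasMFDerivAt_unique h2 (hasMFDerivAt_const x (1 : G))) u
  have hrank : ∀ x, Module.finrank ℝ
      (mfderiv (𝓡 d) (𝓡 d) (σ x ∘ π) x).toLinearMap.range = d - k := by
    intro x
    let P : EuclideanSpace ℝ (Fin d) →ₗ[ℝ] EuclideanSpace ℝ (Fin d) :=
      (mfderiv (𝓡 d) (𝓡 d) (σ x ∘ π) x).toLinearMap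
    let A : EuclideanSpace ℝ (Fin k) →ₗ[ℝ] EuclideanSpace ℝ (Fin d) :=
      (mfderiv (𝓡 k) (𝓡 d) (fun g : G => g • x) 1).toLinearMap
    have h1 : P.ker = A.range := Submodule.ext fun c => hker x c
    have h2 : Module.finrank ℝ A.range = k := by
      have h3 := LinearMap.finrank_range_of_inj (f := A) (injective_mfderiv_orbitMap free x)
      rw [h3, finrank_euclideanSpace_fin]
    have h4 := P.finrank_range_add_finrank_ker
    rw [h1, h2, finrank_euclideanSpace_fin] at h4
    exact Nat.eq_sub_of_add_eq h4
  choose r hr using hquot.surjective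
  obtain ⟨cs, hm, hιs, hρs⟩ := exists_isManifold_of_local_retracts (I := 𝓡 d) (e := d - k)
    (ι := fun q => σ (r q)) (ρ := fun _ => π) (U := fun q => π '' V (r q)) (V := fun _ => univ)
    (fun q => hUo _) (fun q => ⟨r q, hxV _, hr q⟩) (fun _ => isOpen_univ) (fun _ => mem_univ _)
    (fun q => hσc _) (fun _ => hquot.continuous.continuousOn) (fun q => hπσ _)
    (fun q q' z hz => (hσπ _ z hz.2).contMDiffWithinAt)
    (fun q => by
      have h1 : σ (r q) q = r q := by
        have := hσx (r q)
        rwa [hr] at this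
      have h2 : ∀ z, z = r q → Module.finrank ℝ
          (mfderiv (𝓡 d) (𝓡 d) (σ (r q) ∘ π) z).toLinearMap.range = d - k := by
        rintro _ rfl
        exact hrank (r q)
      exact h2 _ h1)
  have hπs : ContMDiff (𝓡 d) (𝓡 (d - k)) ∞ π := fun x =>
    (hρs (π x)).contMDiffAt univ_mem
  -- the sections `σ x` are smooth, as `σ x ∘ π` is and `π` has smooth sections
  have hσs : ∀ x, ContMDiffAt (𝓡 (d - k)) (𝓡 d) ∞ (σ x) (π x) := by
    intro x
    have hmem : π x ∈ π '' V (r (π x)) := ⟨r (π x), hxV _, hr _⟩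
    have h1 : ContMDiffAt (𝓡 (d - k)) (𝓡 d) ∞ (σ (r (π x))) (π x) :=
      (hιs (π x)).contMDiffAt ((hUo _).mem_nhds hmem)
    have h2 : ContMDiffAt (𝓡 d) (𝓡 d) ∞ (σ x ∘ π) (σ (r (π x)) (π x)) :=
      hσπ x _ (by rw [hπσ _ _ hmem]; exact mem_image_of_mem _ (hxV x))
    refine (ContMDiffAt.comp (π x) h2 h1).congr_of_eventuallyEq ?_
    filter_upwards [(hUo _).mem_nhds hmem] with q hq
    simp only [comp_apply, hπσ _ _ hq]
  refine ⟨cs, hm, ⟨hπs, hquot.surjective, fun x v => ?_⟩, fun x c hc => ?_⟩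
  · have h1 : HasMFDerivAt (𝓡 d) (𝓡 (d - k)) π (σ x (π x)) (mfderiv (𝓡 d) (𝓡 (d - k)) π x) := by
      rw [hσx]
      exact (hπs.mdifferentiable (by simp) x).hasMFDerivAt
    have h2 := HasMFDerivAt.comp (π x) h1 ((hσs x).mdifferentiableAt (by simp)).hasMFDerivAt
    have h3 := h2.congr_of_eventuallyEq (f₁ := id) (by
      filter_upwards [(hUo x).mem_nhds (mem_image_of_mem _ (hxV x))] with q hq
      exact (hπσ x q hq).symm)
    exact ⟨mfderiv (𝓡 (d - k)) (𝓡 d) (σ x) (π x) v,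
      DFunLike.congr_fun (hasMFDerivAt_unique h3 (hasMFDerivAt_id (π x))) v⟩
  · have h1 := HasMFDerivAt.comp x ((hσs x).mdifferentiableAt (by simp)).hasMFDerivAt
      (hπs.mdifferentiable (by simp) x).hasMFDerivAt
    refine (hker x c).1 ((DFunLike.congr_fun h1.mfderiv c).trans ?_)
    exact (congrArg _ hc).trans (map_zero (mfderiv (𝓡 (d - k)) (𝓡 d) (σ x) (π x)))

end Orbits

/-! ### The manifold of composable pairs -/

section ComposablePairs

open Filter Topology Set Function

variable {e₁ e₀ : ℕ} {Y₁ Y₀ : Type*}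
  [TopologicalSpace Y₁] [ChartedSpace (EuclideanSpace ℝ (Fin e₁)) Y₁] [IsManifold (𝓡 e₁) ∞ Y₁]
  [TopologicalSpace Y₀] [ChartedSpace (EuclideanSpace ℝ (Fin e₀)) Y₀] [IsManifold (𝓡 e₀) ∞ Y₀]

namespace GroupoidStr

/-- The inclusion `Y₂ → Y₁ × Y₁`. -/
def incl (𝒴 : GroupoidStr Y₁ Y₀) (x : 𝒴.Comp) : Y₁ × Y₁ := x.1

theorem continuous_incl (𝒴 : GroupoidStr Y₁ Y₀) : Continuous 𝒴.incl := continuous_subtype_val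

theorem isInducing_incl (𝒴 : GroupoidStr Y₁ Y₀) : IsInducing 𝒴.incl := IsInducing.subtypeVal

/-- Tangent vectors `(A, B)` of the space of composable pairs satisfy `ds A = dt B`. -/
theorem mfderiv_src_eq_mfderiv_tgt {E : Type*} [NormedAddCommGroup E] [NormedSpace ℝ E]
    {H : Type*} [TopologicalSpace H] {I : ModelWithCorners ℝ E H} {Z : Type*} [TopologicalSpace Z]
    [ChartedSpace H Z] (𝒴 : GroupoidStr Y₁ Y₀)
    (hs : ContMDiff (𝓡 e₁) (𝓡 e₀) ∞ 𝒴.src) (ht : ContMDiff (𝓡 e₁) (𝓡 e₀) ∞ 𝒴.tgt)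
    {f : Z → Y₁ × Y₁} {z : Z} {D : E →L[ℝ] EuclideanSpace ℝ (Fin e₁) × EuclideanSpace ℝ (Fin e₁)}
    (hf : HasMFDerivAt I ((𝓡 e₁).prod (𝓡 e₁)) f z D)
    (h : ∀ᶠ y in 𝓝 z, 𝒴.src (f y).1 = 𝒴.tgt (f y).2) (v : E) :
    (mfderiv (𝓡 e₁) (𝓡 e₀) 𝒴.src (f z).1 (D v).1 : EuclideanSpace ℝ (Fin e₀)) =
      mfderiv (𝓡 e₁) (𝓡 e₀) 𝒴.tgt (f z).2 (D v).2 := by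
  have h1 := HasMFDerivAt.comp (g := 𝒴.src) (f := fun y => (f y).1) z
    (hs.mdifferentiable (by simp) _).hasMFDerivAt
    (HasMFDerivAt.comp (g := Prod.fst) z (hasMFDerivAt_fst (f z)) hf)
  have h2 := HasMFDerivAt.comp (g := 𝒴.tgt) (f := fun y => (f y).2) z
    (ht.mdifferentiable (by simp) _).hasMFDerivAt
    (HasMFDerivAt.comp (g := Prod.snd) z (hasMFDerivAt_snd (f z)) hf)
  exact DFunLike.congr_fun (hasMFDerivAt_unique h1 (h2.congr_of_eventuallyEq h)) v

/-- The space of composable pairs is locally a smooth retract of `Y₁ × Y₁`: move `q` to the fibre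
of `t` over `s(p)`. -/
theorem exists_retraction (𝒴 : GroupoidStr Y₁ Y₀)
    (hs : IsSurjSubmersion e₁ e₀ 𝒴.src) (ht : IsSurjSubmersion e₁ e₀ 𝒴.tgt) (x : 𝒴.Comp) :
    ∃ (ρ : Y₁ × Y₁ → 𝒴.Comp) (V : Set (Y₁ × Y₁)) (U : Set 𝒴.Comp), IsOpen V ∧ IsOpen U ∧ x ∈ U ∧
      (∀ y ∈ U, 𝒴.incl y ∈ V ∧ ρ (𝒴.incl y) = y) ∧ ContinuousOn ρ V ∧
      ContMDiffOn ((𝓡 e₁).prod (𝓡 e₁)) ((𝓡 e₁).prod (𝓡 e₁)) ∞ (𝒴.incl ∘ ρ) V ∧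
      ∀ A B : EuclideanSpace ℝ (Fin e₁),
        (mfderiv (𝓡 e₁) (𝓡 e₀) 𝒴.src (𝒴.incl x).1 A : EuclideanSpace ℝ (Fin e₀)) =
          mfderiv (𝓡 e₁) (𝓡 e₀) 𝒴.tgt (𝒴.incl x).2 B →
        (mfderiv ((𝓡 e₁).prod (𝓡 e₁)) ((𝓡 e₁).prod (𝓡 e₁)) (𝒴.incl ∘ ρ) (𝒴.incl x) (A, B) :
          EuclideanSpace ℝ (Fin e₁) × EuclideanSpace ℝ (Fin e₁)) = (A, B) := by
  obtain ⟨⟨p, q⟩, hpq⟩ := x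
  change 𝒴.src p = 𝒴.tgt q at hpq
  obtain ⟨S, hS1, hS2, hS3⟩ := ht.contMDiff.exists_fibre_transport (ht.mfderiv_surjective q)
  rw [← hpq] at hS1 hS2
  let τ : Y₁ × Y₁ → Y₀ × Y₁ := fun z => (𝒴.src z.1, z.2)
  have hτ : ContMDiff ((𝓡 e₁).prod (𝓡 e₁)) ((𝓡 e₀).prod (𝓡 e₁)) ∞ τ :=
    (hs.contMDiff.comp contMDiff_fst).prodMk contMDiff_snd
  have hev : ∀ᶠ z in 𝓝 (p, q), ContMDiffAt ((𝓡 e₀).prod (𝓡 e₁)) (𝓡 e₁) ∞ S (τ z) ∧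
      𝒴.tgt (S (τ z)) = 𝒴.src z.1 :=
    (hτ.continuous.tendsto (p, q)).eventually (hS1.and hS2)
  obtain ⟨V, hV, hVo, hxV⟩ := eventually_nhds_iff.1 hev
  obtain ⟨W, hW, hWo, hqW⟩ := eventually_nhds_iff.1 hS3
  classical
  let ρ : Y₁ × Y₁ → 𝒴.Comp := fun z =>
    if h : 𝒴.src z.1 = 𝒴.tgt (S (τ z)) then ⟨(z.1, S (τ z)), h⟩ else ⟨(p, q), hpq⟩
  have hρ : ∀ z ∈ V, 𝒴.incl (ρ z) = (z.1, S (τ z)) := fun z hz => by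
    have h : 𝒴.src z.1 = 𝒴.tgt (S (τ z)) := (hV z hz).2.symm
    exact congrArg 𝒴.incl (dif_pos h)
  have hΩ : ContMDiffOn ((𝓡 e₁).prod (𝓡 e₁)) ((𝓡 e₁).prod (𝓡 e₁)) ∞ (𝒴.incl ∘ ρ) V := by
    intro z hz
    refine ContMDiffWithinAt.congr (ContMDiffAt.contMDiffWithinAt ?_) hρ (hρ z hz)
    exact contMDiffAt_fst.prodMk (ContMDiffAt.comp z (hV z hz).1 hτ.contMDiffAt)
  refine ⟨ρ, V, {y | 𝒴.incl y ∈ V ∧ (𝒴.incl y).2 ∈ W}, hVo, ?_, ⟨hxV, hqW⟩, ?_, ?_, hΩ, ?_⟩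
  · exact (hVo.preimage 𝒴.continuous_incl).inter
      (hWo.preimage (continuous_snd.comp 𝒴.continuous_incl))
  · rintro y ⟨hy1, hy2⟩
    refine ⟨hy1, Subtype.ext ?_⟩
    refine (hρ _ hy1).trans (Prod.ext rfl ?_)
    have h1 := hW _ hy2
    have h2 : 𝒴.src (𝒴.incl y).1 = 𝒴.tgt (𝒴.incl y).2 := y.2
    rw [← h2] at h1
    exact h1
  · rw [𝒴.isInducing_incl.continuousOn_iff]
    exact hΩ.continuousOn
  · intro A B hAB
    have h1 : HasMFDerivAt ((𝓡 e₁).prod (𝓡 e₁)) (𝓡 e₀) (fun z : Y₁ × Y₁ => 𝒴.src z.1) (p, q) _ :=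
      HasMFDerivAt.comp (g := 𝒴.src) (f := Prod.fst) (p, q)
        (hs.contMDiff.mdifferentiable (by simp) p).hasMFDerivAt (hasMFDerivAt_fst (p, q))
    have h2 := h1.prodMk (hasMFDerivAt_snd (I := 𝓡 e₁) (I' := 𝓡 e₁) (p, q))
    have h3 := HasMFDerivAt.comp (g := S) (f := τ) (p, q)
      (hS1.self_of_nhds.mdifferentiableAt (by simp)).hasMFDerivAt h2
    have h4 := (hasMFDerivAt_fst (I := 𝓡 e₁) (I' := 𝓡 e₁) (p, q)).prodMk h3
    have h5 := h4.congr_of_eventuallyEq (f₁ := 𝒴.incl ∘ ρ)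
      (by filter_upwards [hVo.mem_nhds hxV] with z hz using hρ z hz)
    have h6 := mfderiv_fibre_transport (ht.contMDiff.mdifferentiable (by simp) q)
      (S := S) (by rw [← hpq]; exact hS1.self_of_nhds.mdifferentiableAt (by simp)) hS3 B
    rw [← hpq] at h6
    refine (DFunLike.congr_fun h5.mfderiv (A, B)).trans (Prod.ext rfl ?_)
    refine Eq.trans ?_ h6
    exact congrArg (fun C : EuclideanSpace ℝ (Fin e₀) =>
      (mfderiv ((𝓡 e₀).prod (𝓡 e₁)) (𝓡 e₁) S (𝒴.src p, q) (C, B) : EuclideanSpace ℝ (Fin e₁))) hAB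

/-- The composable pairs of a groupoid whose source and target are submersions form an
embedded submanifold of `Y₁ × Y₁`. -/
theorem exists_isManifold_comp (𝒴 : GroupoidStr Y₁ Y₀)
    (hs : IsSurjSubmersion e₁ e₀ 𝒴.src) (ht : IsSurjSubmersion e₁ e₀ 𝒴.tgt) :
    ∃ (_ : ChartedSpace (EuclideanSpace ℝ (Fin (2 * e₁ - e₀))) 𝒴.Comp)
      (_ : IsManifold (𝓡 (2 * e₁ - e₀)) ∞ 𝒴.Comp),
      ContMDiff (𝓡 (2 * e₁ - e₀)) ((𝓡 e₁).prod (𝓡 e₁)) ∞ 𝒴.incl ∧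
      ∀ x, Injective (mfderiv (𝓡 (2 * e₁ - e₀)) ((𝓡 e₁).prod (𝓡 e₁)) 𝒴.incl x) := by
  choose ρ V U hV hU hxU hρι hρc hΩ hdΩ using 𝒴.exists_retraction hs ht
  have hrank : ∀ x, Module.finrank ℝ (mfderiv ((𝓡 e₁).prod (𝓡 e₁)) ((𝓡 e₁).prod (𝓡 e₁))
      (𝒴.incl ∘ ρ x) (𝒴.incl x)).toLinearMap.range = 2 * e₁ - e₀ := by
    intro x
    let P : EuclideanSpace ℝ (Fin e₁) × EuclideanSpace ℝ (Fin e₁) →L[ℝ]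
        EuclideanSpace ℝ (Fin e₁) × EuclideanSpace ℝ (Fin e₁) :=
      mfderiv ((𝓡 e₁).prod (𝓡 e₁)) ((𝓡 e₁).prod (𝓡 e₁)) (𝒴.incl ∘ ρ x) (𝒴.incl x)
    let Ds : EuclideanSpace ℝ (Fin e₁) →L[ℝ] EuclideanSpace ℝ (Fin e₀) :=
      mfderiv (𝓡 e₁) (𝓡 e₀) 𝒴.src (𝒴.incl x).1
    let Dt : EuclideanSpace ℝ (Fin e₁) →L[ℝ] EuclideanSpace ℝ (Fin e₀) :=
      mfderiv (𝓡 e₁) (𝓡 e₀) 𝒴.tgt (𝒴.incl x).2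
    let Λ : EuclideanSpace ℝ (Fin e₁) × EuclideanSpace ℝ (Fin e₁) →ₗ[ℝ]
        EuclideanSpace ℝ (Fin e₀) :=
      Ds.toLinearMap.comp (LinearMap.fst ℝ _ _) - Dt.toLinearMap.comp (LinearMap.snd ℝ _ _)
    have hxV := (hρι x x (hxU x)).1
    have hP : HasMFDerivAt ((𝓡 e₁).prod (𝓡 e₁)) ((𝓡 e₁).prod (𝓡 e₁)) (𝒴.incl ∘ ρ x)
        (𝒴.incl x) P :=
      (((hΩ x).contMDiffAt ((hV x).mem_nhds hxV)).mdifferentiableAt (by simp)).hasMFDerivAt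
    have hfix : (𝒴.incl ∘ ρ x) (𝒴.incl x) = 𝒴.incl x := by
      rw [comp_apply, (hρι x x (hxU x)).2]
    have h1 : P.toLinearMap.range = Λ.ker := by
      ext ⟨A, B⟩
      rw [LinearMap.mem_ker]
      change _ ↔ Ds A - Dt B = 0
      rw [sub_eq_zero]
      constructor
      · rintro ⟨v, hv⟩
        have h2 := 𝒴.mfderiv_src_eq_mfderiv_tgt hs.contMDiff ht.contMDiff hP
          (Eventually.of_forall fun z => (ρ x z).2) v
        rw [hfix] at h2
        have h3 : P v = (A, B) := hv
        rw [h3] at h2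
        exact h2
      · exact fun h => ⟨(A, B), hdΩ x A B h⟩
    have h2 : Λ.range = ⊤ := by
      rw [LinearMap.range_eq_top]
      intro C
      obtain ⟨A, hA⟩ := hs.mfderiv_surjective _ C
      refine ⟨(A, 0), ?_⟩
      change Ds A - Dt 0 = C
      rw [map_zero, sub_zero]
      exact hA
    have h3 := Λ.finrank_range_add_finrank_ker
    rw [h2, ← h1, finrank_top, Module.finrank_prod, finrank_euclideanSpace_fin,
      finrank_euclideanSpace_fin, ← two_mul] at h3
    change Module.finrank ℝ P.toLinearMap.range = _
    omega
  obtain ⟨cs, hm, hι, hρ⟩ := exists_isManifold_of_local_retracts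
    (I := (𝓡 e₁).prod (𝓡 e₁)) (e := 2 * e₁ - e₀) (ι := fun _ => 𝒴.incl) (ρ := ρ) (U := U) (V := V)
    hU hxU hV (fun x => (hρι x x (hxU x)).1) (fun _ => 𝒴.continuous_incl.continuousOn) hρc
    (fun x y hy => (hρι x y hy).2) (fun x _ => (hΩ x).mono inter_subset_left) hrank
  have hιs : ContMDiff (𝓡 (2 * e₁ - e₀)) ((𝓡 e₁).prod (𝓡 e₁)) ∞ 𝒴.incl := fun x =>
    (hι x).contMDiffAt ((hU x).mem_nhds (hxU x))
  refine ⟨cs, hm, hιs, fun x => ?_⟩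
  have h1 : HasMFDerivAt ((𝓡 e₁).prod (𝓡 e₁)) (𝓡 (2 * e₁ - e₀)) (ρ x) (𝒴.incl x) _ :=
    (((hρ x).contMDiffAt ((hV x).mem_nhds (hρι x x (hxU x)).1)).mdifferentiableAt
      (by simp)).hasMFDerivAt
  have h2 := HasMFDerivAt.comp x h1 (hιs.mdifferentiable (by simp) x).hasMFDerivAt
  have h3 := h2.congr_of_eventuallyEq (f₁ := id) (by
    filter_upwards [(hU x).mem_nhds (hxU x)] with y hy using (hρι x y hy).2.symm)
  have h4 := hasMFDerivAt_unique h3 (hasMFDerivAt_id x)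
  exact LeftInverse.injective (g := mfderiv ((𝓡 e₁).prod (𝓡 e₁)) (𝓡 (2 * e₁ - e₀)) (ρ x) (𝒴.incl x))
    fun v => DFunLike.congr_fun h4 v

section Smooth

variable {e₂ : ℕ} {𝒴 : GroupoidStr Y₁ Y₀} [ChartedSpace (EuclideanSpace ℝ (Fin e₂)) 𝒴.Comp]
  [IsManifold (𝓡 e₂) ∞ 𝒴.Comp]

/-- A map into the composable pairs is smooth if its two components are. -/
theorem contMDiff_comp_mk {E : Type*} [NormedAddCommGroup E] [NormedSpace ℝ E]
    {H : Type*} [TopologicalSpace H] {I : ModelWithCorners ℝ E H} {Z : Type*} [TopologicalSpace Z]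
    [ChartedSpace H Z]
    (hι : ContMDiff (𝓡 e₂) ((𝓡 e₁).prod (𝓡 e₁)) ∞ 𝒴.incl)
    (hi : ∀ x, Injective (mfderiv (𝓡 e₂) ((𝓡 e₁).prod (𝓡 e₁)) 𝒴.incl x))
    {f : Z → 𝒴.Comp} (h1 : ContMDiff I (𝓡 e₁) ∞ (fun z => (f z).1.1))
    (h2 : ContMDiff I (𝓡 e₁) ∞ (fun z => (f z).1.2)) : ContMDiff I (𝓡 e₂) ∞ f := by
  intro z
  refine ContMDiffAt.of_immersion_comp (f := 𝒴.incl) ((h1 z).prodMk (h2 z)) ?_ hι (hi _)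
  exact (𝒴.isInducing_incl.continuous_iff.2
    (h1.continuous.prodMk h2.continuous)).continuousAt

/-- A pair of tangent vectors `(A, B)` with `ds A = dt B` is tangent to the space of composable
pairs. -/
theorem exists_tangent_comp
    (hι : ContMDiff (𝓡 e₂) ((𝓡 e₁).prod (𝓡 e₁)) ∞ 𝒴.incl)
    (hi : ∀ x, Injective (mfderiv (𝓡 e₂) ((𝓡 e₁).prod (𝓡 e₁)) 𝒴.incl x))
    (hs : IsSurjSubmersion e₁ e₀ 𝒴.src) (ht : IsSurjSubmersion e₁ e₀ 𝒴.tgt)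
    (x : 𝒴.Comp) (A B : EuclideanSpace ℝ (Fin e₁))
    (hAB : (mfderiv (𝓡 e₁) (𝓡 e₀) 𝒴.src (𝒴.fstMap x) A : EuclideanSpace ℝ (Fin e₀)) =
      mfderiv (𝓡 e₁) (𝓡 e₀) 𝒴.tgt (𝒴.sndMap x) B) :
    ∃ v : TangentSpace (𝓡 e₂) x, mfderiv (𝓡 e₂) ((𝓡 e₁).prod (𝓡 e₁)) 𝒴.incl x v = (A, B) := by
  obtain ⟨ρ, V, U, hV, hU, hxU, hρι, hρc, hΩ, hdΩ⟩ := 𝒴.exists_retraction hs ht x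
  obtain ⟨hxV, hρx⟩ := hρι x hxU
  have h1 : ContMDiffAt ((𝓡 e₁).prod (𝓡 e₁)) (𝓡 e₂) ∞ ρ (𝒴.incl x) :=
    ContMDiffAt.of_immersion_comp (f := 𝒴.incl) (hΩ.contMDiffAt (hV.mem_nhds hxV))
      (hρc.continuousAt (hV.mem_nhds hxV)) hι (hi _)
  have h2 : HasMFDerivAt (𝓡 e₂) ((𝓡 e₁).prod (𝓡 e₁)) 𝒴.incl (ρ (𝒴.incl x))
      (mfderiv (𝓡 e₂) ((𝓡 e₁).prod (𝓡 e₁)) 𝒴.incl x) := by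
    rw [hρx]
    exact (hι.mdifferentiable (by simp) x).hasMFDerivAt
  have h3 := HasMFDerivAt.comp (f := ρ) (g := 𝒴.incl) (𝒴.incl x) h2
    (h1.mdifferentiableAt (by simp)).hasMFDerivAt
  exact ⟨mfderiv ((𝓡 e₁).prod (𝓡 e₁)) (𝓡 e₂) ρ (𝒴.incl x) (A, B),
    (DFunLike.congr_fun h3.mfderiv (A, B)).symm.trans (hdΩ A B hAB)⟩

end Smooth

end GroupoidStr

namespace LieGroupoid

variable {e₂ : ℕ} (𝒴 : LieGroupoid e₁ e₀ e₂ Y₁ Y₀)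

theorem contMDiff_incl : ContMDiff (𝓡 e₂) ((𝓡 e₁).prod (𝓡 e₁)) ∞ 𝒴.incl := 𝒴.contMDiff_incl₂

theorem contMDiff_fstMap : ContMDiff (𝓡 e₂) (𝓡 e₁) ∞ 𝒴.fstMap :=
  contMDiff_fst.comp 𝒴.contMDiff_incl

theorem contMDiff_sndMap : ContMDiff (𝓡 e₂) (𝓡 e₁) ∞ 𝒴.sndMap :=
  contMDiff_snd.comp 𝒴.contMDiff_incl

/-- A pair of tangent vectors `(A, B)` with `ds A = dt B` is tangent to the space of composable
pairs. -/
theorem exists_tangent_comp (x : 𝒴.Comp) (A B : EuclideanSpace ℝ (Fin e₁))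
    (hAB : (mfderiv (𝓡 e₁) (𝓡 e₀) 𝒴.src (𝒴.fstMap x) A : EuclideanSpace ℝ (Fin e₀)) =
      mfderiv (𝓡 e₁) (𝓡 e₀) 𝒴.tgt (𝒴.sndMap x) B) :
    ∃ v : TangentSpace (𝓡 e₂) x, mfderiv (𝓡 e₂) (𝓡 e₁) 𝒴.fstMap x v = A ∧
      mfderiv (𝓡 e₂) (𝓡 e₁) 𝒴.sndMap x v = B := by
  obtain ⟨v, hv⟩ := GroupoidStr.exists_tangent_comp 𝒴.contMDiff_incl 𝒴.immersion_incl₂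
    𝒴.src_submersion 𝒴.tgt_submersion x A B hAB
  have h5 := (𝒴.contMDiff_incl.mdifferentiable (by simp) x).hasMFDerivAt
  have h6 := HasMFDerivAt.comp (g := Prod.fst) x (hasMFDerivAt_fst (𝒴.incl x)) h5
  have h7 := HasMFDerivAt.comp (g := Prod.snd) x (hasMFDerivAt_snd (𝒴.incl x)) h5
  exact ⟨v, (DFunLike.congr_fun h6.mfderiv v).trans (congrArg Prod.fst hv),
    (DFunLike.congr_fun h7.mfderiv v).trans (congrArg Prod.snd hv)⟩

end LieGroupoid

end ComposablePairs

/-! ### Push-forward of inner products -/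

section HorizontalLinearAlgebra

open Function ContinuousLinearMap

variable {E F : Type*} [NormedAddCommGroup E] [NormedSpace ℝ E] [FiniteDimensional ℝ E]
  [NormedAddCommGroup F] [NormedSpace ℝ F] [FiniteDimensional ℝ F]

/-- The bilinear form `g` is an inner product. -/
def IsInnerForm (g : E →L[ℝ] E →L[ℝ] ℝ) : Prop :=
  (∀ v w, g v w = g w v) ∧ ∀ v, v ≠ 0 → 0 < g v v

/-- The form `h` is the push-forward of the form `g` by `D`: the map `D` is isometric on
the `g`-orthogonal complement of its kernel. -/
def IsPushforwardForm (g : E →L[ℝ] E →L[ℝ] ℝ) (D : E →L[ℝ] F) (h : F →L[ℝ] F →L[ℝ] ℝ) : Prop :=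
  ∀ v w, (∀ z, D z = 0 → g v z = 0) → (∀ z, D z = 0 → g w z = 0) → h (D v) (D w) = g v w

/-- The form on the dual of `F` obtained from the form dual to `g` by restriction along the
transpose of `D`. -/
noncomputable def dualPushforward (g : E →L[ℝ] E →L[ℝ] ℝ) (D : E →L[ℝ] F) : (F →L[ℝ] ℝ) →L[ℝ] F :=
  D.comp ((inverse g).comp ((compL ℝ E F ℝ).flip D))

/-- The push-forward of an inner product `g` by a surjective map `D`, by a formula that is visibly
smooth in `g` and `D`: the dual of the restriction of the dual of `g`. -/
noncomputable def pushforwardForm (g : E →L[ℝ] E →L[ℝ] ℝ) (D : E →L[ℝ] F) :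
    F →L[ℝ] F →L[ℝ] ℝ :=
  inverse (dualPushforward g D)

/-- An injective linear map between spaces of the same finite dimension, as an equivalence. -/
theorem exists_equiv_of_injective_of_finrank_eq {A : E →L[ℝ] F} (hA : Injective A)
    (h : Module.finrank ℝ E = Module.finrank ℝ F) : ∃ e : E ≃L[ℝ] F, (e : E →L[ℝ] F) = A :=
  ⟨(LinearEquiv.ofInjectiveOfFinrankEq A.toLinearMap hA h).toContinuousLinearEquiv, by ext; rfl⟩

theorem finrank_continuousDual : Module.finrank ℝ (E →L[ℝ] ℝ) = Module.finrank ℝ E := by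
  rw [← Subspace.dual_finrank_eq (K := ℝ) (V := E)]
  exact (LinearMap.toContinuousLinearMap (𝕜 := ℝ) (E := E) (F' := ℝ)).symm.finrank_eq

variable {g : E →L[ℝ] E →L[ℝ] ℝ} {D : E →L[ℝ] F}

theorem IsInnerForm.exists_equiv (hg : IsInnerForm g) :
    ∃ e : E ≃L[ℝ] (E →L[ℝ] ℝ), (e : E →L[ℝ] E →L[ℝ] ℝ) = g := by
  refine exists_equiv_of_injective_of_finrank_eq ?_ finrank_continuousDual.symm
  rw [injective_iff_map_eq_zero]
  intro v hv
  by_contra h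
  have h1 := hg.2 v h
  rw [hv] at h1
  exact lt_irrefl _ h1

theorem IsInnerForm.apply_inverse (hg : IsInnerForm g) (l : E →L[ℝ] ℝ) : g (inverse g l) = l := by
  obtain ⟨i, rfl⟩ := hg.exists_equiv
  rw [inverse_equiv]
  exact i.apply_symm_apply l

/-- The dual form restricts to a nondegenerate form on the dual of `F`, as it is definite and the
transpose of a surjective map is injective. -/
theorem exists_equiv_dualPushforward (hg : IsInnerForm g) (hD : Surjective D) :
    ∃ e : (F →L[ℝ] ℝ) ≃L[ℝ] F, (e : (F →L[ℝ] ℝ) →L[ℝ] F) = dualPushforward g D := by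
  refine exists_equiv_of_injective_of_finrank_eq ?_ finrank_continuousDual
  obtain ⟨e, rfl⟩ := hg.exists_equiv
  rw [injective_iff_map_eq_zero]
  intro l hl
  have h1 : D (e.symm (l.comp D)) = 0 := by
    simpa [dualPushforward, inverse_equiv] using hl
  have h2 : e.symm (l.comp D) = 0 := by
    by_contra h
    have h3 := hg.2 _ h
    simp only [ContinuousLinearEquiv.coe_coe, ContinuousLinearEquiv.apply_symm_apply] at h3
    have h4 : 0 < l (D (e.symm (l.comp D))) := h3
    rw [h1, map_zero] at h4
    exact lt_irrefl _ h4
  have h3 : l.comp D = 0 := by simpa using h2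
  ext u
  obtain ⟨v, rfl⟩ := hD u
  exact DFunLike.congr_fun h3 v

/-- Every vector `u` has a horizontal lift `v`; its inner product with any vector is computed by the
push-forward. -/
theorem exists_horizontal_lift (hg : IsInnerForm g) (hD : Surjective D) (u : F) :
    ∃ v, D v = u ∧ ∀ z, g v z = pushforwardForm g D u (D z) := by
  obtain ⟨e, he⟩ := exists_equiv_dualPushforward hg hD
  have h1 : dualPushforward g D (pushforwardForm g D u) = u := by
    rw [pushforwardForm, ← he, inverse_equiv]
    exact e.apply_symm_apply u
  refine ⟨inverse g ((pushforwardForm g D u).comp D), h1, fun z => ?_⟩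
  rw [hg.apply_inverse]
  rfl

theorem exists_horizontal_lift' (hg : IsInnerForm g) (hD : Surjective D) (u : F) :
    ∃ v, D v = u ∧ ∀ z, D z = 0 → g v z = 0 := by
  obtain ⟨v, h1, h2⟩ := exists_horizontal_lift hg hD u
  exact ⟨v, h1, fun z hz => by rw [h2, hz, map_zero]⟩

/-- Horizontal lifts are unique. -/
theorem horizontal_ext (hg : IsInnerForm g) {v v' : E} (h : D v = D v')
    (hv : ∀ z, D z = 0 → g v z = 0) (hv' : ∀ z, D z = 0 → g v' z = 0) : v = v' := by
  by_contra hne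
  have h1 := hg.2 (v - v') (sub_ne_zero.2 hne)
  have h2 : D (v - v') = 0 := by rw [map_sub, h, sub_self]
  have h3 : g (v - v') (v - v') = g v (v - v') - g v' (v - v') :=
    DFunLike.congr_fun (map_sub g v v') (v - v')
  rw [h3, hv _ h2, hv' _ h2, sub_zero] at h1
  exact lt_irrefl _ h1

theorem isPushforwardForm_pushforwardForm (hg : IsInnerForm g) (hD : Surjective D) :
    IsPushforwardForm g D (pushforwardForm g D) := by
  intro v w hv hw
  obtain ⟨v', h1, h2⟩ := exists_horizontal_lift hg hD (D v)
  have h3 : v = v' := horizontal_ext hg h1.symm hv fun z hz => by rw [h2, hz, map_zero]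
  rw [← h2, ← h3]

theorem IsPushforwardForm.unique (hg : IsInnerForm g) (hD : Surjective D)
    {h h' : F →L[ℝ] F →L[ℝ] ℝ} (hh : IsPushforwardForm g D h) (hh' : IsPushforwardForm g D h') :
    h = h' := by
  ext u u'
  obtain ⟨v, rfl, hv⟩ := exists_horizontal_lift' hg hD u
  obtain ⟨w, rfl, hw⟩ := exists_horizontal_lift' hg hD u'
  rw [hh v w hv hw, hh' v w hv hw]

theorem IsPushforwardForm.isInnerForm (hg : IsInnerForm g) (hD : Surjective D)
    {h : F →L[ℝ] F →L[ℝ] ℝ} (hh : IsPushforwardForm g D h) : IsInnerForm h := by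
  refine ⟨fun u u' => ?_, fun u hu => ?_⟩
  · obtain ⟨v, rfl, hv⟩ := exists_horizontal_lift' hg hD u
    obtain ⟨w, rfl, hw⟩ := exists_horizontal_lift' hg hD u'
    rw [hh v w hv hw, hh w v hw hv, hg.1]
  · obtain ⟨v, rfl, hv⟩ := exists_horizontal_lift' hg hD u
    rw [hh v v hv hv]
    exact hg.2 v fun h0 => hu (by rw [h0, map_zero])

/-- The isometry property of a push-forward persists if only one of the two vectors is horizontal,
as the vertical part of the other does not contribute. -/
theorem IsPushforwardForm.apply_of_horizontal (hg : IsInnerForm g) (hD : Surjective D)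
    {h : F →L[ℝ] F →L[ℝ] ℝ} (hh : IsPushforwardForm g D h) {v : E}
    (hv : ∀ z, D z = 0 → g v z = 0) (w : E) : h (D v) (D w) = g v w := by
  obtain ⟨w', h1, h2⟩ := exists_horizontal_lift' hg hD (D w)
  have h3 : g v (w - w') = 0 := hv _ (by rw [map_sub, h1, sub_self])
  rw [map_sub, sub_eq_zero] at h3
  rw [h3, ← h1, hh v w' hv h2]

/-- The unit ball of the push-forward is contained in the image of the unit ball. -/
theorem isVonNBounded_of_isPushforwardForm (hg : IsInnerForm g) (hD : Surjective D)
    (hb : Bornology.IsVonNBounded ℝ {v : E | g v v < 1})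
    {h : F →L[ℝ] F →L[ℝ] ℝ} (hh : IsPushforwardForm g D h) :
    Bornology.IsVonNBounded ℝ {v : F | h v v < 1} := by
  refine (hb.image D).subset ?_
  intro u hu
  obtain ⟨v, rfl, hv⟩ := exists_horizontal_lift' hg hD u
  exact ⟨v, by rwa [Set.mem_ofPred_eq, ← hh v v hv hv], rfl⟩

/-- Inversion is smooth, so the push-forward depends smoothly on the form and on the map. -/
theorem contDiffAt_pushforwardForm (hg : IsInnerForm g) (hD : Surjective D) :
    ContDiffAt ℝ ∞ (fun p : (E →L[ℝ] E →L[ℝ] ℝ) × (E →L[ℝ] F) => pushforwardForm p.1 p.2)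
      (g, D) := by
  have : CompleteSpace E := FiniteDimensional.complete ℝ E
  have : CompleteSpace F := FiniteDimensional.complete ℝ F
  obtain ⟨e, he⟩ := exists_equiv_dualPushforward hg hD
  obtain ⟨i, hi⟩ := hg.exists_equiv
  have h1 : ContDiffAt ℝ ∞ (fun p : (E →L[ℝ] E →L[ℝ] ℝ) × (E →L[ℝ] F) => inverse p.1) (g, D) := by
    refine ContDiffAt.comp (g, D) (g := inverse) ?_ contDiffAt_fst
    change ContDiffAt ℝ ∞ inverse g
    rw [← hi]
    exact contDiffAt_map_inverse i
  have hΛ : ContDiff ℝ ∞ ((compL ℝ E F ℝ).flip) := ContinuousLinearMap.contDiff _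
  have h2 : ContDiffAt ℝ ∞ (fun p : (E →L[ℝ] E →L[ℝ] ℝ) × (E →L[ℝ] F) =>
      dualPushforward p.1 p.2) (g, D) :=
    contDiffAt_snd.clm_comp (h1.clm_comp
      (hΛ.contDiffAt.comp (g, D) contDiffAt_snd))
  refine ContDiffAt.comp (g, D) (g := inverse) ?_ h2
  change ContDiffAt ℝ ∞ inverse (dualPushforward g D)
  rw [← he]
  exact contDiffAt_map_inverse e

end HorizontalLinearAlgebra

/-! ### Riemannian submersions -/

section RiemannianSubmersions

open Filter Topology Set Function Bundle

section Differential

variable {a b c : ℕ} {L M N : Type*}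
  [TopologicalSpace L] [ChartedSpace (EuclideanSpace ℝ (Fin a)) L]
  [TopologicalSpace M] [ChartedSpace (EuclideanSpace ℝ (Fin b)) M]
  [TopologicalSpace N] [ChartedSpace (EuclideanSpace ℝ (Fin c)) N]

/-- The differential of `f` at `x`, as a linear map between the model spaces, which are the tangent
spaces by definition. -/
noncomputable def differential (a b : ℕ) {L M : Type*}
    [TopologicalSpace L] [ChartedSpace (EuclideanSpace ℝ (Fin a)) L]
    [TopologicalSpace M] [ChartedSpace (EuclideanSpace ℝ (Fin b)) M] (f : L → M) (x : L) :
    EuclideanSpace ℝ (Fin a) →L[ℝ] EuclideanSpace ℝ (Fin b) :=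
  mfderiv (𝓡 a) (𝓡 b) f x

theorem ContMDiff.hasMFDerivAt_differential {f : L → M} (hf : ContMDiff (𝓡 a) (𝓡 b) ∞ f) (x : L) :
    HasMFDerivAt (𝓡 a) (𝓡 b) f x (differential a b f x) :=
  (hf.mdifferentiable (by simp) x).hasMFDerivAt

theorem HasMFDerivAt.differential_eq {f : L → M} {x : L}
    {D : EuclideanSpace ℝ (Fin a) →L[ℝ] EuclideanSpace ℝ (Fin b)}
    (h : HasMFDerivAt (𝓡 a) (𝓡 b) f x D) : differential a b f x = D := h.mfderiv

theorem differential_comp {f : L → M} {g : M → N} (hg : ContMDiff (𝓡 b) (𝓡 c) ∞ g)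
    (hf : ContMDiff (𝓡 a) (𝓡 b) ∞ f) (x : L) :
    differential a c (g ∘ f) x = (differential b c g (f x)).comp (differential a b f x) :=
  (HasMFDerivAt.comp x (hg.hasMFDerivAt_differential (f x))
    (hf.hasMFDerivAt_differential x)).differential_eq

theorem differential_comp_apply {f : L → M} {g : M → N} (hg : ContMDiff (𝓡 b) (𝓡 c) ∞ g)
    (hf : ContMDiff (𝓡 a) (𝓡 b) ∞ f) (x : L) (v : EuclideanSpace ℝ (Fin a)) :
    differential a c (g ∘ f) x v = differential b c g (f x) (differential a b f x v) :=
  DFunLike.congr_fun (differential_comp hg hf x) v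

theorem IsSurjSubmersion.differential_surjective {f : L → M} (hf : IsSurjSubmersion a b f) (x : L) :
    Surjective (differential a b f x) := hf.mfderiv_surjective x

theorem IsSurjSubmersion.comp {f : L → M} {g : M → N} (hg : IsSurjSubmersion b c g)
    (hf : IsSurjSubmersion a b f) : IsSurjSubmersion a c (g ∘ f) where
  contMDiff := hg.contMDiff.comp hf.contMDiff
  surjective := hg.surjective.comp hf.surjective
  mfderiv_surjective x := by
    change Surjective (differential a c (g ∘ f) x)
    rw [differential_comp hg.contMDiff hf.contMDiff]
    exact (hg.differential_surjective _).comp (hf.differential_surjective x)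

/-- A smooth map whose composite with a surjective submersion is a surjective submersion
is a surjective submersion. -/
theorem IsSurjSubmersion.of_comp {f : L → M} {g : M → N} (hgf : IsSurjSubmersion a c (g ∘ f))
    (hg : ContMDiff (𝓡 b) (𝓡 c) ∞ g) (hf : IsSurjSubmersion a b f) : IsSurjSubmersion b c g where
  contMDiff := hg
  surjective := hgf.surjective.of_comp
  mfderiv_surjective y := by
    obtain ⟨x, rfl⟩ := hf.surjective y
    have h := hgf.differential_surjective x
    rw [differential_comp hg hf.contMDiff] at h
    exact Surjective.of_comp (g := differential a b f x) h

end Differential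

variable {a b c : ℕ} {L M N : Type*}
  [TopologicalSpace L] [ChartedSpace (EuclideanSpace ℝ (Fin a)) L] [IsManifold (𝓡 a) ∞ L]
  [TopologicalSpace M] [ChartedSpace (EuclideanSpace ℝ (Fin b)) M] [IsManifold (𝓡 b) ∞ M]
  [TopologicalSpace N] [ChartedSpace (EuclideanSpace ℝ (Fin c)) N] [IsManifold (𝓡 c) ∞ N]

/-- The inner product given by a Riemannian metric on the tangent space at a point. -/
def metricForm (η : RiemMetric a L) (x : L) :
    EuclideanSpace ℝ (Fin a) →L[ℝ] EuclideanSpace ℝ (Fin a) →L[ℝ] ℝ := η.inner x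

theorem isInnerForm_metricForm (η : RiemMetric a L) (x : L) : IsInnerForm (metricForm η x) :=
  ⟨η.symm x, η.pos x⟩

theorem isRiemSubmersion_iff {η : RiemMetric a L} {η' : RiemMetric b M} {f : L → M} :
    IsRiemSubmersion η η' f ↔ IsSurjSubmersion a b f ∧
      ∀ x, IsPushforwardForm (metricForm η x) (differential a b f x) (metricForm η' (f x)) :=
  ⟨fun h => ⟨h.submersion, h.isometric⟩, fun h => ⟨h.1, h.2⟩⟩

theorem tangentMap_eq_tangentMap_iff {f : L → M} {x y : L} {v w : EuclideanSpace ℝ (Fin a)} :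
    tangentMap (𝓡 a) (𝓡 b) f ⟨x, v⟩ = tangentMap (𝓡 a) (𝓡 b) f ⟨y, w⟩ ↔
      f x = f y ∧ differential a b f x v = differential a b f y w := by
  have h : ∀ (p q : M) (V W : EuclideanSpace ℝ (Fin b)),
      (⟨p, V⟩ : TangentBundle (𝓡 b) M) = ⟨q, W⟩ ↔ p = q ∧ V = W := by
    intro p q V W
    constructor
    · intro h
      exact ⟨congrArg TotalSpace.proj h,
        congrArg (fun z : TangentBundle (𝓡 b) M => (z.2 : EuclideanSpace ℝ (Fin b))) h⟩
    · rintro ⟨rfl, rfl⟩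
      rfl
  exact h _ _ _ _

/-- Transversality in terms of differentials between the model spaces; the tangent spaces of the
base at `f x` and at `f y` are both the model space. -/
theorem isTransverse_iff {η : RiemMetric a L} {f : L → M} :
    IsTransverse b η f ↔ ∀ x y v₁ v₂ w₁ w₂,
      (∀ z, differential a b f x z = 0 → metricForm η x v₁ z = 0) →
      (∀ z, differential a b f x z = 0 → metricForm η x v₂ z = 0) →
      (∀ z, differential a b f y z = 0 → metricForm η y w₁ z = 0) →
      (∀ z, differential a b f y z = 0 → metricForm η y w₂ z = 0) → f x = f y →
      differential a b f x v₁ = differential a b f y w₁ →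
      differential a b f x v₂ = differential a b f y w₂ →
      metricForm η x v₁ v₂ = metricForm η y w₁ w₂ := by
  constructor
  · intro h x y v₁ v₂ w₁ w₂ h1 h2 h3 h4 h5 h6 h7
    exact h x y v₁ v₂ w₁ w₂ h1 h2 h3 h4 (tangentMap_eq_tangentMap_iff.2 ⟨h5, h6⟩)
      (tangentMap_eq_tangentMap_iff.2 ⟨h5, h7⟩)
  · intro h x y v₁ v₂ w₁ w₂ h1 h2 h3 h4 h5 h6
    exact h x y v₁ v₂ w₁ w₂ h1 h2 h3 h4 (tangentMap_eq_tangentMap_iff.1 h5).1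
      (tangentMap_eq_tangentMap_iff.1 h5).2 (tangentMap_eq_tangentMap_iff.1 h6).2

theorem IsRiemSubmersion.isTransverse {η : RiemMetric a L} {η' : RiemMetric b M} {f : L → M}
    (h : IsRiemSubmersion η η' f) : IsTransverse b η f := by
  rw [isTransverse_iff]
  intro x y v₁ v₂ w₁ w₂ h1 h2 h3 h4 h5 h6 h7
  obtain ⟨-, h⟩ := isRiemSubmersion_iff.1 h
  rw [← h x v₁ v₂ h1 h2, ← h y w₁ w₂ h3 h4, h5, h6, h7]

/-- If `f` and `g ∘ f` are Riemannian submersions, so is `g`: the horizontal lift along `f` of a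
vector horizontal for `g` is horizontal for `g ∘ f`. -/
theorem IsRiemSubmersion.of_comp {η : RiemMetric a L} {η' : RiemMetric b M} {η'' : RiemMetric c N}
    {f : L → M} {g : M → N} (hgf : IsRiemSubmersion η η'' (g ∘ f))
    (hf : IsRiemSubmersion η η' f) (hg : ContMDiff (𝓡 b) (𝓡 c) ∞ g) :
    IsRiemSubmersion η' η'' g := by
  rw [isRiemSubmersion_iff] at *
  refine ⟨hgf.1.of_comp hg hf.1, fun y => ?_⟩
  obtain ⟨x, rfl⟩ := hf.1.surjective y
  have hD := hf.1.differential_surjective x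
  have hη := isInnerForm_metricForm η x
  intro v w hv hw
  obtain ⟨v', rfl, hv'⟩ := exists_horizontal_lift' hη hD v
  obtain ⟨w', rfl, hw'⟩ := exists_horizontal_lift' hη hD w
  have key : ∀ v', (∀ z, differential a b f x z = 0 → metricForm η x v' z = 0) →
      (∀ z, differential b c g (f x) z = 0 →
        metricForm η' (f x) (differential a b f x v') z = 0) →
      ∀ z, differential a c (g ∘ f) x z = 0 → metricForm η x v' z = 0 := by
    intro v' hv' h z hz
    rw [differential_comp_apply hg hf.1.contMDiff] at hz
    rw [← (hf.2 x).apply_of_horizontal hη hD hv']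
    exact h _ hz
  have h := hgf.2 x v' w' (key v' hv' hv) (key w' hw' hw)
  rw [differential_comp_apply hg hf.1.contMDiff, differential_comp_apply hg hf.1.contMDiff] at h
  rw [hf.2 x v' w' hv' hw']
  exact h

theorem IsRiemSubmersion.comp {η : RiemMetric a L} {η' : RiemMetric b M} {η'' : RiemMetric c N}
    {f : L → M} {g : M → N} (hg : IsRiemSubmersion η' η'' g) (hf : IsRiemSubmersion η η' f) :
    IsRiemSubmersion η η'' (g ∘ f) := by
  rw [isRiemSubmersion_iff] at *
  refine ⟨hg.1.comp hf.1, fun x v w hv hw => ?_⟩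
  have hD := hf.1.differential_surjective x
  have hη := isInnerForm_metricForm η x
  have hcomp := differential_comp_apply hg.1.contMDiff hf.1.contMDiff x
  have key : ∀ v, (∀ z, differential a c (g ∘ f) x z = 0 → metricForm η x v z = 0) →
      (∀ z, differential a b f x z = 0 → metricForm η x v z = 0) ∧
      ∀ z, differential b c g (f x) z = 0 →
        metricForm η' (f x) (differential a b f x v) z = 0 := by
    intro v hv
    have h1 : ∀ z, differential a b f x z = 0 → metricForm η x v z = 0 := fun z hz =>
      hv z (by rw [hcomp, hz, map_zero])
    refine ⟨h1, fun z hz => ?_⟩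
    obtain ⟨z', rfl⟩ := hD z
    rw [(hf.2 x).apply_of_horizontal hη hD h1]
    exact hv z' (by rw [hcomp, hz])
  obtain ⟨hv1, hv2⟩ := key v hv
  obtain ⟨hw1, hw2⟩ := key w hw
  rw [hcomp, hcomp, ← hf.2 x v w hv1 hw1]
  exact hg.2 (f x) _ _ hv2 hw2

/-- A smooth surjective isometric self-map is a Riemannian submersion. -/
theorem PreservesMetric.isRiemSubmersion {η : RiemMetric a L} {f : L → L}
    (h : PreservesMetric η f) (hf : ContMDiff (𝓡 a) (𝓡 a) ∞ f) (hs : Surjective f) :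
    IsRiemSubmersion η η f := by
  refine ⟨⟨hf, hs, fun x => ?_⟩, fun x v w _ _ => h x v w⟩
  have hinj : Injective (differential a a f x) := by
    rw [injective_iff_map_eq_zero]
    intro v hv
    by_contra hne
    have h1 : metricForm η (f x) (differential a a f x v) (differential a a f x v) =
      metricForm η x v v := h x v v
    have h2 := (isInnerForm_metricForm η x).2 v hne
    rw [← h1, hv, map_zero] at h2
    exact lt_irrefl _ h2
  exact (LinearMap.injective_iff_surjective (f := (differential a a f x).toLinearMap)).1 hinj

/-- A Riemannian submersion of a manifold to itself preserves the metric: its differentials are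
bijective, so that all vectors are horizontal. -/
theorem IsRiemSubmersion.preservesMetric {η : RiemMetric a L} {f : L → L}
    (h : IsRiemSubmersion η η f) : PreservesMetric η f := by
  intro x v w
  have hinj : Injective (differential a a f x) :=
    (LinearMap.injective_iff_surjective (f := (differential a a f x).toLinearMap)).2
      (h.submersion.differential_surjective x)
  have key : ∀ v : EuclideanSpace ℝ (Fin a),
      ∀ z, differential a a f x z = 0 → metricForm η x v z = 0 := by
    intro v z hz
    have h1 : z = 0 := hinj (hz.trans (map_zero _).symm)
    rw [h1, map_zero]
  exact h.isometric x v w (key v) (key w)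

/-- A Riemannian metric in the local trivialization of the tangent bundle at `x₀`. -/
noncomputable def metricInCoordinates (h : ∀ x : L, EuclideanSpace ℝ (Fin a) →L[ℝ]
    EuclideanSpace ℝ (Fin a) →L[ℝ] ℝ) (x₀ x : L) :
    EuclideanSpace ℝ (Fin a) →L[ℝ] EuclideanSpace ℝ (Fin a) →L[ℝ] ℝ :=
  ContinuousLinearMap.inCoordinates (EuclideanSpace ℝ (Fin a))
    (fun x : L => TangentSpace (𝓡 a) x) (EuclideanSpace ℝ (Fin a) →L[ℝ] ℝ)
    (fun x : L => TangentSpace (𝓡 a) x →L[ℝ] Trivial L ℝ x) x₀ x x₀ x (h x)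

/-- Smoothness of a field of bilinear forms, as a section of the bundle of bilinear forms, is
smoothness of its coordinate expression. -/
theorem contMDiffAt_metric_iff {h : ∀ x : L, EuclideanSpace ℝ (Fin a) →L[ℝ]
    EuclideanSpace ℝ (Fin a) →L[ℝ] ℝ} {x₀ : L} :
    ContMDiffAt (𝓡 a) ((𝓡 a).prod 𝓘(ℝ, EuclideanSpace ℝ (Fin a) →L[ℝ]
        EuclideanSpace ℝ (Fin a) →L[ℝ] ℝ)) ∞
      (fun x => TotalSpace.mk' (EuclideanSpace ℝ (Fin a) →L[ℝ] EuclideanSpace ℝ (Fin a) →L[ℝ] ℝ)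
        (E := fun x : L => TangentSpace (𝓡 a) x →L[ℝ] TangentSpace (𝓡 a) x →L[ℝ] ℝ) x (h x)) x₀ ↔
    ContMDiffAt (𝓡 a) 𝓘(ℝ, EuclideanSpace ℝ (Fin a) →L[ℝ] EuclideanSpace ℝ (Fin a) →L[ℝ] ℝ) ∞
      (metricInCoordinates h x₀) x₀ := by
  refine (contMDiffAt_hom_bundle _).trans ?_
  exact ⟨fun h => h.2, fun h => ⟨contMDiffAt_id, h⟩⟩

end RiemannianSubmersions

/-! ### Push-forward of Riemannian metrics -/

section PushforwardMetric

open Filter Topology Set Function Bundle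

variable {a b : ℕ} {L M : Type*}
  [TopologicalSpace L] [ChartedSpace (EuclideanSpace ℝ (Fin a)) L] [IsManifold (𝓡 a) ∞ L]
  [TopologicalSpace M] [ChartedSpace (EuclideanSpace ℝ (Fin b)) M] [IsManifold (𝓡 b) ∞ M]

/-- The local frame of the tangent bundle at `x₀`, as a map from the model space to the tangent
space at `x`. -/
noncomputable def frameAt (x₀ x : L) : EuclideanSpace ℝ (Fin a) →L[ℝ] EuclideanSpace ℝ (Fin a) :=
  (trivializationAt (EuclideanSpace ℝ (Fin a)) (fun x : L => TangentSpace (𝓡 a) x) x₀).symmL ℝ x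

/-- The local coframe of the tangent bundle at `x₀`, inverse to the frame. -/
noncomputable def coframeAt (x₀ x : L) :
    EuclideanSpace ℝ (Fin a) →L[ℝ] EuclideanSpace ℝ (Fin a) :=
  (trivializationAt (EuclideanSpace ℝ (Fin a))
    (fun x : L => TangentSpace (𝓡 a) x) x₀).continuousLinearMapAt ℝ x

theorem eventually_mem_baseSet (x₀ : L) : ∀ᶠ x in 𝓝 x₀,
    x ∈ (trivializationAt (EuclideanSpace ℝ (Fin a))
      (fun x : L => TangentSpace (𝓡 a) x) x₀).baseSet :=
  (trivializationAt (EuclideanSpace ℝ (Fin a))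
    (fun x : L => TangentSpace (𝓡 a) x) x₀).open_baseSet.eventually_mem
    (mem_baseSet_trivializationAt _ _ x₀)

theorem eventually_frameAt_coframeAt (x₀ : L) : ∀ᶠ x in 𝓝 x₀,
    (∀ v : EuclideanSpace ℝ (Fin a), frameAt x₀ x (coframeAt x₀ x v) = v) ∧
      ∀ v : EuclideanSpace ℝ (Fin a), coframeAt x₀ x (frameAt x₀ x v) = v := by
  filter_upwards [eventually_mem_baseSet (a := a) x₀] with x hx
  exact ⟨fun v => Trivialization.symmL_continuousLinearMapAt _ hx v,
    fun v => Trivialization.continuousLinearMapAt_symmL _ hx v⟩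

theorem metricInCoordinates_apply (h : ∀ x : L, EuclideanSpace ℝ (Fin a) →L[ℝ]
    EuclideanSpace ℝ (Fin a) →L[ℝ] ℝ) (x₀ : L) : ∀ᶠ x in 𝓝 x₀, ∀ v w,
      metricInCoordinates h x₀ x v w = h x (frameAt x₀ x v) (frameAt x₀ x w) := by
  filter_upwards [eventually_mem_baseSet (a := a) x₀] with x hx v w
  have hA : ∀ u : EuclideanSpace ℝ (Fin a), frameAt x₀ x u =
      (trivializationAt (EuclideanSpace ℝ (Fin a))
        (fun x : L => TangentSpace (𝓡 a) x) x₀).symm x u :=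
    fun u => Trivialization.symmL_apply _ hx u
  have hT : ∀ r : ℝ, (trivializationAt ℝ (Trivial L ℝ) x₀).linearMapAt ℝ x r = r := by
    intro r
    rw [Trivialization.coe_linearMapAt_of_mem _ (mem_univ x)]
    rfl
  refine ((inCoordinates_apply_eq₂ hx hx (mem_univ x)).trans (hT _)).trans ?_
  rw [hA v, hA w]
  rfl

/-- The differential of a smooth map is smooth when read in local frames. -/
theorem contMDiffAt_differential_inCoordinates {f : L → M} (hf : ContMDiff (𝓡 a) (𝓡 b) ∞ f)
    (x₀ : L) : ContMDiffAt (𝓡 a) 𝓘(ℝ, EuclideanSpace ℝ (Fin a) →L[ℝ] EuclideanSpace ℝ (Fin b)) ∞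
      (fun x => (coframeAt (f x₀) (f x)).comp ((differential a b f x).comp (frameAt x₀ x))) x₀ :=
  ContMDiffAt.mfderiv_const (hf x₀) (by simp)

/-- A metric on the source of a surjective submersion which is transverse to it can be pushed
forward to the target.  The form at `f x` does not depend on the choice of `x` by transversality;
it is smooth since near each point it is computed along a smooth local section of `f`. -/
theorem exists_isRiemSubmersion_of_isTransverse {η : RiemMetric a L} {f : L → M}
    (hf : IsSurjSubmersion a b f) (ht : IsTransverse b η f) :
    ∃ η' : RiemMetric b M, IsRiemSubmersion η η' f := by
  rw [isTransverse_iff] at ht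
  have hη := isInnerForm_metricForm η
  have hD := hf.differential_surjective
  choose r hr using hf.surjective
  let h : ∀ y : M, EuclideanSpace ℝ (Fin b) →L[ℝ] EuclideanSpace ℝ (Fin b) →L[ℝ] ℝ := fun y =>
    pushforwardForm (metricForm η (r y)) (differential a b f (r y))
  have hh : ∀ x, IsPushforwardForm (metricForm η x) (differential a b f x) (h (f x)) := by
    intro x v w hv hw
    obtain ⟨v', h1, hv'⟩ :=
      exists_horizontal_lift' (hη (r (f x))) (hD (r (f x))) (differential a b f x v)
    obtain ⟨w', h2, hw'⟩ :=
      exists_horizontal_lift' (hη (r (f x))) (hD (r (f x))) (differential a b f x w)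
    rw [ht x (r (f x)) v w v' w' hv hw hv' hw' (hr (f x)).symm h1.symm h2.symm, ← h1, ← h2]
    exact isPushforwardForm_pushforwardForm (hη _) (hD _) v' w' hv' hw'
  have hin : ∀ y, IsInnerForm (h y) := by
    intro y
    obtain ⟨x, rfl⟩ := hf.surjective y
    exact (hh x).isInnerForm (hη x) (hD x)
  have hsm : ∀ y₀, ContMDiffAt (𝓡 b)
      𝓘(ℝ, EuclideanSpace ℝ (Fin b) →L[ℝ] EuclideanSpace ℝ (Fin b) →L[ℝ] ℝ) ∞
      (metricInCoordinates h y₀) y₀ := by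
    intro y₀
    obtain ⟨x₀, rfl⟩ := hf.surjective y₀
    obtain ⟨σ, hσ1, hσ2, hσ3⟩ := hf.contMDiff.exists_local_section (hf.mfderiv_surjective x₀)
    have hG : ContMDiffAt (𝓡 a)
        𝓘(ℝ, EuclideanSpace ℝ (Fin a) →L[ℝ] EuclideanSpace ℝ (Fin a) →L[ℝ] ℝ) ∞
        (metricInCoordinates (metricForm η) x₀) x₀ := contMDiffAt_metric_iff.1 (η.contMDiff x₀)
    have hDc := contMDiffAt_differential_inCoordinates hf.contMDiff x₀
    have hσt : Tendsto σ (𝓝 (f x₀)) (𝓝 x₀) := by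
      have := hσ2.continuousAt.tendsto
      rwa [hσ1] at this
    -- in coordinates, the push-forward is given by the linear algebra formula
    have hform : ∀ x, (∀ v w, metricInCoordinates (metricForm η) x₀ x v w =
          metricForm η x (frameAt x₀ x v) (frameAt x₀ x w)) →
        (∀ v w, metricInCoordinates h (f x₀) (f x) v w =
          h (f x) (frameAt (f x₀) (f x) v) (frameAt (f x₀) (f x) w)) →
        ((∀ v : EuclideanSpace ℝ (Fin a), frameAt x₀ x (coframeAt x₀ x v) = v) ∧
          ∀ v : EuclideanSpace ℝ (Fin a), coframeAt x₀ x (frameAt x₀ x v) = v) →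
        ((∀ v : EuclideanSpace ℝ (Fin b), frameAt (f x₀) (f x) (coframeAt (f x₀) (f x) v) = v) ∧
          ∀ v : EuclideanSpace ℝ (Fin b), coframeAt (f x₀) (f x) (frameAt (f x₀) (f x) v) = v) →
        IsInnerForm (metricInCoordinates (metricForm η) x₀ x) ∧
        Surjective ((coframeAt (f x₀) (f x)).comp ((differential a b f x).comp (frameAt x₀ x))) ∧
        metricInCoordinates h (f x₀) (f x) = pushforwardForm
          (metricInCoordinates (metricForm η) x₀ x)
          ((coframeAt (f x₀) (f x)).comp ((differential a b f x).comp (frameAt x₀ x))) := by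
      intro x h1 h2 h3 h4
      have h5 : IsInnerForm (metricInCoordinates (metricForm η) x₀ x) := by
        refine ⟨fun v w => ?_, fun v hv => ?_⟩
        · rw [h1, h1, (hη x).1]
        · rw [h1]
          refine (hη x).2 _ fun h0 => hv ?_
          rw [← h3.2 v, h0, map_zero]
      have h6 : Surjective
          ((coframeAt (f x₀) (f x)).comp ((differential a b f x).comp (frameAt x₀ x))) := by
        intro u
        obtain ⟨v, hv⟩ := hD x (frameAt (f x₀) (f x) u)
        refine ⟨coframeAt x₀ x v, ?_⟩
        simp only [ContinuousLinearMap.comp_apply]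
        rw [h3.1, hv, h4.2]
      refine ⟨h5, h6, IsPushforwardForm.unique h5 h6 ?_ (isPushforwardForm_pushforwardForm h5 h6)⟩
      intro v w hv hw
      have key : ∀ v, (∀ z, ((coframeAt (f x₀) (f x)).comp
          ((differential a b f x).comp (frameAt x₀ x))) z = 0 →
            metricInCoordinates (metricForm η) x₀ x v z = 0) →
          ∀ z, differential a b f x z = 0 → metricForm η x (frameAt x₀ x v) z = 0 := by
        intro v hv z hz
        have h7 := hv (coframeAt x₀ x z) (by
          simp only [ContinuousLinearMap.comp_apply]
          rw [h3.1, hz, map_zero])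
        rwa [h1, h3.1] at h7
      rw [h1, h2]
      simp only [ContinuousLinearMap.comp_apply]
      rw [h4.1, h4.1]
      exact hh x _ _ (key v hv) (key w hw)
    have hev := ((metricInCoordinates_apply (metricForm η) x₀).and
      ((hf.contMDiff.continuous.tendsto x₀).eventually
        (metricInCoordinates_apply h (f x₀)))).and
      ((eventually_frameAt_coframeAt (a := a) x₀).and
        ((hf.contMDiff.continuous.tendsto x₀).eventually
        (eventually_frameAt_coframeAt (a := b) (f x₀))))
    have hev' := hev.mono fun x hx => hform x hx.1.1 hx.1.2 hx.2.1 hx.2.2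
    have h7 := contDiffAt_pushforwardForm hev'.self_of_nhds.1 hev'.self_of_nhds.2.1
    have h8 : ContMDiffAt (𝓡 a)
        𝓘(ℝ, EuclideanSpace ℝ (Fin b) →L[ℝ] EuclideanSpace ℝ (Fin b) →L[ℝ] ℝ) ∞
        (fun x => pushforwardForm (metricInCoordinates (metricForm η) x₀ x)
          ((coframeAt (f x₀) (f x)).comp ((differential a b f x).comp (frameAt x₀ x)))) x₀ :=
      ContMDiffAt.comp x₀ (g := fun p : (EuclideanSpace ℝ (Fin a) →L[ℝ]
          EuclideanSpace ℝ (Fin a) →L[ℝ] ℝ) × (EuclideanSpace ℝ (Fin a) →L[ℝ]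
          EuclideanSpace ℝ (Fin b)) => pushforwardForm p.1 p.2) h7.contMDiffAt (hG.prodMk_space hDc)
    have h9 : ContMDiffAt (𝓡 b)
        𝓘(ℝ, EuclideanSpace ℝ (Fin b) →L[ℝ] EuclideanSpace ℝ (Fin b) →L[ℝ] ℝ) ∞ _ (f x₀) :=
      ContMDiffAt.comp (f x₀) (by rw [hσ1]; exact h8) hσ2
    refine h9.congr_of_eventuallyEq ?_
    filter_upwards [hσt.eventually hev', hσ3] with y hy1 hy2
    have h10 := hy1.2.2
    rw [hy2] at h10
    simp only [comp_apply]
    rw [h10, hy2]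
  refine ⟨⟨h, fun y v w => (hin y).1 v w, fun y v hv => (hin y).2 v hv, fun y => ?_,
    fun y => contMDiffAt_metric_iff.2 (hsm y)⟩, ⟨hf, fun x v w hv hw => hh x v w hv hw⟩⟩
  obtain ⟨x, rfl⟩ := hf.surjective y
  exact isVonNBounded_of_isPushforwardForm (hη x) (hD x) (η.isVonNBounded x) (hh x)

end PushforwardMetric

/-! ### Triangles in a groupoid and their symmetries -/

namespace GroupoidStr

variable {X₁ X₀ : Type*} (𝒳 : GroupoidStr X₁ X₀)

theorem comp_congr {p p' q q' : X₁} (hp : p = p') (hq : q = q') (h : 𝒳.src p = 𝒳.tgt q) :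
    𝒳.comp p q h = 𝒳.comp p' q' (by rw [← hp, ← hq, h]) := by
  subst hp hq
  rfl

theorem comp_eq_of_eq_unit {p e : X₁} (h : 𝒳.src p = 𝒳.tgt e) (he : e = 𝒳.unit (𝒳.src p)) :
    𝒳.comp p e h = p := by
  subst he
  exact 𝒳.comp_unit p

theorem eq_comp_of_eq_unit {p e : X₁} (h : 𝒳.src e = 𝒳.tgt p) (he : e = 𝒳.unit (𝒳.tgt p)) :
    𝒳.comp e p h = p := by
  subst he
  exact 𝒳.unit_comp p

theorem eq_inv_of_comp_eq_unit {p q : X₁} (h : 𝒳.src p = 𝒳.tgt q)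
    (hu : 𝒳.comp p q h = 𝒳.unit (𝒳.tgt p)) : q = 𝒳.inv p := by
  have h1 := 𝒳.comp_assoc (𝒳.inv p) p q (𝒳.src_inv p) h
  rw [𝒳.eq_comp_of_eq_unit _ (by rw [𝒳.inv_comp, h]),
    𝒳.comp_eq_of_eq_unit _ (by rw [hu, 𝒳.src_inv])] at h1
  exact h1

theorem comp_comp_inv_cancel {p q : X₁} (h : 𝒳.src p = 𝒳.tgt q) :
    𝒳.comp (𝒳.comp p q h) (𝒳.inv q) (by rw [𝒳.src_comp, 𝒳.tgt_inv]) = p := by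
  rw [𝒳.comp_assoc p q (𝒳.inv q) h (𝒳.tgt_inv q).symm]
  exact 𝒳.comp_eq_of_eq_unit _ (by rw [𝒳.comp_inv, h])

theorem comp_inv_comp_cancel {p q : X₁} (h : 𝒳.src p = 𝒳.src q) :
    𝒳.comp (𝒳.comp p (𝒳.inv q) (by rw [h, 𝒳.tgt_inv])) q (by rw [𝒳.src_comp, 𝒳.src_inv]) = p := by
  rw [𝒳.comp_assoc p (𝒳.inv q) q (by rw [h, 𝒳.tgt_inv]) (𝒳.src_inv q)]
  exact 𝒳.comp_eq_of_eq_unit _ (by rw [𝒳.inv_comp, h])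

theorem inv_unit (x : X₀) : 𝒳.inv (𝒳.unit x) = 𝒳.unit x := by
  refine (𝒳.eq_inv_of_comp_eq_unit (by rw [𝒳.src_unit, 𝒳.tgt_unit]) ?_).symm
  exact 𝒳.comp_eq_of_eq_unit _ (by rw [𝒳.src_unit]) |>.trans (by rw [𝒳.tgt_unit])

theorem Comp.ext {𝒳 : GroupoidStr X₁ X₀} {x y : 𝒳.Comp} (h1 : 𝒳.fstMap x = 𝒳.fstMap y)
    (h2 : 𝒳.sndMap x = 𝒳.sndMap y) : x = y := Subtype.ext (Prod.ext h1 h2)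

section Triangles

variable (x : 𝒳.Comp)

theorem src_edge (i j : Fin 3) : 𝒳.src (𝒳.edge x i j) = 𝒳.tgt (𝒳.toVertex x j) := by
  rw [edge, 𝒳.src_comp, 𝒳.src_inv]

theorem tgt_edge (i j : Fin 3) : 𝒳.tgt (𝒳.edge x i j) = 𝒳.tgt (𝒳.toVertex x i) := by
  rw [edge, 𝒳.tgt_comp]

theorem edge_self (i : Fin 3) : 𝒳.edge x i i = 𝒳.unit (𝒳.tgt (𝒳.toVertex x i)) := 𝒳.comp_inv _

theorem edge_comp_edge (i j k : Fin 3) (h : 𝒳.src (𝒳.edge x i j) = 𝒳.tgt (𝒳.edge x j k)) :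
    𝒳.comp (𝒳.edge x i j) (𝒳.edge x j k) h = 𝒳.edge x i k := by
  have h1 := 𝒳.comp_assoc (𝒳.edge x i j) (𝒳.toVertex x j) (𝒳.inv (𝒳.toVertex x k))
    (𝒳.src_edge x i j) (by rw [𝒳.tgt_inv, src_toVertex, src_toVertex])
  refine h1.symm.trans (𝒳.comp_congr ?_ rfl _)
  exact 𝒳.comp_inv_comp_cancel (by rw [src_toVertex, src_toVertex])

theorem inv_edge (i j : Fin 3) : 𝒳.inv (𝒳.edge x i j) = 𝒳.edge x j i := by
  refine (𝒳.eq_inv_of_comp_eq_unit (by rw [src_edge, tgt_edge]) ?_).symm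
  rw [edge_comp_edge, edge_self, tgt_edge]

theorem edge_zero_one : 𝒳.edge x 0 1 = 𝒳.fstMap x := 𝒳.comp_comp_inv_cancel x.2

theorem edge_two (i : Fin 3) : 𝒳.edge x i 2 = 𝒳.toVertex x i := by
  refine 𝒳.comp_eq_of_eq_unit _ ?_
  rw [src_toVertex]
  exact 𝒳.inv_unit _

theorem edge_one_two : 𝒳.edge x 1 2 = 𝒳.sndMap x := 𝒳.edge_two x 1

theorem edge_zero_two : 𝒳.edge x 0 2 = 𝒳.compMap x := 𝒳.edge_two x 0

theorem compMap_permute (σ : Equiv.Perm (Fin 3)) :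
    𝒳.compMap (𝒳.permute σ x) = 𝒳.edge x (σ 0) (σ 2) := 𝒳.edge_comp_edge x _ _ _ _

theorem toVertex_permute (σ : Equiv.Perm (Fin 3)) (i : Fin 3) :
    𝒳.toVertex (𝒳.permute σ x) i = 𝒳.edge x (σ i) (σ 2) := by
  fin_cases i
  · exact 𝒳.compMap_permute x σ
  · rfl
  · change 𝒳.unit (𝒳.src (𝒳.edge x (σ 1) (σ 2))) = 𝒳.edge x (σ 2) (σ 2)
    rw [src_edge, edge_self]

theorem edge_permute (σ : Equiv.Perm (Fin 3)) (i j : Fin 3) :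
    𝒳.edge (𝒳.permute σ x) i j = 𝒳.edge x (σ i) (σ j) := by
  refine (𝒳.comp_congr (𝒳.toVertex_permute x σ i)
    ((congrArg 𝒳.inv (𝒳.toVertex_permute x σ j)).trans (𝒳.inv_edge x _ _)) _).trans ?_
  exact 𝒳.edge_comp_edge x _ _ _ _

theorem permute_permute (σ τ : Equiv.Perm (Fin 3)) :
    𝒳.permute τ (𝒳.permute σ x) = 𝒳.permute (σ * τ) x :=
  Comp.ext (𝒳.edge_permute x σ _ _) (𝒳.edge_permute x σ _ _)

theorem permute_one : 𝒳.permute 1 x = x := Comp.ext (𝒳.edge_zero_one x) (𝒳.edge_one_two x)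

theorem permute_surjective (σ : Equiv.Perm (Fin 3)) : Function.Surjective (𝒳.permute σ) :=
  fun x => ⟨𝒳.permute σ⁻¹ x, by rw [permute_permute, inv_mul_cancel, permute_one]⟩

end Triangles

variable {Y₁ Y₀ : Type*} {𝒳} {𝒴 : GroupoidStr Y₁ Y₀} {φ₁ : X₁ → Y₁} {φ₀ : X₀ → Y₀}

theorem IsHom.map_unit (h : IsHom 𝒳 𝒴 φ₁ φ₀) (x : X₀) : φ₁ (𝒳.unit x) = 𝒴.unit (φ₀ x) := by
  have hs : 𝒳.src (𝒳.unit x) = 𝒳.tgt (𝒳.unit x) := by rw [𝒳.src_unit, 𝒳.tgt_unit]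
  have h1 := h.comp _ _ hs
  rw [𝒳.comp_eq_of_eq_unit hs (by rw [𝒳.src_unit])] at h1
  have hst : 𝒴.src (φ₁ (𝒳.unit x)) = 𝒴.tgt (φ₁ (𝒳.unit x)) := by rw [h.src, h.tgt, hs]
  -- an idempotent arrow is a unit
  have h2 := 𝒴.comp_comp_inv_cancel hst
  rw [𝒴.comp_congr h1.symm rfl, 𝒴.comp_inv, h.tgt, 𝒳.tgt_unit] at h2
  exact h2.symm

theorem IsHom.map_inv (h : IsHom 𝒳 𝒴 φ₁ φ₀) (p : X₁) : φ₁ (𝒳.inv p) = 𝒴.inv (φ₁ p) := by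
  refine 𝒴.eq_inv_of_comp_eq_unit (by rw [h.src, h.tgt, 𝒳.tgt_inv]) ?_
  rw [← h.comp p (𝒳.inv p) (𝒳.tgt_inv p).symm, 𝒳.comp_inv, h.map_unit, h.tgt]

theorem IsHom.map_toVertex (h : IsHom 𝒳 𝒴 φ₁ φ₀) (x : 𝒳.Comp) (i : Fin 3) :
    φ₁ (𝒳.toVertex x i) = 𝒴.toVertex (h.map₂ x) i := by
  fin_cases i
  · exact h.comp _ _ x.2
  · rfl
  · exact (h.map_unit _).trans (congrArg 𝒴.unit (h.src _).symm)

theorem IsHom.map_edge (h : IsHom 𝒳 𝒴 φ₁ φ₀) (x : 𝒳.Comp) (i j : Fin 3) :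
    φ₁ (𝒳.edge x i j) = 𝒴.edge (h.map₂ x) i j :=
  (h.comp _ _ _).trans (𝒴.comp_congr (h.map_toVertex x i)
    ((h.map_inv _).trans (congrArg 𝒴.inv (h.map_toVertex x j))) _)

/-- Morphisms of groupoids respect the symmetries of triangles. -/
theorem IsHom.map₂_permute (h : IsHom 𝒳 𝒴 φ₁ φ₀) (σ : Equiv.Perm (Fin 3)) (x : 𝒳.Comp) :
    h.map₂ (𝒳.permute σ x) = 𝒴.permute σ (h.map₂ x) :=
  Comp.ext (h.map_edge x _ _) (h.map_edge x _ _)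

end GroupoidStr

/-! ### Criteria for transversality -/

section Transversality

open Function

variable {a b c : ℕ} {L M N : Type*}
  [TopologicalSpace L] [ChartedSpace (EuclideanSpace ℝ (Fin a)) L] [IsManifold (𝓡 a) ∞ L]
  [TopologicalSpace M] [ChartedSpace (EuclideanSpace ℝ (Fin b)) M] [IsManifold (𝓡 b) ∞ M]
  [TopologicalSpace N] [ChartedSpace (EuclideanSpace ℝ (Fin c)) N] [IsManifold (𝓡 c) ∞ N]

/-- Two Riemannian submersions `f₁`, `f₂` with `g ∘ f₁ = g ∘ f₂` that jointly reach all pairs of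
points in one fibre of `g` make the metric transverse to `g`: a horizontal vector of the base
has the same horizontal lift along `g ∘ f₁` and along `g ∘ f₂`. -/
theorem isTransverse_of_riemSubmersions {η : RiemMetric a L} {η' : RiemMetric b M}
    {f₁ f₂ : L → M} {g : M → N} (h₁ : IsRiemSubmersion η η' f₁) (h₂ : IsRiemSubmersion η η' f₂)
    (hg : ContMDiff (𝓡 b) (𝓡 c) ∞ g) (hgf : g ∘ f₁ = g ∘ f₂)
    (hp : ∀ p p', g p = g p' → ∃ x, f₁ x = p ∧ f₂ x = p') : IsTransverse c η' g := by
  rw [isTransverse_iff]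
  intro p p' v₁ v₂ w₁ w₂ hv₁ hv₂ hw₁ hw₂ hpp' h1 h2
  obtain ⟨x, rfl, rfl⟩ := hp p p' hpp'
  have hη := isInnerForm_metricForm η x
  -- the horizontal lift along `f` is horizontal for `g ∘ f`
  have key : ∀ (f : L → M), IsRiemSubmersion η η' f → ∀ v : EuclideanSpace ℝ (Fin b),
      (∀ z, differential b c g (f x) z = 0 → metricForm η' (f x) v z = 0) →
      ∃ u, differential a b f x u = v ∧ (∀ z, differential a b f x z = 0 → metricForm η x u z = 0) ∧
        ∀ z, differential a c (g ∘ f) x z = 0 → metricForm η x u z = 0 := by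
    intro f hf v hv
    rw [isRiemSubmersion_iff] at hf
    obtain ⟨u, rfl, hu⟩ := exists_horizontal_lift' hη (hf.1.differential_surjective x) v
    refine ⟨u, rfl, hu, fun z hz => ?_⟩
    rw [differential_comp_apply hg hf.1.contMDiff] at hz
    rw [← (hf.2 x).apply_of_horizontal hη (hf.1.differential_surjective x) hu]
    exact hv _ hz
  have key2 : ∀ v w, (∀ z, differential b c g (f₁ x) z = 0 → metricForm η' (f₁ x) v z = 0) →
      (∀ z, differential b c g (f₂ x) z = 0 → metricForm η' (f₂ x) w z = 0) →
      differential b c g (f₁ x) v = differential b c g (f₂ x) w →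
      ∃ u, differential a b f₁ x u = v ∧ differential a b f₂ x u = w ∧
        (∀ z, differential a b f₁ x z = 0 → metricForm η x u z = 0) ∧
        ∀ z, differential a b f₂ x z = 0 → metricForm η x u z = 0 := by
    intro v w hv hw hvw
    obtain ⟨u, hu1, hu2, hu3⟩ := key f₁ h₁ v hv
    obtain ⟨u', hu1', hu2', hu3'⟩ := key f₂ h₂ w hw
    have h3 : differential a c (g ∘ f₁) x u = differential a c (g ∘ f₁) x u' := by
      rw [differential_comp_apply hg h₁.submersion.contMDiff, hu1, hvw, hgf,
        differential_comp_apply hg h₂.submersion.contMDiff, hu1']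
    rw [← hgf] at hu3'
    have h4 : u = u' := horizontal_ext hη h3 hu3 hu3'
    subst h4
    exact ⟨u, hu1, hu1', hu2, hu2'⟩
  obtain ⟨u₁, h3, h4, h5, h6⟩ := key2 v₁ w₁ hv₁ hw₁ h1
  obtain ⟨u₂, h7, h8, h9, h10⟩ := key2 v₂ w₂ hv₂ hw₂ h2
  rw [isRiemSubmersion_iff] at h₁ h₂
  rw [← h3, ← h7, h₁.2 x u₁ u₂ h5 h9, ← h4, ← h8, h₂.2 x u₁ u₂ h6 h10]

/-- A metric is transverse to `f` if isometries over the base act transitively on the fibres. -/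
theorem isTransverse_of_isometries {η : RiemMetric a L} {f : L → N}
    (hf : ContMDiff (𝓡 a) (𝓡 c) ∞ f)
    (h : ∀ x y, f x = f y → ∃ φ : L → L, IsRiemSubmersion η η φ ∧ φ x = y ∧ f ∘ φ = f) :
    IsTransverse c η f := by
  rw [isTransverse_iff]
  intro x y v₁ v₂ w₁ w₂ hv₁ hv₂ hw₁ hw₂ hxy h1 h2
  obtain ⟨φ, hφ, rfl, hfφ⟩ := h x y hxy
  have hpres : ∀ v w, metricForm η (φ x) (differential a a φ x v) (differential a a φ x w) =
    metricForm η x v w := hφ.preservesMetric x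
  have hD : ∀ v, differential a c f (φ x) (differential a a φ x v) = differential a c f x v := by
    intro v
    rw [← differential_comp_apply hf hφ.submersion.contMDiff, hfφ]
  have key : ∀ v w, (∀ z, differential a c f x z = 0 → metricForm η x v z = 0) →
      (∀ z, differential a c f (φ x) z = 0 → metricForm η (φ x) w z = 0) →
      differential a c f x v = differential a c f (φ x) w → differential a a φ x v = w := by
    intro v w hv hw hvw
    refine horizontal_ext (isInnerForm_metricForm η (φ x)) ((hD v).trans hvw) (fun z hz => ?_) hw
    obtain ⟨z', rfl⟩ := hφ.submersion.differential_surjective x z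
    rw [hpres]
    exact hv z' (by rw [← hD, hz])
  rw [← key v₁ w₁ hv₁ hw₁ h1, ← key v₂ w₂ hv₂ hw₂ h2, hpres]

end Transversality

/-! ### The metrics induced by a 2-metric -/

namespace LieGroupoid

open Function

variable {d₁ d₀ d₂ : ℕ} {X₁ X₀ : Type*}
  [TopologicalSpace X₁] [ChartedSpace (EuclideanSpace ℝ (Fin d₁)) X₁] [IsManifold (𝓡 d₁) ∞ X₁]
  [TopologicalSpace X₀] [ChartedSpace (EuclideanSpace ℝ (Fin d₀)) X₀] [IsManifold (𝓡 d₀) ∞ X₀]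
  (𝒳 : LieGroupoid d₁ d₀ d₂ X₁ X₀)

theorem contMDiff_toVertex (i : Fin 3) :
    ContMDiff (𝓡 d₂) (𝓡 d₁) ∞ (fun x => 𝒳.toVertex x i) := by
  fin_cases i
  · exact 𝒳.contMDiff_comp
  · exact 𝒳.contMDiff_sndMap
  · exact 𝒳.contMDiff_unit.comp (𝒳.src_submersion.contMDiff.comp 𝒳.contMDiff_sndMap)

theorem contMDiff_edge (i j : Fin 3) :
    ContMDiff (𝓡 d₂) (𝓡 d₁) ∞ (fun x => 𝒳.edge x i j) :=
  𝒳.contMDiff_comp.comp (GroupoidStr.contMDiff_comp_mk 𝒳.contMDiff_incl 𝒳.immersion_incl₂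
    (f := fun x =>
    ⟨(𝒳.toVertex x i, 𝒳.inv (𝒳.toVertex x j)), by
      simp only [𝒳.tgt_inv, GroupoidStr.src_toVertex]⟩)
    (𝒳.contMDiff_toVertex i) (𝒳.contMDiff_inv.comp (𝒳.contMDiff_toVertex j)))

theorem contMDiff_permute (σ : Equiv.Perm (Fin 3)) :
    ContMDiff (𝓡 d₂) (𝓡 d₂) ∞ (𝒳.permute σ) :=
  GroupoidStr.contMDiff_comp_mk 𝒳.contMDiff_incl 𝒳.immersion_incl₂
    (𝒳.contMDiff_edge _ _) (𝒳.contMDiff_edge _ _)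

theorem isSurjSubmersion_fstMap : IsSurjSubmersion d₂ d₁ 𝒳.fstMap where
  contMDiff := 𝒳.contMDiff_fstMap
  surjective p := ⟨⟨(p, 𝒳.unit (𝒳.src p)), (𝒳.tgt_unit _).symm⟩, rfl⟩
  mfderiv_surjective x A := by
    obtain ⟨B, hB⟩ := 𝒳.tgt_submersion.differential_surjective (𝒳.sndMap x)
      (differential d₁ d₀ 𝒳.src (𝒳.fstMap x) A)
    obtain ⟨v, hv, -⟩ := 𝒳.exists_tangent_comp x A B hB.symm
    exact ⟨v, hv⟩

variable {𝒳}

theorem IsTwoMetric.isRiemSubmersion_permute {η : RiemMetric d₂ 𝒳.toGroupoidStr.Comp}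
    (hη : 𝒳.IsTwoMetric η) (σ : Equiv.Perm (Fin 3)) : IsRiemSubmersion η η (𝒳.permute σ) :=
  (hη.invariant σ).isRiemSubmersion (𝒳.contMDiff_permute σ) (𝒳.permute_surjective σ)

/-- A 2-metric induces metrics on the arrows and on the objects. -/
theorem IsTwoMetric.exists_areInducedMetrics {η : RiemMetric d₂ 𝒳.toGroupoidStr.Comp}
    (hη : 𝒳.IsTwoMetric η) : ∃ (η₁ : RiemMetric d₁ X₁) (η₀ : RiemMetric d₀ X₀),
      𝒳.AreInducedMetrics η η₁ η₀ := by
  have hm : 𝒳.fstMap ∘ 𝒳.permute (Equiv.swap 1 2) = 𝒳.compMap := by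
    funext x
    exact 𝒳.edge_zero_two x
  obtain ⟨η₁, h₁⟩ := exists_isRiemSubmersion_of_isTransverse (b := d₁) (f := 𝒳.compMap)
    (by
      rw [← hm]
      exact 𝒳.isSurjSubmersion_fstMap.comp
        (hη.isRiemSubmersion_permute (Equiv.swap 1 2)).submersion)
    hη.transverse
  have hfst : IsRiemSubmersion η η₁ 𝒳.fstMap := by
    have h := h₁.comp (hη.isRiemSubmersion_permute (Equiv.swap 1 2))
    have h' : 𝒳.compMap ∘ 𝒳.permute (Equiv.swap 1 2) = 𝒳.fstMap := by
      funext x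
      exact (𝒳.compMap_permute x _).trans (𝒳.edge_zero_one x)
    rwa [h'] at h
  have hsnd : IsRiemSubmersion η η₁ 𝒳.sndMap := by
    have h := h₁.comp (hη.isRiemSubmersion_permute (Equiv.swap 0 1))
    have h' : 𝒳.compMap ∘ 𝒳.permute (Equiv.swap 0 1) = 𝒳.sndMap := by
      funext x
      exact (𝒳.compMap_permute x _).trans (𝒳.edge_one_two x)
    rwa [h'] at h
  have hinv : IsRiemSubmersion η₁ η₁ 𝒳.inv := by
    have h := h₁.comp (hη.isRiemSubmersion_permute (Equiv.swap 0 2))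
    have h' : 𝒳.compMap ∘ 𝒳.permute (Equiv.swap 0 2) = 𝒳.inv ∘ 𝒳.compMap := by
      funext x
      refine (𝒳.compMap_permute x _).trans ?_
      rw [comp_apply, ← 𝒳.edge_zero_two x, 𝒳.inv_edge]
      rfl
    rw [h'] at h
    exact h.of_comp h₁ 𝒳.contMDiff_inv
  -- two arrows with the same source are two sides of a triangle
  have htr : IsTransverse d₀ η₁ 𝒳.src := by
    refine isTransverse_of_riemSubmersions h₁ hsnd 𝒳.src_submersion.contMDiff ?_ ?_
    · funext x
      exact 𝒳.src_comp _ _ _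
    · intro p p' h
      exact ⟨⟨(𝒳.comp p (𝒳.inv p') (by rw [h, 𝒳.tgt_inv]), p'), by
        simp only [𝒳.src_comp, 𝒳.src_inv]⟩, 𝒳.comp_inv_comp_cancel h, rfl⟩
  obtain ⟨η₀, h₀⟩ := exists_isRiemSubmersion_of_isTransverse 𝒳.src_submersion htr
  refine ⟨η₁, η₀, h₁, hfst, hsnd, h₀, ?_⟩
  have h := h₀.comp hinv
  have h' : 𝒳.src ∘ 𝒳.inv = 𝒳.tgt := funext 𝒳.src_inv
  rwa [h'] at h

end LieGroupoid

/-! ### The quotient of a groupoid by an action -/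

section OrbitGroupoid

open Function

/-- The projection of a set with a group action to the set of orbits. -/
def orbitProj (G : Type*) {X : Type*} [Group G] [MulAction G X] (x : X) :
    MulAction.orbitRel.Quotient G X := Quotient.mk _ x

section Orbits

variable {G X : Type*} [Group G] [MulAction G X]

theorem orbitProj_surjective : Surjective (orbitProj G : X → _) := Quotient.mk_surjective

theorem orbitProj_smul (g : G) (x : X) : orbitProj G (g • x) = orbitProj G x :=
  Quotient.sound (MulAction.orbitRel_apply.2 (MulAction.mem_orbit x g))

theorem exists_smul_eq_of_orbitProj_eq {x y : X} (h : orbitProj G x = orbitProj G y) :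
    ∃ g : G, g • x = y :=
  MulAction.orbitRel_apply.1 (Quotient.exact h.symm)

theorem IsFreeAction.eq_of_smul_eq_smul (free : IsFreeAction G X) {g h : G} {x : X}
    (hgh : g • x = h • x) : g = h := by
  have h1 : (h⁻¹ * g) • x = x := by rw [mul_smul, hgh, inv_smul_smul]
  exact (inv_mul_eq_one.1 (free _ _ h1)).symm

end Orbits

namespace GroupoidStr

variable {G₁ G₀ X₁ X₀ : Type*} [Group G₁] [Group G₀] [MulAction G₁ X₁] [MulAction G₀ X₀]
  {𝒢 : GroupoidStr G₁ G₀} {𝒳 : GroupoidStr X₁ X₀}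

/-- The pair of actions is a morphism of groupoids. -/
def IsAction (𝒢 : GroupoidStr G₁ G₀) (𝒳 : GroupoidStr X₁ X₀) : Prop :=
  (𝒢.prod 𝒳).IsHom 𝒳 (fun gp => gp.1 • gp.2) (fun gx => gx.1 • gx.2)

namespace IsAction

theorem src_smul (θ : IsAction 𝒢 𝒳) (g : G₁) (p : X₁) : 𝒳.src (g • p) = 𝒢.src g • 𝒳.src p :=
  θ.src (g, p)

theorem tgt_smul (θ : IsAction 𝒢 𝒳) (g : G₁) (p : X₁) : 𝒳.tgt (g • p) = 𝒢.tgt g • 𝒳.tgt p :=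
  θ.tgt (g, p)

theorem unit_smul (θ : IsAction 𝒢 𝒳) (g : G₀) (x : X₀) : 𝒳.unit (g • x) = 𝒢.unit g • 𝒳.unit x :=
  (θ.map_unit (g, x)).symm

theorem inv_smul (θ : IsAction 𝒢 𝒳) (g : G₁) (p : X₁) : 𝒳.inv (g • p) = 𝒢.inv g • 𝒳.inv p :=
  (θ.map_inv (g, p)).symm

theorem smul_composable (θ : IsAction 𝒢 𝒳) {g h : G₁} {p q : X₁} (hgh : 𝒢.src g = 𝒢.tgt h)
    (hpq : 𝒳.src p = 𝒳.tgt q) : 𝒳.src (g • p) = 𝒳.tgt (h • q) := by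
  rw [θ.src_smul, θ.tgt_smul, hgh, hpq]

theorem comp_smul (θ : IsAction 𝒢 𝒳) {g h : G₁} {p q : X₁} (hgh : 𝒢.src g = 𝒢.tgt h)
    (hpq : 𝒳.src p = 𝒳.tgt q) :
    𝒳.comp (g • p) (h • q) (θ.smul_composable hgh hpq) = 𝒢.comp g h hgh • 𝒳.comp p q hpq :=
  (θ.comp (g, p) (h, q) (Prod.ext hgh hpq)).symm

/-- If two composable pairs differ by a pair of group elements, then that pair is composable. -/
theorem composable_of_smul (θ : IsAction 𝒢 𝒳) (free₀ : IsFreeAction G₀ X₀) {g h : G₁} {p q : X₁}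
    (hpq : 𝒳.src p = 𝒳.tgt q) (h' : 𝒳.src (g • p) = 𝒳.tgt (h • q)) : 𝒢.src g = 𝒢.tgt h := by
  rw [θ.src_smul, θ.tgt_smul, hpq] at h'
  exact free₀.eq_of_smul_eq_smul h'

/-- Classes of arrows with target the class of `x` are represented by arrows with target `x`. -/
theorem exists_rep_tgt (θ : IsAction 𝒢 𝒳) {q : X₁} {x : X₀}
    (h : orbitProj G₀ (𝒳.tgt q) = orbitProj G₀ x) :
    ∃ q', orbitProj G₁ q' = orbitProj G₁ q ∧ 𝒳.tgt q' = x := by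
  obtain ⟨g, rfl⟩ := exists_smul_eq_of_orbitProj_eq h
  exact ⟨𝒢.unit g • q, orbitProj_smul _ _, by rw [θ.tgt_smul, 𝒢.tgt_unit]⟩

theorem exists_rep_src (θ : IsAction 𝒢 𝒳) {q : X₁} {x : X₀}
    (h : orbitProj G₀ (𝒳.src q) = orbitProj G₀ x) :
    ∃ q', orbitProj G₁ q' = orbitProj G₁ q ∧ 𝒳.src q' = x := by
  obtain ⟨g, rfl⟩ := exists_smul_eq_of_orbitProj_eq h
  exact ⟨𝒢.unit g • q, orbitProj_smul _ _, by rw [θ.src_smul, 𝒢.src_unit]⟩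

/-- The source map on orbits. -/
def quotSrc (θ : IsAction 𝒢 𝒳) (P : MulAction.orbitRel.Quotient G₁ X₁) :
    MulAction.orbitRel.Quotient G₀ X₀ :=
  Quotient.lift (fun p => orbitProj G₀ (𝒳.src p)) (by
    intro p q h
    obtain ⟨g, rfl⟩ := exists_smul_eq_of_orbitProj_eq (Quotient.sound h : orbitProj G₁ p = _)
    rw [θ.src_smul, orbitProj_smul]) P

/-- The target map on orbits. -/
def quotTgt (θ : IsAction 𝒢 𝒳) (P : MulAction.orbitRel.Quotient G₁ X₁) :
    MulAction.orbitRel.Quotient G₀ X₀ :=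
  Quotient.lift (fun p => orbitProj G₀ (𝒳.tgt p)) (by
    intro p q h
    obtain ⟨g, rfl⟩ := exists_smul_eq_of_orbitProj_eq (Quotient.sound h : orbitProj G₁ p = _)
    rw [θ.tgt_smul, orbitProj_smul]) P

/-- The unit map on orbits. -/
def quotUnit (θ : IsAction 𝒢 𝒳) (x : MulAction.orbitRel.Quotient G₀ X₀) :
    MulAction.orbitRel.Quotient G₁ X₁ :=
  Quotient.lift (fun x => orbitProj G₁ (𝒳.unit x)) (by
    intro x y h
    obtain ⟨g, rfl⟩ := exists_smul_eq_of_orbitProj_eq (Quotient.sound h : orbitProj G₀ x = _)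
    rw [θ.unit_smul, orbitProj_smul]) x

/-- The inversion map on orbits. -/
def quotInv (θ : IsAction 𝒢 𝒳) (P : MulAction.orbitRel.Quotient G₁ X₁) :
    MulAction.orbitRel.Quotient G₁ X₁ :=
  Quotient.lift (fun p => orbitProj G₁ (𝒳.inv p)) (by
    intro p q h
    obtain ⟨g, rfl⟩ := exists_smul_eq_of_orbitProj_eq (Quotient.sound h : orbitProj G₁ p = _)
    rw [θ.inv_smul, orbitProj_smul]) P

/-- Composable orbits have composable representatives. -/
theorem exists_composable_rep (θ : IsAction 𝒢 𝒳) (P Q : MulAction.orbitRel.Quotient G₁ X₁)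
    (h : θ.quotSrc P = θ.quotTgt Q) : ∃ p q, orbitProj G₁ p = P ∧ orbitProj G₁ q = Q ∧
      𝒳.src p = 𝒳.tgt q := by
  obtain ⟨p, rfl⟩ := orbitProj_surjective P
  obtain ⟨q, rfl⟩ := orbitProj_surjective Q
  obtain ⟨q', hq', h'⟩ := θ.exists_rep_tgt (x := 𝒳.src p) h.symm
  exact ⟨p, q', rfl, hq', h'.symm⟩

/-- The composition of orbits, through composable representatives. -/
noncomputable def quotComp (θ : IsAction 𝒢 𝒳) (P Q : MulAction.orbitRel.Quotient G₁ X₁)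
    (h : θ.quotSrc P = θ.quotTgt Q) : MulAction.orbitRel.Quotient G₁ X₁ :=
  orbitProj G₁ (𝒳.comp (θ.exists_composable_rep P Q h).choose
    (θ.exists_composable_rep P Q h).choose_spec.choose
    (θ.exists_composable_rep P Q h).choose_spec.choose_spec.2.2)

/-- The composition of orbits does not depend on the representatives: as the action on objects is
free, two composable pairs of representatives differ by a composable pair of group elements. -/
theorem quotComp_orbitProj (θ : IsAction 𝒢 𝒳) (free₀ : IsFreeAction G₀ X₀) {p q : X₁}
    (hpq : 𝒳.src p = 𝒳.tgt q)
    (h : θ.quotSrc (orbitProj G₁ p) = θ.quotTgt (orbitProj G₁ q)) :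
    θ.quotComp (orbitProj G₁ p) (orbitProj G₁ q) h = orbitProj G₁ (𝒳.comp p q hpq) := by
  have key : ∀ p' q', orbitProj G₁ p' = orbitProj G₁ p → orbitProj G₁ q' = orbitProj G₁ q →
      ∀ h' : 𝒳.src p' = 𝒳.tgt q',
        orbitProj G₁ (𝒳.comp p' q' h') = orbitProj G₁ (𝒳.comp p q hpq) := by
    intro p' q' hp hq h'
    obtain ⟨g, rfl⟩ := exists_smul_eq_of_orbitProj_eq hp.symm
    obtain ⟨k, rfl⟩ := exists_smul_eq_of_orbitProj_eq hq.symm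
    have hgk := θ.composable_of_smul free₀ hpq h'
    rw [θ.comp_smul hgk hpq, orbitProj_smul]
  have hs := (θ.exists_composable_rep _ _ h).choose_spec.choose_spec
  exact key _ _ hs.1 hs.2.1 hs.2.2

/-- The quotient of a groupoid by an action that is free on objects. -/
noncomputable def quotient (θ : IsAction 𝒢 𝒳) (free₀ : IsFreeAction G₀ X₀) :
    GroupoidStr (MulAction.orbitRel.Quotient G₁ X₁) (MulAction.orbitRel.Quotient G₀ X₀) where
  src := θ.quotSrc
  tgt := θ.quotTgt
  unit := θ.quotUnit
  inv := θ.quotInv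
  comp := θ.quotComp
  src_unit x := by
    obtain ⟨x, rfl⟩ := orbitProj_surjective x
    exact congrArg _ (𝒳.src_unit x)
  tgt_unit x := by
    obtain ⟨x, rfl⟩ := orbitProj_surjective x
    exact congrArg _ (𝒳.tgt_unit x)
  src_inv P := by
    obtain ⟨p, rfl⟩ := orbitProj_surjective P
    exact congrArg _ (𝒳.src_inv p)
  tgt_inv P := by
    obtain ⟨p, rfl⟩ := orbitProj_surjective P
    exact congrArg _ (𝒳.tgt_inv p)
  src_comp P Q h := by
    obtain ⟨p, q, rfl, rfl, hpq⟩ := θ.exists_composable_rep P Q h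
    rw [θ.quotComp_orbitProj free₀ hpq]
    exact congrArg (orbitProj G₀) (𝒳.src_comp p q hpq)
  tgt_comp P Q h := by
    obtain ⟨p, q, rfl, rfl, hpq⟩ := θ.exists_composable_rep P Q h
    rw [θ.quotComp_orbitProj free₀ hpq]
    exact congrArg (orbitProj G₀) (𝒳.tgt_comp p q hpq)
  comp_assoc P Q R h k := by
    obtain ⟨p, q, rfl, rfl, hpq⟩ := θ.exists_composable_rep P Q h
    obtain ⟨r, rfl⟩ := orbitProj_surjective R
    obtain ⟨r', hr', hqr⟩ := θ.exists_rep_tgt (x := 𝒳.src q) k.symm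
    simp only [← hr', θ.quotComp_orbitProj free₀ hpq, θ.quotComp_orbitProj free₀ hqr.symm]
    rw [θ.quotComp_orbitProj free₀ (by rw [𝒳.src_comp, hqr]),
      θ.quotComp_orbitProj free₀ (by rw [𝒳.tgt_comp, hpq]), 𝒳.comp_assoc p q r' hpq hqr.symm]
  comp_unit P := by
    obtain ⟨p, rfl⟩ := orbitProj_surjective P
    exact (θ.quotComp_orbitProj free₀ (𝒳.tgt_unit _).symm _).trans (congrArg _ (𝒳.comp_unit p))
  unit_comp P := by
    obtain ⟨p, rfl⟩ := orbitProj_surjective P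
    exact (θ.quotComp_orbitProj free₀ (𝒳.src_unit _) _).trans (congrArg _ (𝒳.unit_comp p))
  comp_inv P := by
    obtain ⟨p, rfl⟩ := orbitProj_surjective P
    exact (θ.quotComp_orbitProj free₀ (𝒳.tgt_inv _).symm _).trans (congrArg _ (𝒳.comp_inv p))
  inv_comp P := by
    obtain ⟨p, rfl⟩ := orbitProj_surjective P
    exact (θ.quotComp_orbitProj free₀ (𝒳.src_inv _) _).trans (congrArg _ (𝒳.inv_comp p))

theorem isHom_orbitProj (θ : IsAction 𝒢 𝒳) (free₀ : IsFreeAction G₀ X₀) :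
    𝒳.IsHom (θ.quotient free₀) (orbitProj G₁) (orbitProj G₀) where
  src _ := rfl
  tgt _ := rfl
  comp _ _ h := (θ.quotComp_orbitProj free₀ h (congrArg (orbitProj G₀) h)).symm

/-- The action of composable pairs of group elements on composable pairs of arrows. -/
def act₂ (θ : IsAction 𝒢 𝒳) (g : 𝒢.Comp) (x : 𝒳.Comp) : 𝒳.Comp :=
  θ.map₂ ⟨((g.1.1, x.1.1), (g.1.2, x.1.2)), Prod.ext g.2 x.2⟩

theorem compMap_act₂ (θ : IsAction 𝒢 𝒳) (g : 𝒢.Comp) (x : 𝒳.Comp) :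
    𝒳.compMap (θ.act₂ g x) = 𝒢.compMap g • 𝒳.compMap x := θ.comp_smul g.2 x.2

/-- A preimage is obtained by acting with the inverses `g⁻¹`, `h⁻¹` in the group `G₁`; it is
composable because `s(g) = t(h)` acts injectively on the objects. -/
theorem act₂_surjective (θ : IsAction 𝒢 𝒳) (g : 𝒢.Comp) : Surjective (θ.act₂ g) := by
  intro y
  refine ⟨⟨(g.1.1⁻¹ • y.1.1, g.1.2⁻¹ • y.1.2), ?_⟩,
    Comp.ext (smul_inv_smul _ _) (smul_inv_smul _ _)⟩
  have h1 := θ.src_smul g.1.1 (g.1.1⁻¹ • y.1.1)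
  have h2 := θ.tgt_smul g.1.2 (g.1.2⁻¹ • y.1.2)
  rw [smul_inv_smul] at h1 h2
  rw [y.2, h2, g.2] at h1
  exact (MulAction.injective _ h1).symm

theorem map₂_orbitProj_surjective (θ : IsAction 𝒢 𝒳) (free₀ : IsFreeAction G₀ X₀) :
    Surjective (θ.isHom_orbitProj free₀).map₂ := by
  intro y
  obtain ⟨p, q, hp, hq, hpq⟩ := θ.exists_composable_rep y.1.1 y.1.2 y.2
  exact ⟨⟨(p, q), hpq⟩, Comp.ext hp hq⟩

section Fibres

variable {𝒴 : GroupoidStr (MulAction.orbitRel.Quotient G₁ X₁) (MulAction.orbitRel.Quotient G₀ X₀)}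

/-- The fibres of the projection on composable pairs are orbits. -/
theorem exists_act₂_eq (θ : IsAction 𝒢 𝒳) (free₀ : IsFreeAction G₀ X₀)
    (π : 𝒳.IsHom 𝒴 (orbitProj G₁) (orbitProj G₀)) {x y : 𝒳.Comp} (h : π.map₂ x = π.map₂ y) :
    ∃ g, θ.act₂ g x = y := by
  obtain ⟨g, hg⟩ := exists_smul_eq_of_orbitProj_eq (congrArg Prod.fst (congrArg Subtype.val h))
  obtain ⟨k, hk⟩ := exists_smul_eq_of_orbitProj_eq (congrArg Prod.snd (congrArg Subtype.val h))
  have h1 := y.2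
  rw [← hg, ← hk] at h1
  exact ⟨⟨(g, k), θ.composable_of_smul free₀ x.2 h1⟩, Comp.ext hg hk⟩

theorem map₂_act₂ (θ : IsAction 𝒢 𝒳) (π : 𝒳.IsHom 𝒴 (orbitProj G₁) (orbitProj G₀))
    (g : 𝒢.Comp) (x : 𝒳.Comp) : π.map₂ (θ.act₂ g x) = π.map₂ x :=
  Comp.ext (orbitProj_smul _ _) (orbitProj_smul _ _)

end Fibres

end IsAction

end GroupoidStr

end OrbitGroupoid

/-! ### The quotient Lie groupoid -/

section SmoothQuotient

open Function

section Map₂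

variable {d₁ d₀ d₂ e₁ e₀ e₂ : ℕ} {X₁ X₀ Y₁ Y₀ : Type*}
  [TopologicalSpace X₁] [ChartedSpace (EuclideanSpace ℝ (Fin d₁)) X₁] [IsManifold (𝓡 d₁) ∞ X₁]
  [TopologicalSpace X₀] [ChartedSpace (EuclideanSpace ℝ (Fin d₀)) X₀] [IsManifold (𝓡 d₀) ∞ X₀]
  [TopologicalSpace Y₁] [ChartedSpace (EuclideanSpace ℝ (Fin e₁)) Y₁] [IsManifold (𝓡 e₁) ∞ Y₁]
  [TopologicalSpace Y₀] [ChartedSpace (EuclideanSpace ℝ (Fin e₀)) Y₀] [IsManifold (𝓡 e₀) ∞ Y₀]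
  {𝒳 : LieGroupoid d₁ d₀ d₂ X₁ X₀} {𝒴 : GroupoidStr Y₁ Y₀}
  [ChartedSpace (EuclideanSpace ℝ (Fin e₂)) 𝒴.Comp] [IsManifold (𝓡 e₂) ∞ 𝒴.Comp]
  {φ₁ : X₁ → Y₁} {φ₀ : X₀ → Y₀}

/-- The map on composable pairs induced by a fibration is a submersion: a tangent vector
`(V, W)` of `Y₂` is lifted by first lifting `W` to `B` and then lifting `V` to a vector with
prescribed source `dt B`. -/
theorem GroupoidStr.IsHom.isSurjSubmersion_map₂
    (hι : ContMDiff (𝓡 e₂) ((𝓡 e₁).prod (𝓡 e₁)) ∞ 𝒴.incl)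
    (hi : ∀ x, Injective (mfderiv (𝓡 e₂) ((𝓡 e₁).prod (𝓡 e₁)) 𝒴.incl x))
    (hs : ContMDiff (𝓡 e₁) (𝓡 e₀) ∞ 𝒴.src) (ht : ContMDiff (𝓡 e₁) (𝓡 e₀) ∞ 𝒴.tgt)
    (h : 𝒳.toGroupoidStr.IsHom 𝒴 φ₁ φ₀) (h₁ : IsSurjSubmersion d₁ e₁ φ₁)
    (h₀ : ContMDiff (𝓡 d₀) (𝓡 e₀) ∞ φ₀) (hsurj : Surjective h.map₂)
    (hlift : ∀ (p : X₁) (v : EuclideanSpace ℝ (Fin e₁)) (w : EuclideanSpace ℝ (Fin d₀)),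
      differential e₁ e₀ 𝒴.src (φ₁ p) v = differential d₀ e₀ φ₀ (𝒳.src p) w →
      ∃ u, differential d₁ e₁ φ₁ p u = v ∧ differential d₁ d₀ 𝒳.src p u = w) :
    IsSurjSubmersion d₂ e₂ h.map₂ := by
  have hsm : ContMDiff (𝓡 d₂) (𝓡 e₂) ∞ h.map₂ :=
    GroupoidStr.contMDiff_comp_mk hι hi (h₁.contMDiff.comp 𝒳.contMDiff_fstMap)
      (h₁.contMDiff.comp 𝒳.contMDiff_sndMap)
  refine ⟨hsm, hsurj, fun x v => ?_⟩
  let D : EuclideanSpace ℝ (Fin e₂) →L[ℝ] EuclideanSpace ℝ (Fin e₁) × EuclideanSpace ℝ (Fin e₁) :=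
    mfderiv (𝓡 e₂) ((𝓡 e₁).prod (𝓡 e₁)) 𝒴.incl (h.map₂ x)
  have hD : HasMFDerivAt (𝓡 e₂) ((𝓡 e₁).prod (𝓡 e₁)) 𝒴.incl (h.map₂ x) D :=
    (hι.mdifferentiable (by simp) _).hasMFDerivAt
  have hst : differential e₁ e₀ 𝒴.src (φ₁ (𝒳.fstMap x)) (D v).1 =
      differential e₁ e₀ 𝒴.tgt (φ₁ (𝒳.sndMap x)) (D v).2 :=
    𝒴.mfderiv_src_eq_mfderiv_tgt hs ht hD (Filter.Eventually.of_forall fun y => y.2) v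
  obtain ⟨B, hB⟩ := h₁.differential_surjective (𝒳.sndMap x) (D v).2
  have htgt : 𝒴.tgt ∘ φ₁ = φ₀ ∘ 𝒳.tgt := funext h.tgt
  have hx : 𝒳.tgt (𝒳.sndMap x) = 𝒳.src (𝒳.fstMap x) := x.2.symm
  have hB' : differential e₁ e₀ 𝒴.tgt (φ₁ (𝒳.sndMap x)) (D v).2 =
      differential d₀ e₀ φ₀ (𝒳.src (𝒳.fstMap x)) (differential d₁ d₀ 𝒳.tgt (𝒳.sndMap x) B) := by
    rw [← hB, ← differential_comp_apply ht h₁.contMDiff, htgt,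
      differential_comp_apply h₀ 𝒳.tgt_submersion.contMDiff, hx]
  obtain ⟨A, hA1, hA2⟩ := hlift (𝒳.fstMap x) (D v).1 _ (hst.trans hB')
  obtain ⟨u, hu1, hu2⟩ := 𝒳.exists_tangent_comp x A B hA2
  refine ⟨u, hi _ ?_⟩
  have h2 := HasMFDerivAt.comp (f := h.map₂) (g := 𝒴.incl) x hD (hsm.hasMFDerivAt_differential x)
  have h3 := (h₁.contMDiff.comp 𝒳.contMDiff_fstMap).hasMFDerivAt_differential x
  have h4 := (h₁.contMDiff.comp 𝒳.contMDiff_sndMap).hasMFDerivAt_differential x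
  rw [differential_comp h₁.contMDiff 𝒳.contMDiff_fstMap] at h3
  rw [differential_comp h₁.contMDiff 𝒳.contMDiff_sndMap] at h4
  have h5 := DFunLike.congr_fun (hasMFDerivAt_unique h2 (h3.prodMk h4)) u
  refine h5.trans (Prod.ext ?_ ?_)
  · exact (congrArg (differential d₁ e₁ φ₁ (𝒳.fstMap x)) hu1).trans hA1
  · exact (congrArg (differential d₁ e₁ φ₁ (𝒳.sndMap x)) hu2).trans hB

end Map₂

variable {k₁ k₀ k₂ d₁ d₀ d₂ : ℕ} {G₁ G₀ X₁ X₀ : Type*}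
  [Group G₁] [TopologicalSpace G₁] [ChartedSpace (EuclideanSpace ℝ (Fin k₁)) G₁]
  [LieGroup (𝓡 k₁) ∞ G₁]
  [Group G₀] [TopologicalSpace G₀] [ChartedSpace (EuclideanSpace ℝ (Fin k₀)) G₀]
  [LieGroup (𝓡 k₀) ∞ G₀]
  [TopologicalSpace X₁] [ChartedSpace (EuclideanSpace ℝ (Fin d₁)) X₁] [IsManifold (𝓡 d₁) ∞ X₁]
  [TopologicalSpace X₀] [ChartedSpace (EuclideanSpace ℝ (Fin d₀)) X₀] [IsManifold (𝓡 d₀) ∞ X₀]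
  [MulAction G₁ X₁] [MulAction G₀ X₀]
  {𝒢 : LieGroupoid k₁ k₀ k₂ G₁ G₀} {𝒳 : LieGroupoid d₁ d₀ d₂ X₁ X₀}

namespace IsTwoAction

theorem contMDiff_orbitMap_arrows (θ : IsTwoAction 𝒢 𝒳) (p : X₁) :
    ContMDiff (𝓡 k₁) (𝓡 d₁) ∞ (fun g : G₁ => g • p) := by
  have := θ.smooth_arrows
  exact (contMDiff_smul (I := 𝓡 k₁) (I' := 𝓡 d₁) (n := ∞) (G := G₁) (M := X₁)).comp
    (contMDiff_id.prodMk contMDiff_const)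

theorem contMDiff_orbitMap_objects (θ : IsTwoAction 𝒢 𝒳) (x : X₀) :
    ContMDiff (𝓡 k₀) (𝓡 d₀) ∞ (fun g : G₀ => g • x) := by
  have := θ.smooth_objects
  exact (contMDiff_smul (I := 𝓡 k₀) (I' := 𝓡 d₀) (n := ∞) (G := G₀) (M := X₀)).comp
    (contMDiff_id.prodMk contMDiff_const)

theorem contMDiff_smul_arrows (θ : IsTwoAction 𝒢 𝒳) (g : G₁) :
    ContMDiff (𝓡 d₁) (𝓡 d₁) ∞ (fun p : X₁ => g • p) := by
  have := θ.smooth_arrows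
  exact ContMDiffSMul.contMDiff_const_smul (I := 𝓡 k₁) g

theorem contMDiff_act₂ (θ : IsTwoAction 𝒢 𝒳) (g : 𝒢.Comp) :
    ContMDiff (𝓡 d₂) (𝓡 d₂) ∞ (θ.act₂ g) :=
  GroupoidStr.contMDiff_comp_mk 𝒳.contMDiff_incl 𝒳.immersion_incl₂
    ((θ.contMDiff_smul_arrows g.1.1).comp 𝒳.contMDiff_fstMap)
    ((θ.contMDiff_smul_arrows g.1.2).comp 𝒳.contMDiff_sndMap)

/-- The underlying action of groupoids. -/
theorem isAction (θ : IsTwoAction 𝒢 𝒳) : 𝒢.toGroupoidStr.IsAction 𝒳.toGroupoidStr := θ.isHom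

/-- The source map preserves the neutral element: `s(1)` fixes the source of any arrow `p`. -/
theorem src_one (θ : IsTwoAction 𝒢 𝒳) (free₀ : IsFreeAction G₀ X₀) (p : X₁) : 𝒢.src 1 = 1 :=
  free₀ _ (𝒳.src p) (by rw [← θ.isAction.src_smul, one_smul])

theorem isRiemSubmersion_act₂ (θ : IsTwoAction 𝒢 𝒳) {η : RiemMetric d₂ 𝒳.toGroupoidStr.Comp}
    (isometric : θ.IsIsometric η) (g : 𝒢.Comp) : IsRiemSubmersion η η (θ.act₂ g) :=
  (isometric g).isRiemSubmersion (θ.contMDiff_act₂ g) (θ.isAction.act₂_surjective g)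

/-- An isometric 2-action preserves the induced metric on the arrows, as the translation by
`g` is induced by the translation of composable pairs by `(g, 1_{s(g)})`. -/
theorem isRiemSubmersion_smul (θ : IsTwoAction 𝒢 𝒳) {η : RiemMetric d₂ 𝒳.toGroupoidStr.Comp}
    (isometric : θ.IsIsometric η) {η₁ : RiemMetric d₁ X₁} (h : IsRiemSubmersion η η₁ 𝒳.compMap)
    (g : G₁) : IsRiemSubmersion η₁ η₁ (fun p : X₁ => g • p) := by
  let γ : 𝒢.Comp := ⟨(g, 𝒢.unit (𝒢.src g)), (𝒢.tgt_unit _).symm⟩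
  have h1 := h.comp (θ.isRiemSubmersion_act₂ isometric γ)
  have h2 : 𝒳.compMap ∘ θ.act₂ γ = (fun p : X₁ => g • p) ∘ 𝒳.compMap := by
    funext x
    refine (θ.isAction.compMap_act₂ γ x).trans ?_
    have h3 : 𝒢.compMap γ = g := 𝒢.comp_unit g
    rw [h3]
    rfl
  rw [h2] at h1
  exact h1.of_comp h (θ.contMDiff_smul_arrows g)

variable {e₁ e₀ : ℕ}
  [ChartedSpace (EuclideanSpace ℝ (Fin e₁)) (MulAction.orbitRel.Quotient G₁ X₁)]
  [ChartedSpace (EuclideanSpace ℝ (Fin e₀)) (MulAction.orbitRel.Quotient G₀ X₀)]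
  [IsManifold (𝓡 e₁) ∞ (MulAction.orbitRel.Quotient G₁ X₁)]
  [IsManifold (𝓡 e₀) ∞ (MulAction.orbitRel.Quotient G₀ X₀)]

/-- Lifts of tangent vectors along the projection to the orbits with prescribed source: any
lift has the prescribed source up to a vector tangent to an orbit in the objects, and is
corrected by a vector tangent to an orbit in the arrows. -/
theorem exists_differential_lift (θ : IsTwoAction 𝒢 𝒳) (free₀ : IsFreeAction G₀ X₀)
    (h₁ : IsSurjSubmersion d₁ e₁ (orbitProj G₁ : X₁ → _))
    (h₀ : IsSurjSubmersion d₀ e₀ (orbitProj G₀ : X₀ → _))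
    (hker : ∀ (x : X₀) (c : EuclideanSpace ℝ (Fin d₀)),
      differential d₀ e₀ (orbitProj G₀ : X₀ → _) x c = 0 →
      ∃ u, differential k₀ d₀ (fun g : G₀ => g • x) 1 u = c)
    (hs : ContMDiff (𝓡 e₁) (𝓡 e₀) ∞ θ.isAction.quotSrc)
    (p : X₁) (v : EuclideanSpace ℝ (Fin e₁)) (w : EuclideanSpace ℝ (Fin d₀))
    (hvw : differential e₁ e₀ θ.isAction.quotSrc (orbitProj G₁ p) v =
      differential d₀ e₀ (orbitProj G₀ : X₀ → _) (𝒳.src p) w) :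
    ∃ u, differential d₁ e₁ (orbitProj G₁ : X₁ → _) p u = v ∧
      differential d₁ d₀ 𝒳.src p u = w := by
  obtain ⟨u₀, rfl⟩ := h₁.differential_surjective p v
  have hcomm : θ.isAction.quotSrc ∘ (orbitProj G₁ : X₁ → _) = orbitProj G₀ ∘ 𝒳.src := rfl
  rw [← differential_comp_apply hs h₁.contMDiff, hcomm,
    differential_comp_apply h₀.contMDiff 𝒳.src_submersion.contMDiff] at hvw
  -- the source of the lift `u₀` is wrong by the orbit-tangent vector given by `C`
  obtain ⟨C, hC⟩ := hker (𝒳.src p) (w - differential d₁ d₀ 𝒳.src p u₀) (by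
    rw [map_sub, hvw, sub_self])
  obtain ⟨E, hE⟩ := 𝒢.src_submersion.differential_surjective 1 C
  have hp := θ.contMDiff_orbitMap_arrows p
  refine ⟨u₀ + differential k₁ d₁ (fun g : G₁ => g • p) 1 E, ?_, ?_⟩
  · have h2 : HasMFDerivAt (𝓡 d₁) (𝓡 e₁) (orbitProj G₁ : X₁ → _) ((1 : G₁) • p)
        (differential d₁ e₁ (orbitProj G₁ : X₁ → _) p) := by
      rw [one_smul]
      exact h₁.contMDiff.hasMFDerivAt_differential p
    have h3 := HasMFDerivAt.comp (f := fun g : G₁ => g • p) (g := (orbitProj G₁ : X₁ → _)) 1 h2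
      (hp.hasMFDerivAt_differential 1)
    have h4 : ((orbitProj G₁ : X₁ → _) ∘ fun g : G₁ => g • p) = fun _ => orbitProj G₁ p :=
      funext fun g => orbitProj_smul g p
    rw [h4] at h3
    have h5 : differential d₁ e₁ (orbitProj G₁ : X₁ → _) p
        (differential k₁ d₁ (fun g : G₁ => g • p) 1 E) = 0 :=
      DFunLike.congr_fun (hasMFDerivAt_unique h3 (hasMFDerivAt_const _ _)) E
    rw [map_add, h5, add_zero]
  · have h2 : HasMFDerivAt (𝓡 d₁) (𝓡 d₀) 𝒳.src ((1 : G₁) • p) (differential d₁ d₀ 𝒳.src p) := by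
      rw [one_smul]
      exact 𝒳.src_submersion.contMDiff.hasMFDerivAt_differential p
    have h3 := HasMFDerivAt.comp (f := fun g : G₁ => g • p) (g := 𝒳.src) 1 h2
      (hp.hasMFDerivAt_differential 1)
    have h4 : (𝒳.src ∘ fun g : G₁ => g • p) = (fun g : G₀ => g • 𝒳.src p) ∘ 𝒢.src :=
      funext fun g => θ.isAction.src_smul g p
    have h5 : HasMFDerivAt (𝓡 k₀) (𝓡 d₀) (fun g : G₀ => g • 𝒳.src p) (𝒢.src 1)
        (differential k₀ d₀ (fun g : G₀ => g • 𝒳.src p) 1) := by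
      rw [θ.src_one free₀ p]
      exact (θ.contMDiff_orbitMap_objects (𝒳.src p)).hasMFDerivAt_differential 1
    have h6 := HasMFDerivAt.comp (f := 𝒢.src) (g := fun g : G₀ => g • 𝒳.src p) 1 h5
      (𝒢.src_submersion.contMDiff.hasMFDerivAt_differential 1)
    rw [h4] at h3
    have h7 : differential d₁ d₀ 𝒳.src p (differential k₁ d₁ (fun g : G₁ => g • p) 1 E) =
        differential k₀ d₀ (fun g : G₀ => g • 𝒳.src p) 1 (differential k₁ k₀ 𝒢.src 1 E) :=
      DFunLike.congr_fun (hasMFDerivAt_unique h3 h6) E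
    rw [map_add, h7, hE, hC, add_sub_cancel]

/-- The quotient of a Lie groupoid by a 2-action with smooth orbit spaces is a Lie groupoid, and the
projection is a fibration. -/
theorem exists_quotient_lieGroupoid (θ : IsTwoAction 𝒢 𝒳) (free₀ : IsFreeAction G₀ X₀)
    [T2Space (MulAction.orbitRel.Quotient G₁ X₁)] [T2Space (MulAction.orbitRel.Quotient G₀ X₀)]
    [SecondCountableTopology (MulAction.orbitRel.Quotient G₁ X₁)]
    [SecondCountableTopology (MulAction.orbitRel.Quotient G₀ X₀)]
    (h₁ : IsSurjSubmersion d₁ e₁ (orbitProj G₁ : X₁ → _))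
    (h₀ : IsSurjSubmersion d₀ e₀ (orbitProj G₀ : X₀ → _))
    (hker : ∀ (x : X₀) (c : EuclideanSpace ℝ (Fin d₀)),
      differential d₀ e₀ (orbitProj G₀ : X₀ → _) x c = 0 →
      ∃ u, differential k₀ d₀ (fun g : G₀ => g • x) 1 u = c) :
    ∃ (𝒴 : LieGroupoid e₁ e₀ (2 * e₁ - e₀) (MulAction.orbitRel.Quotient G₁ X₁)
        (MulAction.orbitRel.Quotient G₀ X₀))
      (π : LieGroupoid.IsFibration 𝒳 𝒴 (orbitProj G₁) (orbitProj G₀)),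
      IsSurjSubmersion d₂ (2 * e₁ - e₀) π.toIsHom.map₂ := by
  set τ := θ.isAction with hτ
  -- smoothness descends along the submersions `π₁` and `π₀`
  have hsc : ContMDiff (𝓡 e₁) (𝓡 e₀) ∞ τ.quotSrc := fun P => by
    obtain ⟨p, rfl⟩ := h₁.surjective P
    exact ContMDiffAt.of_comp_submersion
      ((h₀.contMDiff.comp 𝒳.src_submersion.contMDiff) p) h₁.contMDiff (h₁.mfderiv_surjective p)
  have htc : ContMDiff (𝓡 e₁) (𝓡 e₀) ∞ τ.quotTgt := fun P => by
    obtain ⟨p, rfl⟩ := h₁.surjective P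
    exact ContMDiffAt.of_comp_submersion
      ((h₀.contMDiff.comp 𝒳.tgt_submersion.contMDiff) p) h₁.contMDiff (h₁.mfderiv_surjective p)
  have huc : ContMDiff (𝓡 e₀) (𝓡 e₁) ∞ τ.quotUnit := fun x => by
    obtain ⟨x, rfl⟩ := h₀.surjective x
    exact ContMDiffAt.of_comp_submersion
      ((h₁.contMDiff.comp 𝒳.contMDiff_unit) x) h₀.contMDiff (h₀.mfderiv_surjective x)
  have hic : ContMDiff (𝓡 e₁) (𝓡 e₁) ∞ τ.quotInv := fun P => by
    obtain ⟨p, rfl⟩ := h₁.surjective P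
    exact ContMDiffAt.of_comp_submersion
      ((h₁.contMDiff.comp 𝒳.contMDiff_inv) p) h₁.contMDiff (h₁.mfderiv_surjective p)
  have hs : IsSurjSubmersion e₁ e₀ (τ.quotient free₀).src :=
    IsSurjSubmersion.of_comp (h₀.comp 𝒳.src_submersion) hsc h₁
  have ht : IsSurjSubmersion e₁ e₀ (τ.quotient free₀).tgt :=
    IsSurjSubmersion.of_comp (h₀.comp 𝒳.tgt_submersion) htc h₁
  have hlift := θ.exists_differential_lift free₀ h₁ h₀ hker hsc
  have hom := τ.isHom_orbitProj free₀
  obtain ⟨cs, hm, hι, hi⟩ := (τ.quotient free₀).exists_isManifold_comp hs ht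
  have h₂ : IsSurjSubmersion d₂ (2 * e₁ - e₀) hom.map₂ :=
    hom.isSurjSubmersion_map₂ hι hi hs.contMDiff ht.contMDiff h₁ h₀.contMDiff
      (τ.map₂_orbitProj_surjective free₀) hlift
  have hcomp : ContMDiff (𝓡 (2 * e₁ - e₀)) (𝓡 e₁) ∞ (τ.quotient free₀).compMap := fun y => by
    obtain ⟨x, rfl⟩ := h₂.surjective y
    have h3 : (τ.quotient free₀).compMap ∘ hom.map₂ = orbitProj G₁ ∘ 𝒳.compMap :=
      funext fun x => (hom.comp _ _ x.2).symm
    exact ContMDiffAt.of_comp_submersion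
      (by rw [h3]; exact (h₁.contMDiff.comp 𝒳.contMDiff_comp) x) h₂.contMDiff
      (h₂.mfderiv_surjective x)
  let 𝒴 : LieGroupoid e₁ e₀ (2 * e₁ - e₀) (MulAction.orbitRel.Quotient G₁ X₁)
      (MulAction.orbitRel.Quotient G₀ X₀) :=
    { toGroupoidStr := τ.quotient free₀
      t2_arrows := inferInstance
      t2_objects := inferInstance
      secondCountable_arrows := inferInstance
      secondCountable_objects := inferInstance
      src_submersion := hs
      tgt_submersion := ht
      contMDiff_unit := huc
      contMDiff_inv := hic
      charts₂ := cs
      isManifold₂ := hm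
      contMDiff_incl₂ := hι
      immersion_incl₂ := hi
      contMDiff_comp := hcomp }
  refine ⟨𝒴, ⟨⟨hom, h₁.contMDiff, h₀.contMDiff⟩, h₀, ?_, fun p v w h => hlift p v w h⟩, h₂⟩
  intro r x h
  obtain ⟨p, rfl⟩ := h₁.surjective r
  exact τ.exists_rep_src h

end IsTwoAction

end SmoothQuotient

/-! ### The Riemannian structure of the quotient -/

namespace LieGroupoid

variable {d₁ d₀ d₂ e₁ e₀ e₂ : ℕ} {X₁ X₀ Y₁ Y₀ : Type*}
  [TopologicalSpace X₁] [ChartedSpace (EuclideanSpace ℝ (Fin d₁)) X₁] [IsManifold (𝓡 d₁) ∞ X₁]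
  [TopologicalSpace X₀] [ChartedSpace (EuclideanSpace ℝ (Fin d₀)) X₀] [IsManifold (𝓡 d₀) ∞ X₀]
  [TopologicalSpace Y₁] [ChartedSpace (EuclideanSpace ℝ (Fin e₁)) Y₁] [IsManifold (𝓡 e₁) ∞ Y₁]
  [TopologicalSpace Y₀] [ChartedSpace (EuclideanSpace ℝ (Fin e₀)) Y₀] [IsManifold (𝓡 e₀) ∞ Y₀]
  {𝒳 : LieGroupoid d₁ d₀ d₂ X₁ X₀} {𝒴 : LieGroupoid e₁ e₀ e₂ Y₁ Y₀}
  {φ₁ : X₁ → Y₁} {φ₀ : X₀ → Y₀}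

/-- A metric on `Y₂` that is the push-forward of a 2-metric along a fibration is a 2-metric, if
also the induced metric on the arrows can be pushed forward; and then the fibration is a
Riemannian submersion in every degree. -/
theorem IsFibration.isRiemGroupoidSubmersion (π : IsFibration 𝒳 𝒴 φ₁ φ₀)
    {η : RiemMetric d₂ 𝒳.toGroupoidStr.Comp} {η₁ : RiemMetric d₁ X₁} {η₀ : RiemMetric d₀ X₀}
    {ε : RiemMetric e₂ 𝒴.toGroupoidStr.Comp} {ε₁ : RiemMetric e₁ Y₁} (hη : 𝒳.IsTwoMetric η)
    (hind : 𝒳.AreInducedMetrics η η₁ η₀) (h₂ : IsRiemSubmersion η ε π.toIsHom.map₂)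
    (h₁ : IsRiemSubmersion η₁ ε₁ φ₁) :
    𝒴.IsTwoMetric ε ∧ IsRiemGroupoidSubmersion 𝒳 𝒴 η ε φ₁ φ₀ := by
  have hm : 𝒴.compMap ∘ π.toIsHom.map₂ = φ₁ ∘ 𝒳.compMap :=
    funext fun x => (π.toIsHom.comp _ _ x.2).symm
  have hs : 𝒴.src ∘ φ₁ = φ₀ ∘ 𝒳.src := funext π.toIsHom.src
  have hε : 𝒴.IsTwoMetric ε := by
    constructor
    · intro σ
      have h := h₂.comp (hη.isRiemSubmersion_permute σ)
      have h' : π.toIsHom.map₂ ∘ 𝒳.permute σ = 𝒴.permute σ ∘ π.toIsHom.map₂ :=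
        funext fun x => π.toIsHom.map₂_permute σ x
      rw [h'] at h
      exact (h.of_comp h₂ (𝒴.contMDiff_permute σ)).preservesMetric
    · have h := h₁.comp hind.comp
      rw [← hm] at h
      exact (h.of_comp h₂ 𝒴.contMDiff_comp).isTransverse
  refine ⟨hε, ⟨π, h₂, ?_⟩⟩
  -- `ε₁'` is the metric on the arrows induced by `ε`
  obtain ⟨ε₁', ε₀', hind'⟩ := hε.exists_areInducedMetrics
  have h₁' : IsRiemSubmersion η₁ ε₁' φ₁ := by
    have h := hind'.comp.comp h₂
    rw [hm] at h
    exact h.of_comp hind.comp π.contMDiff_arrows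
  have h₀' : IsRiemSubmersion η₀ ε₀' φ₀ := by
    have h := hind'.src.comp h₁'
    rw [hs] at h
    exact h.of_comp hind.src π.contMDiff_objects
  exact ⟨η₁, η₀, ε₁', ε₀', hind, hind', h₁', h₀'⟩

end LieGroupoid

theorem mainTheorem8 {k₁ k₀ k₂ d₁ d₀ d₂ : ℕ} {G₁ G₀ X₁ X₀ : Type*}
    [Group G₁] [TopologicalSpace G₁] [ChartedSpace (EuclideanSpace ℝ (Fin k₁)) G₁]
    [LieGroup (𝓡 k₁) ∞ G₁]
    [Group G₀] [TopologicalSpace G₀] [ChartedSpace (EuclideanSpace ℝ (Fin k₀)) G₀]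
    [LieGroup (𝓡 k₀) ∞ G₀]
    [TopologicalSpace X₁] [ChartedSpace (EuclideanSpace ℝ (Fin d₁)) X₁] [IsManifold (𝓡 d₁) ∞ X₁]
    [TopologicalSpace X₀] [ChartedSpace (EuclideanSpace ℝ (Fin d₀)) X₀] [IsManifold (𝓡 d₀) ∞ X₀]
    [MulAction G₁ X₁] [MulAction G₀ X₀]
    (𝒢 : LieGroupoid k₁ k₀ k₂ G₁ G₀) (h𝒢 : IsLieTwoGroup 𝒢)
    (𝒳 : LieGroupoid d₁ d₀ d₂ X₁ X₀)
    (η : RiemMetric d₂ 𝒳.toGroupoidStr.Comp) (hη : 𝒳.IsTwoMetric η)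
    (θ : IsTwoAction 𝒢 𝒳)
    (free₁ : IsFreeAction G₁ X₁) (free₀ : IsFreeAction G₀ X₀)
    (proper₁ : ProperSMul G₁ X₁) (proper₀ : ProperSMul G₀ X₀)
    (isometric : θ.IsIsometric η) :
    ∃ (e₁ e₀ e₂ : ℕ)
      (_ : ChartedSpace (EuclideanSpace ℝ (Fin e₁)) (MulAction.orbitRel.Quotient G₁ X₁))
      (_ : ChartedSpace (EuclideanSpace ℝ (Fin e₀)) (MulAction.orbitRel.Quotient G₀ X₀))
      (_ : IsManifold (𝓡 e₁) ∞ (MulAction.orbitRel.Quotient G₁ X₁))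
      (_ : IsManifold (𝓡 e₀) ∞ (MulAction.orbitRel.Quotient G₀ X₀))
      (𝒴 : LieGroupoid e₁ e₀ e₂ (MulAction.orbitRel.Quotient G₁ X₁)
        (MulAction.orbitRel.Quotient G₀ X₀))
      (ε : RiemMetric e₂ 𝒴.toGroupoidStr.Comp),
      𝒴.IsTwoMetric ε ∧
      LieGroupoid.IsRiemGroupoidSubmersion 𝒳 𝒴 η ε
        (fun p => (Quotient.mk _ p : MulAction.orbitRel.Quotient G₁ X₁))
        (fun x => (Quotient.mk _ x : MulAction.orbitRel.Quotient G₀ X₀)) := by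
  have := θ.smooth_arrows
  have := θ.smooth_objects
  have := 𝒳.t2_arrows
  have := 𝒳.t2_objects
  have := 𝒳.secondCountable_arrows
  have := 𝒳.secondCountable_objects
  obtain ⟨cs₁, hm₁, h₁, -⟩ := exists_isManifold_orbit_quotient (k := k₁) (d := d₁) free₁
  obtain ⟨cs₀, hm₀, h₀, hker⟩ := exists_isManifold_orbit_quotient (k := k₀) (d := d₀) free₀
  have : SecondCountableTopology (MulAction.orbitRel.Quotient G₁ X₁) :=
    ContinuousConstSMul.secondCountableTopology
  have : SecondCountableTopology (MulAction.orbitRel.Quotient G₀ X₀) :=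
    ContinuousConstSMul.secondCountableTopology
  obtain ⟨𝒴, π, h₂⟩ := θ.exists_quotient_lieGroupoid free₀ h₁ h₀ hker
  obtain ⟨η₁, η₀, hind⟩ := hη.exists_areInducedMetrics
  -- `G₂` acts by isometries, transitively on the fibres of `X₂ → Y₂`
  obtain ⟨ε, hε⟩ := exists_isRiemSubmersion_of_isTransverse (η := η) h₂
    (isTransverse_of_isometries h₂.contMDiff fun x y hxy => by
      obtain ⟨g, rfl⟩ := θ.isAction.exists_act₂_eq free₀ π.toIsHom hxy
      exact ⟨θ.act₂ g, θ.isRiemSubmersion_act₂ isometric g, rfl,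
        funext fun x => θ.isAction.map₂_act₂ π.toIsHom g x⟩)
  -- `G₁` acts by isometries, transitively on the fibres of `X₁ → Y₁`
  obtain ⟨ε₁, hε₁⟩ := exists_isRiemSubmersion_of_isTransverse (η := η₁) h₁
    (isTransverse_of_isometries h₁.contMDiff fun p q hpq => by
      obtain ⟨g, rfl⟩ := exists_smul_eq_of_orbitProj_eq hpq
      exact ⟨fun p => g • p, θ.isRiemSubmersion_smul isometric hind.comp g, rfl,
        funext fun p => orbitProj_smul g p⟩)
  exact ⟨_, _, _, cs₁, cs₀, hm₁, hm₀, 𝒴, ε, π.isRiemGroupoidSubmersion hη hind hε hε₁⟩
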